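/- Let $M=\Gamma\backslash G$ be a nilmanifold, i.e. $G$ is a simply connected nilpotent (real) Lie group and $\Gamma\subset G$ is a lattice (a discrete subgroup with $\Gamma\backslash G$ compact), and let $J$ be a left-invariant complex structure on $M$, with $\dim_{\mathbb C}(M,J)=n$. Suppose that the Bott-Chern cohomology of $(M,J)$ is computed by left-invariant forms, i.e. for all $p,q$ the inclusion of the left-invariant complex forms into the smooth complex forms on $M$ induces an isomorphism $H^{p,q}_{BC}(\mathfrak g,J)\cong H^{p,q}_{BC}(M)$, where $H_{BC}=\ker d/\operatorname{im}\partial\overline\partial$. Suppose moreover that $(M,J)$ admits a coframe $\{\eta^1,\dots,\eta^n\}$ of left-invariant $(1,0)$-forms with $$d\eta^i=0\quad (i=1,\dots,n-1),\qquad d\eta^n\in\operatorname{Span}_{\mathbb C}\langle \eta^{i}\wedge\overline{\eta^{j}}\rangle_{i,j=1,\dots,n-1}.$$ Let $g$ be a left-invariant Hermitian metric on $(M,J)$ which is SKT, i.e. whose fundamental form $F(X,Y)=g(JX,Y)$ satisfies $\partial\overline\partial F=0$. Then $g$ is geometrically-Bott-Chern-formal: if $\alpha$ and $\beta$ are smooth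 forms on $M$ of types $(p,q)$ and $(r,s)$ with $\Delta_{BC}\alpha=0$ and $\Delta_{BC}\beta=0$, then $\Delta_{BC}(\alpha\wedge\beta)=0$. Here $$\Delta_{BC}=\partial\overline\partial\,\overline\partial^*\partial^*+\overline\partial^*\partial^*\partial\overline\partial+\overline\partial^*\partial\partial^*\overline\partial+\partial^*\overline\partial\,\overline\partial^*\partial+\overline\partial^*\overline\partial+\partial^*\partial,$$ with $\partial^*=-*\overline\partial*$, $\overline\partial^*=-*\partial*$, and $*$ the $\mathbb C$-linear Hodge operator of $g$ with respect to the volume form $F^n/n!$. -/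

import Mathlib

open scoped Manifold ContDiff TensorProduct

set_option linter.unusedSectionVars false

noncomputable section

namespace Nilmanifold

/-! ### Complex exterior algebra of a Lie algebra: left-invariant complex forms -/

section LieAlgebraForms

variable (L : Type*) [LieRing L] [LieAlgebra ℝ L]

/-- The complexified dual `𝔤*_ℂ`: left-invariant complex `1`-forms. -/
abbrev CDual : Type _ := L →ₗ[ℝ] ℂ

/-- The exterior algebra `⋀ 𝔤*_ℂ`: left-invariant complex forms of all degrees, with `*` as the
wedge product. -/
abbrev InvForms : Type _ := ExteriorAlgebra ℂ (CDual L)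

variable {L}

/-- Evaluation of complex `1`-forms at a vector. -/
def evalAt (v : L) : Module.Dual ℂ (CDual L) where
  toFun φ := φ v
  map_add' _ _ := rfl
  map_smul' _ _ := rfl

/-- Interior product `ι_v` with a vector `v`. -/
def interiorProd (v : L) : Module.End ℂ (InvForms L) :=
  CliffordAlgebra.contractLeft (evalAt v)

/-- Exterior multiplication `σ ↦ φ ∧ σ` by a `1`-form. -/
def wedgeLeft (φ : CDual L) : Module.End ℂ (InvForms L) :=
  LinearMap.mulLeft ℂ (ExteriorAlgebra.ι ℂ φ)

/-- Complex conjugate of a complex `1`-form. -/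
def conjForm (φ : CDual L) : CDual L :=
  Complex.conjAe.toLinearMap ∘ₗ φ

variable (L) in
/-- An auxiliary basis `e_a` of `𝔤`. No notion defined with it depends on its choice. -/
def frame [Module.Finite ℝ L] :
    Module.Basis (Fin (Module.finrank ℝ L)) ℝ L :=
  Module.finBasis ℝ L

variable (L) in
/-- The coframe `e^a` dual to `frame`, as complex-valued forms. -/
def coframe [Module.Finite ℝ L] (a : Fin (Module.finrank ℝ L)) : CDual L :=
  Complex.ofRealCLM.toLinearMap ∘ₗ (frame L).coord a

variable (L) in
/-- The Chevalley-Eilenberg differential `- ½ ∑ e^a ∧ e^b ∧ ι_[e_a, e_b]`: the antiderivation of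
`⋀ 𝔤*_ℂ` with `(dφ)(X, Y) = - φ [X, Y]` for every `1`-form `φ`. -/
def ceD [Module.Finite ℝ L] : Module.End ℂ (InvForms L) :=
  (-(1 / 2) : ℂ) • ∑ a, ∑ b,
    wedgeLeft (coframe L a) * wedgeLeft (coframe L b) * interiorProd ⁅frame L a, frame L b⁆

variable (L) in
/-- A left-invariant (integrable) complex structure, given on the Lie algebra: `J² = -id` and
`N_J = 0`. -/
structure InvComplexStructure where
  J : L →ₗ[ℝ] L
  sq : ∀ v, J (J v) = -v
  nijenhuis : ∀ v w, ⁅J v, J w⁆ - ⁅v, w⁆ - J ⁅J v, w⁆ - J ⁅v, J w⁆ = 0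

variable (𝒥 : InvComplexStructure L)

/-- `𝔤^{1,0}`: the forms with `φ ∘ J = i φ`. -/
def forms10 : Submodule ℂ (CDual L) where
  carrier := {φ | ∀ v, φ (𝒥.J v) = Complex.I * φ v}
  add_mem' {φ ψ} hφ hψ v := by simp [hφ v, hψ v, mul_add]
  zero_mem' v := by simp
  smul_mem' c φ hφ v := by simp [hφ v, mul_left_comm]

/-- `𝔤^{0,1}`: the forms with `φ ∘ J = - i φ`. -/
def forms01 : Submodule ℂ (CDual L) where
  carrier := {φ | ∀ v, φ (𝒥.J v) = -Complex.I * φ v}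
  add_mem' {φ ψ} hφ hψ v := by simp [hφ v, hψ v]; ring
  zero_mem' v := by simp
  smul_mem' c φ hφ v := by simp [hφ v, mul_left_comm]

/-- `⋀^{p,q} 𝔤 = ⋀^p 𝔤^{1,0} ⊗ ⋀^q 𝔤^{0,1}`: the span of the products of `p` elements of
`𝔤^{1,0}` and `q` elements of `𝔤^{0,1}`. -/
def invBidegree (p q : ℕ) : Submodule ℂ (InvForms L) :=
  (forms10 𝒥).map (ExteriorAlgebra.ι ℂ) ^ p * (forms01 𝒥).map (ExteriorAlgebra.ι ℂ) ^ q

/-- The endomorphism `φ ↦ φ ∘ J` of `𝔤*_ℂ`. -/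
def precompJ : Module.End ℂ (CDual L) where
  toFun φ := φ ∘ₗ 𝒥.J
  map_add' _ _ := rfl
  map_smul' _ _ := rfl

/-- The projection `𝔤*_ℂ → 𝔤^{1,0}` along `𝔤^{0,1}`. -/
def pr10 : Module.End ℂ (CDual L) := (1 / 2 : ℂ) • (1 - Complex.I • precompJ 𝒥)

/-- The projection `𝔤*_ℂ → 𝔤^{0,1}` along `𝔤^{1,0}`. -/
def pr01 : Module.End ℂ (CDual L) := (1 / 2 : ℂ) • (1 + Complex.I • precompJ 𝒥)

/-- `φ ↦ φ^{1,0} x + φ^{0,1} y`, where `x`, `y` are formal commuting variables of bidegree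
`(1,0)` and `(0,1)`. -/
def bigradeGen : CDual L →ₗ[ℂ] AddMonoidAlgebra (InvForms L) (ℕ × ℕ) where
  toFun φ := AddMonoidAlgebra.single (1, 0) (ExteriorAlgebra.ι ℂ (pr10 𝒥 φ)) +
    AddMonoidAlgebra.single (0, 1) (ExteriorAlgebra.ι ℂ (pr01 𝒥 φ))
  map_add' φ ψ := by
    simp only [map_add, AddMonoidAlgebra.single_add]
    abel
  map_smul' c φ := by
    simp only [map_smul, AddMonoidAlgebra.smul_single, smul_add, RingHom.id_apply]

theorem bigradeGen_sq (φ : CDual L) : bigradeGen 𝒥 φ * bigradeGen 𝒥 φ = 0 := by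
  have h := ExteriorAlgebra.ι_add_mul_swap (R := ℂ) (pr10 𝒥 φ) (pr01 𝒥 φ)
  simp only [bigradeGen, LinearMap.coe_mk, AddHom.coe_mk, add_mul, mul_add,
    AddMonoidAlgebra.single_mul_single, ExteriorAlgebra.ι_sq_zero, AddMonoidAlgebra.single_zero]
  simp only [Prod.mk_add_mk, zero_add, add_zero]
  rw [← AddMonoidAlgebra.single_add, add_comm, h, AddMonoidAlgebra.single_zero]

/-- The algebra map sending a form to `∑ σ^{p,q} x^p y^q`, with `σ^{p,q}` its `(p,q)`-component. -/
def bigrade : InvForms L →ₐ[ℂ] AddMonoidAlgebra (InvForms L) (ℕ × ℕ) :=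
  ExteriorAlgebra.lift ℂ ⟨bigradeGen 𝒥, bigradeGen_sq 𝒥⟩

/-- The projection `π^{p,q}` onto `⋀^{p,q} 𝔤`. -/
def invProj (p q : ℕ) : Module.End ℂ (InvForms L) where
  toFun σ := (bigrade 𝒥 σ).coeff (p, q)
  map_add' σ τ := by simp
  map_smul' c σ := by simp

/-- A left-invariant Hermitian metric: a `J`-invariant inner product on the Lie algebra. -/
structure InvHermitianMetric where
  g : L →ₗ[ℝ] L →ₗ[ℝ] ℝ
  symm : ∀ v w, g v w = g w v
  pos : ∀ v, v ≠ 0 → 0 < g v v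
  compat : ∀ v w, g (𝒥.J v) (𝒥.J w) = g v w

variable {𝒥} [Module.Finite ℝ L] (h : InvHermitianMetric 𝒥)

/-- The fundamental form `F(X, Y) = g(J X, Y)`, i.e. `½ ∑ g(J e_a, e_b) e^a ∧ e^b`. -/
def fundForm : InvForms L :=
  (1 / 2 : ℂ) • ∑ a, ∑ b, (h.g (𝒥.J (frame L a)) (frame L b) : ℂ) •
    (ExteriorAlgebra.ι ℂ (coframe L a) * ExteriorAlgebra.ι ℂ (coframe L b))

/-- The volume form `F^n / n!`, where `n = ½ dim_ℝ 𝔤`. -/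
def volForm : InvForms L :=
  ((Nat.factorial (Module.finrank ℝ L / 2) : ℂ)⁻¹) • fundForm h ^ (Module.finrank ℝ L / 2)

/-- The Gram matrix `g(e_a, e_b)`. -/
def gram : Matrix (Fin (Module.finrank ℝ L)) (Fin (Module.finrank ℝ L)) ℝ :=
  Matrix.of fun a b => h.g (frame L a) (frame L b)

/-- The musical map `φ ↦ φ^♯` (`ℂ`-linear); `φ^♯ ∈ 𝔤_ℂ` is viewed as the functional
`ψ ↦ ψ(φ^♯) = g(φ, ψ) = ∑ g^{ab} φ(e_a) ψ(e_b)` on `𝔤*_ℂ`. -/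
def sharp : CDual L →ₗ[ℂ] Module.Dual ℂ (CDual L) :=
  ∑ a, ∑ b, (((gram h)⁻¹ a b : ℝ) : ℂ) • (evalAt (frame L a)).smulRight (evalAt (frame L b))

/-- Interior product with `φ^♯`, as an element of the opposite algebra. -/
def sharpInterior : CDual L →ₗ[ℂ] (Module.End ℂ (InvForms L))ᵐᵒᵖ :=
  (MulOpposite.opLinearEquiv ℂ).toLinearMap ∘ₗ
    (CliffordAlgebra.contractLeft (Q := (0 : QuadraticForm ℂ (CDual L)))) ∘ₗ sharp h

theorem sharpInterior_sq (φ : CDual L) : sharpInterior h φ * sharpInterior h φ = 0 := by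
  apply MulOpposite.unop_injective
  exact LinearMap.ext fun σ => CliffordAlgebra.contractLeft_contractLeft _ σ

/-- The `ℂ`-linear Hodge operator,
`*(φ_1 ∧ … ∧ φ_k) = ι_{φ_k^♯} ⋯ ι_{φ_1^♯} (F^n / n!)`. It is the one with
`α ∧ * conj β = ⟨α, β⟩ F^n / n!` for the Hermitian product `⟨ , ⟩` induced by `g` on forms. -/
def invStar : Module.End ℂ (InvForms L) :=
  (LinearMap.applyₗ (volForm h)) ∘ₗ (MulOpposite.opLinearEquiv ℂ).symm.toLinearMap ∘ₗ
    (ExteriorAlgebra.lift ℂ ⟨sharpInterior h, sharpInterior_sq h⟩).toLinearMap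

end LieAlgebraForms

/-! ### Operators of a bigraded complex and Bott-Chern cohomology -/

section Bicomplex

variable {W : Type*} [AddCommGroup W] [Module ℂ W]

/-- `∂ = π^{p+1,q} ∘ d` on bidegree `(p,q)`; all bidegrees with an entry above `N` are zero. -/
def delOf (N : ℕ) (π : ℕ → ℕ → Module.End ℂ W) (d : Module.End ℂ W) : Module.End ℂ W :=
  ∑ p ∈ Finset.range (N + 1), ∑ q ∈ Finset.range (N + 1), π (p + 1) q * d * π p q

/-- `∂̄ = π^{p,q+1} ∘ d` on bidegree `(p,q)`; all bidegrees with an entry above `N` are zero. -/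
def delbarOf (N : ℕ) (π : ℕ → ℕ → Module.End ℂ W) (d : Module.End ℂ W) : Module.End ℂ W :=
  ∑ p ∈ Finset.range (N + 1), ∑ q ∈ Finset.range (N + 1), π p (q + 1) * d * π p q

/-- Elements of `A` (one bidegree) that are `∂`- and `∂̄`-closed. -/
def bcClosed (A : Submodule ℂ W) (del delbar : Module.End ℂ W) : Submodule ℂ W :=
  A ⊓ LinearMap.ker del ⊓ LinearMap.ker delbar

/-- Elements of `A` (one bidegree) that are `∂∂̄`-exact. -/
def bcExact (A : Submodule ℂ W) (del delbar : Module.End ℂ W) : Submodule ℂ W :=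
  A ⊓ LinearMap.range (del * delbar)

/-- Bott-Chern cohomology in the bidegree `A`. -/
abbrev BCCohomology (A : Submodule ℂ W) (del delbar : Module.End ℂ W) : Type _ :=
  bcClosed A del delbar ⧸ (bcExact A del delbar).submoduleOf (bcClosed A del delbar)

variable {W' : Type*} [AddCommGroup W'] [Module ℂ W']

/-- The map induced on Bott-Chern cohomology by a map of complexes. -/
def bcMap {A : Submodule ℂ W} {del delbar : Module.End ℂ W}
    {A' : Submodule ℂ W'} {del' delbar' : Module.End ℂ W'} (f : W →ₗ[ℂ] W')
    (hA : ∀ σ ∈ A, f σ ∈ A') (hdel : ∀ σ, del' (f σ) = f (del σ))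
    (hdelbar : ∀ σ, delbar' (f σ) = f (delbar σ)) :
    BCCohomology A del delbar →ₗ[ℂ] BCCohomology A' del' delbar' :=
  Submodule.mapQ _ _
    (f.restrict (p := bcClosed A del delbar) (q := bcClosed A' del' delbar') (by
      rintro σ ⟨⟨h1, h2⟩, h3⟩
      rw [SetLike.mem_coe, LinearMap.mem_ker] at h2
      rw [SetLike.mem_coe, LinearMap.mem_ker] at h3
      refine ⟨⟨hA σ h1, ?_⟩, ?_⟩
      · simp [hdel, h2]
      · simp [hdelbar, h3]))
    (by
      rintro ⟨σ, hσ⟩ ⟨h1, τ, hτ⟩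
      refine ⟨hA σ h1, f τ, ?_⟩
      have hτ' : del (delbar τ) = σ := hτ
      simp [hdel, hdelbar, hτ'])

end Bicomplex

/-! ### Smooth forms on `Γ \ G` -/

section Manifold

variable {E : Type*} [NormedAddCommGroup E] [NormedSpace ℝ E] [FiniteDimensional ℝ E]
  {G : Type*} [TopologicalSpace G] [ChartedSpace E G] [Group G] [LieGroup 𝓘(ℝ, E) ∞ G]

instance lieGroup_minSmoothness : LieGroup 𝓘(ℝ, E) (minSmoothness ℝ 3) G :=
  LieGroup.of_le (n := ∞) (by
    rw [minSmoothness_of_isRCLikeNormedField]; exact WithTop.coe_le_coe.2 le_top)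

instance finite_groupLieAlgebra : Module.Finite ℝ (GroupLieAlgebra 𝓘(ℝ, E) G) :=
  inferInstanceAs (Module.Finite ℝ E)

instance (priority := low) completeSpace_model : CompleteSpace E := FiniteDimensional.complete ℝ E

variable (E) in
/-- Smooth complex functions on `Γ \ G`: smooth functions on `G` that are invariant under left
translation by elements of `Γ`. -/
def smoothFunAlg (Γ : Subgroup G) : Subalgebra ℂ (G → ℂ) where
  carrier := {f | ContMDiff 𝓘(ℝ, E) 𝓘(ℝ, ℂ) ∞ f ∧ ∀ γ ∈ Γ, ∀ x, f (γ * x) = f x}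
  mul_mem' hf hg := ⟨(contDiff_mul (𝕜 := ℝ) (𝔸 := ℂ)).contMDiff.comp (hf.1.prodMk_space hg.1), fun γ hγ x => by simp [hf.2 γ hγ x, hg.2 γ hγ x]⟩
  add_mem' hf hg := ⟨hf.1.add hg.1, fun γ hγ x => by simp [hf.2 γ hγ x, hg.2 γ hγ x]⟩
  algebraMap_mem' c := ⟨contMDiff_const, fun _ _ _ => rfl⟩

variable (E) in
/-- `C^∞(Γ \ G, ℂ)`, as a commutative `ℂ`-algebra. -/
def SmoothFun (Γ : Subgroup G) : Type _ := smoothFunAlg E Γ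

instance (Γ : Subgroup G) : CommRing (SmoothFun E Γ) :=
  inferInstanceAs (CommRing (smoothFunAlg E Γ))

instance (Γ : Subgroup G) : Algebra ℂ (SmoothFun E Γ) :=
  inferInstanceAs (Algebra ℂ (smoothFunAlg E Γ))

theorem contMDiff_invField (v : GroupLieAlgebra 𝓘(ℝ, E) G) :
    ContMDiff 𝓘(ℝ, E) 𝓘(ℝ, E).tangent ∞
      (fun x : G => (⟨x, mulInvariantVectorField v x⟩ : TangentBundle 𝓘(ℝ, E) G)) := by
  have sfg : ContMDiff 𝓘(ℝ, E) 𝓘(ℝ, E).tangent ∞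
      (fun x : G => (Bundle.TotalSpace.mk' E x 0 : TangentBundle 𝓘(ℝ, E) G)) :=
    Bundle.contMDiff_zeroSection _ _
  have sfv : ContMDiff 𝓘(ℝ, E) 𝓘(ℝ, E).tangent ∞
      (fun _ : G => (Bundle.TotalSpace.mk' E 1 v : TangentBundle 𝓘(ℝ, E) G)) :=
    contMDiff_const
  have S₂ : ContMDiff (𝓘(ℝ, E).tangent.prod 𝓘(ℝ, E).tangent) (𝓘(ℝ, E).prod 𝓘(ℝ, E)).tangent ∞
      (equivTangentBundleProd 𝓘(ℝ, E) G 𝓘(ℝ, E) G).symm :=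
    contMDiff_equivTangentBundleProd_symm
  have S₃ : ContMDiff (𝓘(ℝ, E).prod 𝓘(ℝ, E)).tangent 𝓘(ℝ, E).tangent ∞
      (tangentMap (𝓘(ℝ, E).prod 𝓘(ℝ, E)) 𝓘(ℝ, E) (fun p : G × G => p.1 * p.2)) :=
    (contMDiff_mul 𝓘(ℝ, E) ∞).contMDiff_tangentMap (by simp)
  have S := (S₃.comp S₂).comp (sfg.prodMk sfv)
  convert! S with x
  · simp
  · simp only [Function.comp_apply, tangentMap]
    rw [mfderiv_prod_eq_add_apply
      ((contMDiff_mul 𝓘(ℝ, E) ∞).mdifferentiableAt (by simp))]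
    have aux : ∀ (A B : E →L[ℝ] E) (w : E), B w = A 0 + B w := fun A B w => by
      rw [map_zero, zero_add]
    exact aux (mfderiv 𝓘(ℝ, E) 𝓘(ℝ, E) (fun z : G => z * 1) x)
      (mfderiv 𝓘(ℝ, E) 𝓘(ℝ, E) (fun z : G => x * z) 1) v

theorem contMDiff_invDeriv (v : GroupLieAlgebra 𝓘(ℝ, E) G) {f : G → ℂ}
    (hf : ContMDiff 𝓘(ℝ, E) 𝓘(ℝ, ℂ) ∞ f) :
    ContMDiff 𝓘(ℝ, E) 𝓘(ℝ, ℂ) ∞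
      (fun x => (mfderiv 𝓘(ℝ, E) 𝓘(ℝ, ℂ) f x (mulInvariantVectorField v x) : ℂ)) := by
  have h1 : ContMDiff 𝓘(ℝ, E).tangent 𝓘(ℝ, ℂ).tangent ∞ (tangentMap 𝓘(ℝ, E) 𝓘(ℝ, ℂ) f) :=
    hf.contMDiff_tangentMap (by simp)
  exact (contMDiff_snd_tangentBundle_modelSpace ℂ 𝓘(ℝ, ℂ)).comp (h1.comp (contMDiff_invField v))

theorem invDeriv_invariant (v : GroupLieAlgebra 𝓘(ℝ, E) G) {f : G → ℂ}
    (hf : ContMDiff 𝓘(ℝ, E) 𝓘(ℝ, ℂ) ∞ f) (γ : G) (hγ : ∀ x, f (γ * x) = f x) (x : G) :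
    (mfderiv 𝓘(ℝ, E) 𝓘(ℝ, ℂ) f (γ * x) (mulInvariantVectorField v (γ * x)) : ℂ) =
      mfderiv 𝓘(ℝ, E) 𝓘(ℝ, ℂ) f x (mulInvariantVectorField v x) := by
  have hL : ∀ a y : G, MDifferentiableAt 𝓘(ℝ, E) 𝓘(ℝ, E) (fun z : G => a * z) y := fun a y =>
    (contMDiff_mul_left (n := ∞)).mdifferentiableAt (by simp)
  have hf' : ∀ y : G, MDifferentiableAt 𝓘(ℝ, E) 𝓘(ℝ, ℂ) f y := fun y =>
    hf.mdifferentiableAt (by simp)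
  have key : ∀ y : G, (mfderiv 𝓘(ℝ, E) 𝓘(ℝ, ℂ) f y (mulInvariantVectorField v y) : ℂ) =
      mfderiv 𝓘(ℝ, E) 𝓘(ℝ, ℂ) (fun z => f (y * z)) 1 v := by
    intro y
    have h1 := mfderiv_comp (I := 𝓘(ℝ, E)) (I' := 𝓘(ℝ, E)) (I'' := 𝓘(ℝ, ℂ)) (1 : G)
      (g := f) (f := fun z : G => y * z) (hf' _) (hL y 1)
    have h2 := DFunLike.congr_fun h1 v
    have h3 : ∀ (a b : G) (_ : a = b) (w : E), (mfderiv 𝓘(ℝ, E) 𝓘(ℝ, ℂ) f a : E →L[ℝ] ℂ) w =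
        (mfderiv 𝓘(ℝ, E) 𝓘(ℝ, ℂ) f b : E →L[ℝ] ℂ) w := by
      rintro a _ rfl w
      rfl
    exact (h3 y (y * 1) (mul_one y).symm _).trans h2.symm
  have e : (fun z => f (γ * x * z)) = fun z => f (x * z) := by
    funext z
    rw [mul_assoc, hγ]
  exact (key _).trans (Eq.trans
    (congrArg (fun F : G → ℂ => (mfderiv 𝓘(ℝ, E) 𝓘(ℝ, ℂ) F 1 : E →L[ℝ] ℂ) v) e) (key _).symm)

/-- The derivative `X_v f` of a function on `Γ \ G` along the left-invariant vector field `X_v`. -/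
def invDeriv (Γ : Subgroup G) (v : GroupLieAlgebra 𝓘(ℝ, E) G) :
    Module.End ℂ (SmoothFun E Γ) where
  toFun f := ⟨fun x => mfderiv 𝓘(ℝ, E) 𝓘(ℝ, ℂ) f.1 x (mulInvariantVectorField v x),
    contMDiff_invDeriv v f.2.1,
    fun γ hγ x => invDeriv_invariant v f.2.1 γ (fun y => f.2.2 γ hγ y) x⟩
  map_add' f g := by
    refine Subtype.ext (funext fun x => ?_)
    have hf : MDifferentiableAt 𝓘(ℝ, E) 𝓘(ℝ, ℂ) f.1 x :=
      f.2.1.mdifferentiableAt (by simp)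
    have hg : MDifferentiableAt 𝓘(ℝ, E) 𝓘(ℝ, ℂ) g.1 x :=
      g.2.1.mdifferentiableAt (by simp)
    exact DFunLike.congr_fun (mfderiv_add hf hg) _
  map_smul' c f := by
    refine Subtype.ext (funext fun x => ?_)
    have hf : MDifferentiableAt 𝓘(ℝ, E) 𝓘(ℝ, ℂ) f.1 x := f.2.1.mdifferentiableAt (by simp)
    have h1 := (((c • ContinuousLinearMap.id ℝ ℂ).hasMFDerivAt).comp x hf.hasMFDerivAt).mfderiv
    exact DFunLike.congr_fun h1 _

variable (E) in
/-- The algebra of smooth complex differential forms of all degrees on `Γ \ G`. The bundle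
`⋀ T*_ℂ (Γ \ G)` is trivialized by left-invariant forms, so its smooth sections are
`C^∞(Γ \ G, ℂ) ⊗ ⋀ 𝔤*_ℂ`; multiplication is the wedge product. -/
abbrev Forms (Γ : Subgroup G) : Type _ :=
  SmoothFun E Γ ⊗[ℂ] InvForms (GroupLieAlgebra 𝓘(ℝ, E) G)

variable (Γ : Subgroup G)

/-- A left-invariant form, as a form on `Γ \ G`. -/
def ofInv : InvForms (GroupLieAlgebra 𝓘(ℝ, E) G) →ₗ[ℂ] Forms E Γ :=
  TensorProduct.mk ℂ _ _ 1

/-- The exterior differential, `d(f σ) = ∑ (X_a f) e^a ∧ σ + f dσ` for a function `f` and a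
left-invariant form `σ`. -/
def extD : Module.End ℂ (Forms E Γ) :=
  ∑ a, TensorProduct.map (invDeriv Γ (frame (GroupLieAlgebra 𝓘(ℝ, E) G) a))
      (wedgeLeft (coframe (GroupLieAlgebra 𝓘(ℝ, E) G) a)) +
    LinearMap.lTensor (SmoothFun E Γ) (ceD (GroupLieAlgebra 𝓘(ℝ, E) G))

variable (𝒥 : InvComplexStructure (GroupLieAlgebra 𝓘(ℝ, E) G))

/-- `𝒜^{p,q}(Γ \ G)`: the smooth forms of type `(p,q)`. -/
def bidegree (p q : ℕ) : Submodule ℂ (Forms E Γ) :=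
  LinearMap.range (LinearMap.lTensor (SmoothFun E Γ) (invBidegree 𝒥 p q).subtype)

/-- The projection onto the forms of type `(p,q)`. -/
def proj (p q : ℕ) : Module.End ℂ (Forms E Γ) :=
  LinearMap.lTensor (SmoothFun E Γ) (invProj 𝒥 p q)

/-- `∂` on left-invariant forms. -/
def invDel : Module.End ℂ (InvForms (GroupLieAlgebra 𝓘(ℝ, E) G)) :=
  delOf (Module.finrank ℝ E) (invProj 𝒥) (ceD _)

/-- `∂̄` on left-invariant forms. -/
def invDelbar : Module.End ℂ (InvForms (GroupLieAlgebra 𝓘(ℝ, E) G)) :=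
  delbarOf (Module.finrank ℝ E) (invProj 𝒥) (ceD _)

/-- `∂` on forms on `Γ \ G`. -/
def del : Module.End ℂ (Forms E Γ) := delOf (Module.finrank ℝ E) (proj Γ 𝒥) (extD Γ)

/-- `∂̄` on forms on `Γ \ G`. -/
def delbar : Module.End ℂ (Forms E Γ) := delbarOf (Module.finrank ℝ E) (proj Γ 𝒥) (extD Γ)

theorem ofInv_mem (p q : ℕ) (σ : InvForms (GroupLieAlgebra 𝓘(ℝ, E) G))
    (hσ : σ ∈ invBidegree 𝒥 p q) : ofInv Γ σ ∈ bidegree Γ 𝒥 p q :=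
  ⟨1 ⊗ₜ ⟨σ, hσ⟩, rfl⟩

theorem extD_ofInv (σ : InvForms (GroupLieAlgebra 𝓘(ℝ, E) G)) :
    extD Γ (ofInv Γ σ) = ofInv Γ (ceD _ σ) := by
  have h1 : ∀ v : GroupLieAlgebra 𝓘(ℝ, E) G, invDeriv Γ v 1 = 0 := fun v =>
    Subtype.ext (funext fun x => DFunLike.congr_fun (mfderiv_const (c := (1 : ℂ))) _)
  simp [extD, ofInv, h1]

theorem del_ofInv (σ : InvForms (GroupLieAlgebra 𝓘(ℝ, E) G)) :
    del Γ 𝒥 (ofInv Γ σ) = ofInv Γ (invDel 𝒥 σ) := by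
  have hp : ∀ p q τ, proj Γ 𝒥 p q (ofInv Γ τ) = ofInv Γ (invProj 𝒥 p q τ) := fun _ _ _ => rfl
  simp [del, invDel, delOf, hp, extD_ofInv]

theorem delbar_ofInv (σ : InvForms (GroupLieAlgebra 𝓘(ℝ, E) G)) :
    delbar Γ 𝒥 (ofInv Γ σ) = ofInv Γ (invDelbar 𝒥 σ) := by
  have hp : ∀ p q τ, proj Γ 𝒥 p q (ofInv Γ τ) = ofInv Γ (invProj 𝒥 p q τ) := fun _ _ _ => rfl
  simp [delbar, invDelbar, delbarOf, hp, extD_ofInv]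

/-- The Bott-Chern cohomology of `(Γ \ G, J)` is computed by left-invariant forms: the inclusion
induces isomorphisms `H_BC^{p,q}(𝔤, J) ≅ H_BC^{p,q}(Γ \ G)` for all `p`, `q`. -/
def BCComputedByInvForms : Prop :=
  ∀ p q : ℕ, Function.Bijective
    (bcMap (ofInv Γ) (ofInv_mem Γ 𝒥 p q) (del_ofInv Γ 𝒥) (delbar_ofInv Γ 𝒥))

variable {𝒥} (h : InvHermitianMetric 𝒥)

/-- The Hodge operator on forms on `Γ \ G`. -/
def hodgeStar : Module.End ℂ (Forms E Γ) := LinearMap.lTensor (SmoothFun E Γ) (invStar h)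

/-- `∂^* = - * ∂̄ *`. -/
def delAdj : Module.End ℂ (Forms E Γ) := -(hodgeStar Γ h * delbar Γ 𝒥 * hodgeStar Γ h)

/-- `∂̄^* = - * ∂ *`. -/
def delbarAdj : Module.End ℂ (Forms E Γ) := -(hodgeStar Γ h * del Γ 𝒥 * hodgeStar Γ h)

/-- The Bott-Chern Laplacian. -/
def laplaceBC : Module.End ℂ (Forms E Γ) :=
  del Γ 𝒥 * delbar Γ 𝒥 * delbarAdj Γ h * delAdj Γ h +
  delbarAdj Γ h * delAdj Γ h * del Γ 𝒥 * delbar Γ 𝒥 +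
  delbarAdj Γ h * del Γ 𝒥 * delAdj Γ h * delbar Γ 𝒥 +
  delAdj Γ h * delbar Γ 𝒥 * delbarAdj Γ h * del Γ 𝒥 +
  delbarAdj Γ h * delbar Γ 𝒥 + delAdj Γ h * del Γ 𝒥

/-- The Bott-Chern harmonic forms of type `(p,q)`. -/
def harmonicBC (p q : ℕ) : Submodule ℂ (Forms E Γ) :=
  bidegree Γ 𝒥 p q ⊓ LinearMap.ker (laplaceBC Γ h)

/-- SKT (strong Kähler with torsion): `∂∂̄F = 0`. -/
def IsSKT : Prop := del Γ 𝒥 (delbar Γ 𝒥 (ofInv Γ (fundForm h))) = 0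

/-- Products of Bott-Chern harmonic forms are Bott-Chern harmonic. -/
def IsGeometricallyBCFormal : Prop :=
  ∀ p q r s : ℕ, ∀ α ∈ harmonicBC Γ h p q, ∀ β ∈ harmonicBC Γ h r s,
    α * β ∈ harmonicBC Γ h (p + r) (q + s)

end Manifold

end Nilmanifold

end

noncomputable section

namespace Nilmanifold

/-! ### Contractions and the grade involution on an exterior algebra -/

section Exterior

open CliffordAlgebra (contractLeft involute)

variable {R M : Type*} [CommRing R] [AddCommGroup M] [Module R M]

local notation "ιₑ" => ExteriorAlgebra.ι R (M := M)

/-! Put Ω = dη^n, and let ζ be the (0,1)-form whose metric dual ζ^♯ satisfies η^n(ζ^♯) = 1 and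
η^i(ζ^♯) = 0 for i < n. An antiderivation is determined by its values on 1-forms, so on
left-invariant forms d = Ω ∧ ι_{ζ^♯} + Ω̄ ∧ ι_{ζ̄^♯} (`exists_structureEq`). By type the first
summand is ∂̄ and the second is ∂ (`delOf_add`, `delbarOf_add`).

As Ω contains neither η^n nor its conjugate, ∂∂̄σ = Ω̄ ∧ Ω ∧ ι_{ζ̄^♯} ι_{ζ^♯} σ. For σ = F the
double contraction is the scalar i|ζ|². Hence SKT forces Ω̄ ∧ Ω = 0 unless ζ = 0, and in both cases
∂∂̄ vanishes on every left-invariant form (`StructureEq.twistOp_twistOp_eq_zero`).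

For the L² product, ∂^* and ∂̄^* are the adjoints of ∂ and ∂̄ up to one positive factor c. Therefore
∂̄^*∂^* also vanishes on left-invariant forms (`StructureEq.delbarAdj_delAdj_ofInv`), and Δ_BC α = 0
forces ∂α = ∂̄α = ∂̄^*∂^*α = 0 (`ker_laplace`). For such an α the cohomological hypothesis gives a
closed left-invariant σ with σ - α = ∂∂̄γ. Since ∂̄^*∂^* kills σ - α, this difference is orthogonal
to itself, so α = σ (`StructureEq.exists_eq_ofInv`). Harmonic forms are thus the closed
left-invariant forms, which are stable under products by the Leibniz rule.

The L² product requires a Γ-invariant integral that annihilates derivatives along left-invariant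
fields (`exists_integral`), obtained from Haar measure on a fundamental domain. The pointwise
Hermitian product and the Hodge operator are handled through contractions and the number operator,
without a basis of the exterior algebra. The operator ** is computed only up to the positive
constant c, which is all that the argument needs. -/

theorem exterior_induction {P : ExteriorAlgebra R M → Prop}
    (one : P 1) (smul : ∀ (r : R) x, P x → P (r • x)) (add : ∀ x y, P x → P y → P (x + y))
    (mul : ∀ m x, P x → P (ιₑ m * x)) (x : ExteriorAlgebra R M) : P x := by
  refine CliffordAlgebra.left_induction _ (fun r => ?_) add (fun x m hx => mul m x hx) x
  rw [Algebra.algebraMap_eq_smul_one]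
  exact smul r 1 one

theorem contract_ι_mul (d : Module.Dual R M) (m : M) (x : ExteriorAlgebra R M) :
    contractLeft d (ιₑ m * x) = d m • x - ιₑ m * contractLeft d x :=
  CliffordAlgebra.contractLeft_ι_mul _ _ _

theorem contract_one (d : Module.Dual R M) :
    contractLeft d (1 : ExteriorAlgebra R M) = 0 :=
  CliffordAlgebra.contractLeft_one _ _

theorem contract_ι (d : Module.Dual R M) (m : M) :
    contractLeft d (ιₑ m) = d m • (1 : ExteriorAlgebra R M) := by
  have h := contract_ι_mul d m 1
  simpa [contract_one] using h

/-- The grade involution records the sign (-1)^k of moving a 1-form past a k-form, so the identities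
built on it need no homogeneity assumption. -/
theorem ι_mul_eq_involute_mul (m : M) (x : ExteriorAlgebra R M) :
    ιₑ m * x = involute x * ιₑ m := by
  induction x using exterior_induction with
  | one => simp
  | smul r x hx => simp [hx]
  | add x y hx hy => simp [mul_add, add_mul, hx, hy]
  | mul k x hx =>
    have h := ExteriorAlgebra.ι_add_mul_swap (R := R) m k
    have h2 : involute (ιₑ k) = - ιₑ k := CliffordAlgebra.involute_ι _
    rw [map_mul, h2, mul_assoc, ← hx, ← mul_assoc, ← mul_assoc, eq_neg_of_add_eq_zero_left h]
    simp

theorem contract_mul (d : Module.Dual R M) (x y : ExteriorAlgebra R M) :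
    contractLeft d (x * y) = contractLeft d x * y + involute x * contractLeft d y := by
  induction x using exterior_induction with
  | one => simp
  | smul r x hx => simp [hx]
  | add x z hx hz => simp only [add_mul, map_add, hx, hz]; abel
  | mul k x hx =>
    have h2 : involute (ιₑ k) = - ιₑ k := CliffordAlgebra.involute_ι _
    rw [mul_assoc, contract_ι_mul, hx, contract_ι_mul, map_mul, h2]
    simp only [mul_add, sub_mul, smul_mul_assoc, mul_assoc, neg_mul]
    abel

theorem involute_contract (d : Module.Dual R M) (x : ExteriorAlgebra R M) :
    involute (contractLeft d x) = -contractLeft d (involute x) := by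
  induction x using exterior_induction with
  | one => simp
  | smul r x hx => simp [hx]
  | add x z hx hz => simp only [map_add, hx, hz]; abel
  | mul k x hx =>
    have h2 : involute (ιₑ k) = - ιₑ k := CliffordAlgebra.involute_ι _
    rw [contract_ι_mul, map_sub, map_mul, map_mul, h2, hx, neg_mul, neg_mul,
      LinearMap.map_neg, contract_ι_mul]
    simp

theorem involute_ι_mul (m : M) (x : ExteriorAlgebra R M) :
    involute (ιₑ m * x) = -(ιₑ m * involute x) := by
  have h2 : involute (ιₑ m) = - ιₑ m := CliffordAlgebra.involute_ι _
  rw [map_mul, h2, neg_mul]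

/-- An element fixed by the grade involution is central. -/
theorem commute_of_involute {x : ExteriorAlgebra R M} (hx : involute x = x)
    (y : ExteriorAlgebra R M) : x * y = y * x := by
  induction y using exterior_induction with
  | one => simp
  | smul r y hy => simp [hy]
  | add y z hy hz => simp [mul_add, add_mul, hy, hz]
  | mul k y hy =>
    have h := ι_mul_eq_involute_mul k x
    rw [hx] at h
    rw [← mul_assoc, ← h, mul_assoc, hy, mul_assoc]

end Exterior

end Nilmanifold

end

noncomputable section

namespace Nilmanifold

/-! ### Conjugation of complex forms -/

/-- A complex algebra with scalars acting through complex conjugation. -/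
def ConjAlgebra (A : Type*) : Type _ := A

instance (A : Type*) [Ring A] : Ring (ConjAlgebra A) := inferInstanceAs (Ring A)

instance (A : Type*) [Ring A] [Algebra ℂ A] : Algebra ℂ (ConjAlgebra A) :=
  RingHom.toAlgebra' ((algebraMap ℂ A).comp (starRingEnd ℂ))
    fun c x => Algebra.commutes (A := A) (starRingEnd ℂ c) x

theorem ConjAlgebra.smul_def {A : Type*} [Ring A] [Algebra ℂ A] (c : ℂ) (x : A) :
    (c • (show ConjAlgebra A from x) : ConjAlgebra A) = (starRingEnd ℂ c • x : A) := by
  rw [Algebra.smul_def, Algebra.smul_def]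
  rfl

section

open CliffordAlgebra (contractLeft involute)

variable {L : Type*} [LieRing L] [LieAlgebra ℝ L]

@[simp] theorem conjForm_apply (φ : CDual L) (v : L) : conjForm φ v = starRingEnd ℂ (φ v) := rfl

@[simp] theorem conjForm_conjForm (φ : CDual L) : conjForm (conjForm φ) = φ := by
  ext v; simp

theorem conjForm_add (φ ψ : CDual L) : conjForm (φ + ψ) = conjForm φ + conjForm ψ := by
  ext v; simp

theorem conjForm_smul (c : ℂ) (φ : CDual L) :
    conjForm (c • φ) = starRingEnd ℂ c • conjForm φ := by
  ext v; simp

variable (L) in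
/-- Conjugation of `1`-forms, as a map into the conjugate algebra. -/
def conjGen : CDual L →ₗ[ℂ] ConjAlgebra (InvForms L) where
  toFun φ := ExteriorAlgebra.ι ℂ (conjForm φ)
  map_add' φ ψ := by
    rw [conjForm_add, map_add]; rfl
  map_smul' c φ := by
    rw [conjForm_smul, map_smul]
    exact (ConjAlgebra.smul_def c (ExteriorAlgebra.ι ℂ (conjForm φ))).symm

variable (L) in
/-- Conjugation of left-invariant forms, as a map into the conjugate algebra. -/
def conjAlgHom : InvForms L →ₐ[ℂ] ConjAlgebra (InvForms L) :=
  ExteriorAlgebra.lift ℂ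
    ⟨conjGen L, fun φ => ExteriorAlgebra.ι_sq_zero (R := ℂ) (conjForm φ)⟩

/-- Complex conjugation of left-invariant forms. -/
def conjInv : InvForms L →+* InvForms L := (conjAlgHom L).toRingHom

@[simp] theorem conjInv_ι (φ : CDual L) :
    conjInv (ExteriorAlgebra.ι ℂ φ) = ExteriorAlgebra.ι ℂ (conjForm φ) :=
  ExteriorAlgebra.lift_ι_apply ℂ (A := ConjAlgebra (InvForms L)) (conjGen L) _ φ

@[simp] theorem conjInv_smul (c : ℂ) (σ : InvForms L) :
    conjInv (c • σ) = starRingEnd ℂ c • conjInv σ :=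
  ((conjAlgHom L).toLinearMap.map_smul c σ).trans (ConjAlgebra.smul_def c (conjInv σ))

@[simp] theorem conjInv_conjInv (σ : InvForms L) : conjInv (conjInv σ) = σ := by
  induction σ using exterior_induction with
  | one => simp
  | smul r x hx => simp [hx]
  | add x y hx hy => simp [hx, hy]
  | mul k x hx => simp [hx]

theorem involute_conjInv (σ : InvForms L) : involute (conjInv σ) = conjInv (involute σ) := by
  induction σ using exterior_induction with
  | one => simp
  | smul r x hx => simp [hx]
  | add x y hx hy => simp [hx, hy]
  | mul k x hx => rw [map_mul, conjInv_ι, involute_ι_mul, hx, involute_ι_mul]; simp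

/-! ### Orthonormal frames -/

variable {𝒥 : InvComplexStructure L} [Module.Finite ℝ L] (h : InvHermitianMetric 𝒥)

theorem exists_orthonormal_basis :
    ∃ u : Module.Basis (Fin (Module.finrank ℝ L)) ℝ L,
      ∀ a b, h.g (u a) (u b) = if a = b then 1 else 0 := by
  let core : InnerProductSpace.Core ℝ L :=
    { inner := fun v w => h.g v w
      conj_inner_symm := fun v w => h.symm w v
      re_inner_nonneg := fun v => by
        rcases eq_or_ne v 0 with rfl | hv
        · simp
        · exact (h.pos v hv).le
      add_left := fun v w z => by simp
      smul_left := fun v w r => by simp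
      definite := fun v hv => by
        by_contra h0
        exact (h.pos v h0).ne' hv }
  let _ : NormedAddCommGroup L := core.toNormedAddCommGroup
  let _ : InnerProductSpace ℝ L := InnerProductSpace.ofCore core.toCore
  have hb := (stdOrthonormalBasis ℝ L).orthonormal
  rw [orthonormal_iff_ite] at hb
  exact ⟨(stdOrthonormalBasis ℝ L).toBasis, fun a b => by
    rw [OrthonormalBasis.coe_toBasis]
    exact hb a b⟩

/-- A `g`-orthonormal basis of the Lie algebra. -/
def onb : Module.Basis (Fin (Module.finrank ℝ L)) ℝ L := (exists_orthonormal_basis h).choose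

theorem onb_orthonormal (a b : Fin (Module.finrank ℝ L)) :
    h.g (onb h a) (onb h b) = if a = b then 1 else 0 :=
  (exists_orthonormal_basis h).choose_spec a b

/-- The coframe dual to `onb`. -/
def oncoframe (a : Fin (Module.finrank ℝ L)) : CDual L :=
  Complex.ofRealCLM.toLinearMap ∘ₗ (onb h).coord a

@[simp] theorem oncoframe_onb (a b : Fin (Module.finrank ℝ L)) :
    oncoframe h a (onb h b) = if b = a then 1 else 0 := by
  rcases eq_or_ne b a with rfl | hab
  · simp [oncoframe]
  · simp [oncoframe, hab]

@[simp] theorem conjForm_oncoframe (a : Fin (Module.finrank ℝ L)) :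
    conjForm (oncoframe h a) = oncoframe h a := by
  ext v; simp [oncoframe]

@[simp] theorem conjForm_coframe (a : Fin (Module.finrank ℝ L)) :
    conjForm (coframe L a) = coframe L a := by
  ext v; simp [coframe]

theorem sum_coord_smul {κ : Type*} [Fintype κ] (b : Module.Basis κ ℝ L) (φ : CDual L) :
    ∑ a, φ (b a) • (Complex.ofRealCLM.toLinearMap ∘ₗ b.coord a : CDual L) = φ := by
  ext v
  conv_rhs => rw [← b.sum_repr v, map_sum]
  simp [LinearMap.sum_apply, mul_comm]

theorem sum_oncoframe (φ : CDual L) : ∑ a, φ (onb h a) • oncoframe h a = φ :=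
  sum_coord_smul _ φ

theorem sum_coframe (φ : CDual L) : ∑ a, φ (frame L a) • coframe L a = φ :=
  sum_coord_smul _ φ

theorem gram_eq : gram h = ((onb h).toMatrix (frame L)).transpose * (onb h).toMatrix (frame L) := by
  ext a b
  have key : ∀ v w : L, h.g v w = ∑ c, (onb h).repr v c * (onb h).repr w c := by
    intro v w
    conv_lhs => rw [← (onb h).sum_repr v, ← (onb h).sum_repr w]
    simp only [map_sum, map_smul, LinearMap.sum_apply, LinearMap.smul_apply, onb_orthonormal,
      smul_eq_mul]
    simp [mul_comm]
  simp [gram, key, Matrix.mul_apply, Module.Basis.toMatrix_apply]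

/-- With P the matrix of the auxiliary frame in the orthonormal basis, the Gram matrix is PᵀP. This
identity converts the definition of `sharp` into a plain sum over the orthonormal basis. -/
theorem toMatrix_mul_gram_inv :
    (onb h).toMatrix (frame L) * (gram h)⁻¹ * ((onb h).toMatrix (frame L)).transpose = 1 := by
  have h1 : (onb h).toMatrix (frame L) * (frame L).toMatrix (onb h) = 1 :=
    Module.Basis.toMatrix_mul_toMatrix_flip _ _
  have h2 := Matrix.isUnit_det_of_right_inverse h1
  have h3 : IsUnit (((onb h).toMatrix (frame L)).transpose).det := by
    rwa [Matrix.det_transpose]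
  rw [gram_eq, Matrix.mul_inv_rev, ← Matrix.mul_assoc, Matrix.mul_nonsing_inv _ h2, Matrix.one_mul,
    Matrix.nonsing_inv_mul _ h3]

theorem sharp_apply (φ ψ : CDual L) : sharp h φ ψ = ∑ a, φ (onb h a) * ψ (onb h a) := by
  have hexp : ∀ (χ : CDual L) (a : Fin (Module.finrank ℝ L)), χ (frame L a) =
      ∑ c, ((onb h).toMatrix (frame L) c a : ℂ) * χ (onb h c) := by
    intro χ a
    conv_lhs => rw [← (onb h).sum_repr (frame L a), map_sum]
    simp [Module.Basis.toMatrix_apply]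
  have hm : ∀ c d, ∑ a, ∑ b, ((onb h).toMatrix (frame L) c a : ℂ) * (((gram h)⁻¹ a b : ℝ) : ℂ) *
      ((onb h).toMatrix (frame L) d b : ℂ) = if c = d then 1 else 0 := by
    intro c d
    have := congrFun (congrFun (toMatrix_mul_gram_inv h) c) d
    simp only [Matrix.mul_apply, Matrix.transpose_apply, Finset.sum_mul, Matrix.one_apply] at this
    rw [Finset.sum_comm] at this
    have h2 := congrArg (fun r : ℝ => (r : ℂ)) this
    push_cast at h2
    rw [h2]
    split_ifs <;> simp
  have h1 : sharp h φ ψ =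
      ∑ a, ∑ b, (((gram h)⁻¹ a b : ℝ) : ℂ) * (φ (frame L a) * ψ (frame L b)) := by
    simp [sharp, LinearMap.sum_apply, evalAt]
  calc sharp h φ ψ = ∑ c, ∑ d, (∑ a, ∑ b, ((onb h).toMatrix (frame L) c a : ℂ) *
        (((gram h)⁻¹ a b : ℝ) : ℂ) * ((onb h).toMatrix (frame L) d b : ℂ)) *
        (φ (onb h c) * ψ (onb h d)) := by
        rw [h1]
        simp only [hexp φ, hexp ψ, Finset.sum_mul, Finset.mul_sum]
        calc _ = ∑ a, ∑ c, ∑ b, ∑ d, _ := Finset.sum_congr rfl fun a _ => by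
                refine (Finset.sum_congr rfl fun b _ => Finset.sum_comm).trans Finset.sum_comm
          _ = ∑ c, ∑ a, ∑ d, ∑ b, _ := Finset.sum_comm.trans (Finset.sum_congr rfl fun c _ =>
                Finset.sum_congr rfl fun a _ => Finset.sum_comm)
          _ = _ := Finset.sum_congr rfl fun c _ => by
                rw [Finset.sum_comm]
                refine Finset.sum_congr rfl fun d _ => Finset.sum_congr rfl fun a _ =>
                  Finset.sum_congr rfl fun b _ => ?_
                ring
    _ = _ := by simp [hm]

theorem sharp_comm (φ ψ : CDual L) : sharp h φ ψ = sharp h ψ φ := by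
  simp [sharp_apply, mul_comm]

theorem conj_sharp (φ ψ : CDual L) :
    starRingEnd ℂ (sharp h φ ψ) = sharp h (conjForm φ) (conjForm ψ) := by
  simp [sharp_apply]

theorem sharp_oncoframe (a : Fin (Module.finrank ℝ L)) :
    sharp h (oncoframe h a) = evalAt (onb h a) := by
  ext ψ
  simp [sharp_apply, evalAt]

/-- Nondegeneracy of the metric. It is used to realize the vector dual to η^n as ζ^♯ for a 1-form ζ.
-/
theorem exists_sharp_eq (d : Module.Dual ℂ (CDual L)) : ∃ ζ, sharp h ζ = d := by
  refine ⟨∑ a, d (oncoframe h a) • oncoframe h a, ?_⟩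
  ext ψ
  conv_rhs => rw [← sum_oncoframe h ψ, map_sum]
  simp [sharp_apply, LinearMap.sum_apply, mul_comm]

end

end Nilmanifold

end

noncomputable section

namespace Nilmanifold

/-! ### The Hermitian product on left-invariant forms -/

section

open CliffordAlgebra (contractLeft involute)

variable {L : Type*} [LieRing L] [LieAlgebra ℝ L]
  {𝒥 : InvComplexStructure L} [Module.Finite ℝ L] (h : InvHermitianMetric 𝒥)

local notation "ιₑ" => ExteriorAlgebra.ι ℂ (M := CDual L)

/-- Contraction with a form: `φ_1 ∧ … ∧ φ_k` acts by `ι_{φ_k^♯} ⋯ ι_{φ_1^♯}`. -/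
def contraction : InvForms L →ₗ[ℂ] Module.End ℂ (InvForms L) :=
  (MulOpposite.opLinearEquiv ℂ).symm.toLinearMap ∘ₗ
    (ExteriorAlgebra.lift ℂ ⟨sharpInterior h, sharpInterior_sq h⟩).toLinearMap

theorem invStar_apply (σ : InvForms L) : invStar h σ = contraction h σ (volForm h) := rfl

@[simp] theorem contraction_one : contraction h 1 = 1 := by
  simp [contraction]

theorem contraction_mul (σ τ : InvForms L) :
    contraction h (σ * τ) = contraction h τ * contraction h σ := by
  simp [contraction]

@[simp] theorem contraction_ι (φ : CDual L) :
    contraction h (ιₑ φ) = contractLeft (sharp h φ) := by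
  simp [contraction, sharpInterior]

theorem contraction_ι_mul (φ : CDual L) (σ τ : InvForms L) :
    contraction h (ιₑ φ * σ) τ = contraction h σ (contractLeft (sharp h φ) τ) := by
  rw [contraction_mul, contraction_ι, Module.End.mul_apply]

/-- The degree zero part of a form. -/
def scalarPart : InvForms L →ₐ[ℂ] ℂ := ExteriorAlgebra.algebraMapInv

theorem scalarPart_ι_mul (φ : CDual L) (σ : InvForms L) : scalarPart (ιₑ φ * σ) = 0 := by
  simp [scalarPart, ExteriorAlgebra.algebraMapInv]

/-- The Hermitian product of left-invariant forms, conjugate-linear in the first variable. -/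
def hermForm (σ τ : InvForms L) : ℂ := scalarPart (contraction h (conjInv σ) τ)

theorem hermForm_mul_left (ξ σ τ : InvForms L) :
    hermForm h (ξ * σ) τ = hermForm h σ (contraction h (conjInv ξ) τ) := by
  simp [hermForm, contraction_mul]

theorem hermForm_ι_mul_left (φ : CDual L) (σ τ : InvForms L) :
    hermForm h (ιₑ φ * σ) τ = hermForm h σ (contractLeft (sharp h (conjForm φ)) τ) := by
  simp [hermForm_mul_left]

theorem hermForm_add_left (σ σ' τ : InvForms L) :
    hermForm h (σ + σ') τ = hermForm h σ τ + hermForm h σ' τ := by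
  simp [hermForm]

theorem hermForm_add_right (σ τ τ' : InvForms L) :
    hermForm h σ (τ + τ') = hermForm h σ τ + hermForm h σ τ' := by
  simp [hermForm]

theorem hermForm_smul_left (c : ℂ) (σ τ : InvForms L) :
    hermForm h (c • σ) τ = starRingEnd ℂ c * hermForm h σ τ := by
  simp [hermForm]

theorem hermForm_smul_right (c : ℂ) (σ τ : InvForms L) :
    hermForm h σ (c • τ) = c * hermForm h σ τ := by
  simp [hermForm]

theorem hermForm_zero_left (τ : InvForms L) : hermForm h 0 τ = 0 := by simp [hermForm]

theorem hermForm_zero_right (σ : InvForms L) : hermForm h σ 0 = 0 := by simp [hermForm]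

theorem hermForm_neg_left (σ τ : InvForms L) : hermForm h (-σ) τ = -hermForm h σ τ := by
  simp [hermForm]

theorem hermForm_neg_right (σ τ : InvForms L) : hermForm h σ (-τ) = -hermForm h σ τ := by
  simp [hermForm]

theorem hermForm_sum_left {κ : Type*} (s : Finset κ) (f : κ → InvForms L) (τ : InvForms L) :
    hermForm h (∑ i ∈ s, f i) τ = ∑ i ∈ s, hermForm h (f i) τ := by
  simp [hermForm, LinearMap.sum_apply]

theorem hermForm_sum_right {κ : Type*} (s : Finset κ) (f : κ → InvForms L) (τ : InvForms L) :
    hermForm h τ (∑ i ∈ s, f i) = ∑ i ∈ s, hermForm h τ (f i) := by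
  simp [hermForm]

theorem hermForm_one_left (τ : InvForms L) : hermForm h 1 τ = scalarPart τ := by
  simp [hermForm]

theorem hermForm_one_right (σ : InvForms L) :
    hermForm h σ 1 = starRingEnd ℂ (scalarPart σ) := by
  induction σ using exterior_induction with
  | one => simp [hermForm_one_left]
  | smul r x hx => simp [hermForm_smul_left, hx]
  | add x y hx hy => simp [hermForm_add_left, hx, hy]
  | mul k x hx =>
    rw [hermForm_ι_mul_left, contract_one, scalarPart_ι_mul, hermForm_zero_right, map_zero]

/-- Exterior multiplication is adjoint to contraction. In the left variable this is built into the
definition; in the right variable it follows by induction on the left factor, from the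
anticommutation rule of contraction and wedge. Hermitian symmetry is deduced from the two versions.
-/
theorem hermForm_ι_mul_right (φ : CDual L) (σ τ : InvForms L) :
    hermForm h σ (ιₑ φ * τ) = hermForm h (contractLeft (sharp h (conjForm φ)) σ) τ := by
  induction σ using exterior_induction generalizing τ with
  | one => rw [hermForm_one_left, scalarPart_ι_mul, contract_one, hermForm_zero_left]
  | smul r x hx => simp [hermForm_smul_left, hx]
  | add x y hx hy => simp [hermForm_add_left, hx, hy]
  | mul k x hx =>
    rw [hermForm_ι_mul_left, contract_ι_mul, contract_ι_mul, sub_eq_add_neg, sub_eq_add_neg,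
      hermForm_add_left, hermForm_add_right, hermForm_smul_left, hermForm_smul_right,
      hermForm_neg_left, hermForm_neg_right, hx, hermForm_ι_mul_left, conj_sharp,
      conjForm_conjForm, sharp_comm h φ]

theorem hermForm_conj_symm (σ τ : InvForms L) :
    starRingEnd ℂ (hermForm h τ σ) = hermForm h σ τ := by
  induction σ using exterior_induction generalizing τ with
  | one => simp [hermForm_one_left, hermForm_one_right]
  | smul r x hx => simp [hermForm_smul_left, hermForm_smul_right, hx]
  | add x y hx hy => simp [hermForm_add_left, hermForm_add_right, hx, hy]
  | mul k x hx => rw [hermForm_ι_mul_right, hx, hermForm_ι_mul_left]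

/-! ### The number operator -/

/-- The number operator `∑ u^a ∧ ι_{u_a}`, which is `k` on `k`-forms. -/
def numberOp : Module.End ℂ (InvForms L) :=
  ∑ a, LinearMap.mulLeft ℂ (ιₑ (oncoframe h a)) * contractLeft (evalAt (onb h a))

theorem numberOp_apply (σ : InvForms L) :
    numberOp h σ = ∑ a, ιₑ (oncoframe h a) * contractLeft (evalAt (onb h a)) σ := by
  simp [numberOp, LinearMap.sum_apply]

theorem numberOp_one : numberOp h 1 = 0 := by
  rw [numberOp_apply]
  exact Finset.sum_eq_zero fun a _ => by rw [contract_one, mul_zero]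

theorem ι_mul_ι_mul_comm (φ ψ : CDual L) (σ : InvForms L) :
    ιₑ φ * (ιₑ ψ * σ) = -(ιₑ ψ * (ιₑ φ * σ)) := by
  have := ExteriorAlgebra.ι_add_mul_swap (R := ℂ) φ ψ
  rw [← mul_assoc, ← mul_assoc, eq_neg_of_add_eq_zero_left this, neg_mul]

theorem numberOp_ι_mul (φ : CDual L) (σ : InvForms L) :
    numberOp h (ιₑ φ * σ) = ιₑ φ * σ + ιₑ φ * numberOp h σ := by
  simp only [numberOp_apply]
  have h1 : ∀ a, ιₑ (oncoframe h a) * contractLeft (evalAt (onb h a)) (ιₑ φ * σ) =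
      ιₑ (φ (onb h a) • oncoframe h a) * σ +
        ιₑ φ * (ιₑ (oncoframe h a) * contractLeft (evalAt (onb h a)) σ) := by
    intro a
    rw [contract_ι_mul, mul_sub, ι_mul_ι_mul_comm, sub_neg_eq_add, map_smul]
    simp [evalAt]
  simp only [h1]
  rw [Finset.sum_add_distrib, ← Finset.sum_mul, ← map_sum, sum_oncoframe, Finset.mul_sum]

theorem numberOp_mul (σ τ : InvForms L) :
    numberOp h (σ * τ) = numberOp h σ * τ + σ * numberOp h τ := by
  induction σ using exterior_induction with
  | one => simp [numberOp_one]
  | smul r x hx => simp [hx]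
  | add x y hx hy => simp only [add_mul, map_add, hx, hy]; abel
  | mul k x hx =>
    rw [mul_assoc, numberOp_ι_mul, hx, numberOp_ι_mul, mul_add, add_mul]
    simp only [mul_assoc]
    abel

/-- Sum of the relations ι_{u_a}(u^a ∧ σ) + u^a ∧ ι_{u_a} σ = σ. It is used to bound degrees and to
show that powers of F do not vanish. -/
theorem sum_contract_ι_mul (σ : InvForms L) :
    ∑ a, contractLeft (evalAt (onb h a)) (ιₑ (oncoframe h a) * σ) =
      (Module.finrank ℝ L : ℂ) • σ - numberOp h σ := by
  have : ∀ a, contractLeft (evalAt (onb h a)) (ιₑ (oncoframe h a) * σ) =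
      σ - ιₑ (oncoframe h a) * contractLeft (evalAt (onb h a)) σ := by
    intro a
    rw [contract_ι_mul]
    simp [evalAt]
  simp only [this, numberOp_apply, Finset.sum_sub_distrib]
  simp [Nat.cast_smul_eq_nsmul]

/-- This makes the number operator self-adjoint and nonnegative, which yields both the orthogonality
of different degrees and the induction proving positivity. -/
theorem hermForm_numberOp (σ τ : InvForms L) : hermForm h σ (numberOp h τ) =
    ∑ a, hermForm h (contractLeft (evalAt (onb h a)) σ) (contractLeft (evalAt (onb h a)) τ) := by
  rw [numberOp_apply, hermForm_sum_right]
  refine Finset.sum_congr rfl fun a _ => ?_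
  rw [hermForm_ι_mul_right, conjForm_oncoframe, sharp_oncoframe]

theorem hermForm_numberOp_left (σ τ : InvForms L) :
    hermForm h (numberOp h σ) τ = hermForm h σ (numberOp h τ) := by
  rw [← hermForm_conj_symm, hermForm_numberOp, hermForm_numberOp, map_sum]
  simp only [hermForm_conj_symm]

theorem numberOp_of_mem {k : ℕ} {σ : InvForms L} (hσ : σ ∈ ⋀[ℂ]^k (CDual L)) :
    numberOp h σ = (k : ℂ) • σ := by
  induction k generalizing σ with
  | zero =>
    rw [ExteriorAlgebra.exteriorPower, pow_zero, Submodule.mem_one] at hσ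
    obtain ⟨c, rfl⟩ := hσ
    rw [Algebra.algebraMap_eq_smul_one, map_smul, numberOp_one]
    simp
  | succ k ih =>
    rw [ExteriorAlgebra.exteriorPower, pow_succ'] at hσ
    refine Submodule.mul_induction_on hσ ?_ ?_
    · rintro _ ⟨φ, rfl⟩ τ hτ
      rw [numberOp_ι_mul, ih hτ]
      push_cast
      rw [mul_smul_comm, add_smul, one_smul, add_comm]
    · intro x y hx hy
      rw [map_add, hx, hy, smul_add]

/-! ### Positivity of the Hermitian product -/

theorem contract_mem {k : ℕ} {σ : InvForms L} (d : Module.Dual ℂ (CDual L))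
    (hσ : σ ∈ ⋀[ℂ]^(k + 1) (CDual L)) : contractLeft d σ ∈ ⋀[ℂ]^k (CDual L) := by
  induction k generalizing σ with
  | zero =>
    rw [ExteriorAlgebra.exteriorPower, zero_add, pow_one] at hσ
    obtain ⟨φ, rfl⟩ := hσ
    rw [contract_ι, ExteriorAlgebra.exteriorPower, pow_zero]
    exact Submodule.smul_mem _ _ (Submodule.mem_one.2 ⟨1, map_one _⟩)
  | succ k ih =>
    rw [ExteriorAlgebra.exteriorPower, pow_succ'] at hσ
    refine Submodule.mul_induction_on hσ ?_ ?_
    · rintro _ ⟨φ, rfl⟩ τ hτ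
      rw [contract_ι_mul]
      refine Submodule.sub_mem _ (Submodule.smul_mem _ _ hτ) ?_
      rw [ExteriorAlgebra.exteriorPower, pow_succ']
      exact Submodule.mul_mem_mul ⟨φ, rfl⟩ (ih hτ)
    · intro x y hx hy
      rw [map_add]
      exact Submodule.add_mem _ hx hy

/-- Induction on the degree through (k+1)|σ|² = ∑ |ι_{u_a} σ|². If all the contractions vanish, then
(k+1)σ = ∑ u^a ∧ ι_{u_a} σ = 0. -/
theorem hermForm_pos_of_mem {k : ℕ} {σ : InvForms L} (hσ : σ ∈ ⋀[ℂ]^k (CDual L)) :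
    0 ≤ (hermForm h σ σ).re ∧ ((hermForm h σ σ).re = 0 → σ = 0) := by
  induction k generalizing σ with
  | zero =>
    rw [ExteriorAlgebra.exteriorPower, pow_zero, Submodule.mem_one] at hσ
    obtain ⟨c, rfl⟩ := hσ
    rw [Algebra.algebraMap_eq_smul_one, hermForm_smul_left, hermForm_smul_right, hermForm_one_left,
      map_one, mul_one, ← Complex.normSq_eq_conj_mul_self, Complex.ofReal_re]
    refine ⟨Complex.normSq_nonneg c, fun h0 => ?_⟩
    rw [Complex.normSq_eq_zero.1 h0, zero_smul]
  | succ k ih =>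
    have key : ((k : ℝ) + 1) * (hermForm h σ σ).re =
        ∑ a, (hermForm h (contractLeft (evalAt (onb h a)) σ)
          (contractLeft (evalAt (onb h a)) σ)).re := by
      have h1 := hermForm_numberOp h σ σ
      rw [numberOp_of_mem h hσ, hermForm_smul_right] at h1
      have h2 := congrArg Complex.re h1
      rw [Complex.re_sum] at h2
      rw [← h2]
      simp
    have hk : (0 : ℝ) < (k : ℝ) + 1 := by positivity
    have hnn : ∀ a ∈ Finset.univ, 0 ≤ (hermForm h (contractLeft (evalAt (onb h a)) σ)
          (contractLeft (evalAt (onb h a)) σ)).re := fun a _ => (ih (contract_mem _ hσ)).1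
    refine ⟨nonneg_of_mul_nonneg_right (key ▸ Finset.sum_nonneg hnn) hk, fun h0 => ?_⟩
    rw [h0, mul_zero, eq_comm, Finset.sum_eq_zero_iff_of_nonneg hnn] at key
    have hz : ∀ a, contractLeft (evalAt (onb h a)) σ = 0 := fun a =>
      (ih (contract_mem _ hσ)).2 (key a (Finset.mem_univ a))
    have h1 := numberOp_of_mem h hσ
    rw [numberOp_apply, Finset.sum_eq_zero fun a _ => by rw [hz a, mul_zero]] at h1
    refine (smul_eq_zero.1 h1.symm).resolve_left ?_
    exact_mod_cast Nat.succ_ne_zero k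

theorem hermForm_eq_zero_of_ne {j k : ℕ} (hjk : j ≠ k) {σ τ : InvForms L}
    (hσ : σ ∈ ⋀[ℂ]^j (CDual L)) (hτ : τ ∈ ⋀[ℂ]^k (CDual L)) : hermForm h σ τ = 0 := by
  have h1 := hermForm_numberOp_left h σ τ
  rw [numberOp_of_mem h hσ, numberOp_of_mem h hτ, hermForm_smul_left, hermForm_smul_right,
    Complex.conj_natCast, ← sub_eq_zero, ← sub_mul] at h1
  exact (mul_eq_zero.1 h1).resolve_left (sub_ne_zero.2 (by exact_mod_cast hjk))

theorem hermForm_pos (σ : InvForms L) :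
    0 ≤ (hermForm h σ σ).re ∧ ((hermForm h σ σ).re = 0 → σ = 0) := by
  classical
  let 𝒜 : ℕ → Submodule ℂ (InvForms L) := fun i => ⋀[ℂ]^i (CDual L)
  let s := (DirectSum.decompose 𝒜 σ).support
  let c : ℕ → InvForms L := fun i => DirectSum.decompose 𝒜 σ i
  have hc : ∀ i, c i ∈ ⋀[ℂ]^i (CDual L) := fun i => (DirectSum.decompose 𝒜 σ i).2
  have hsum : ∑ i ∈ s, c i = σ := DirectSum.sum_support_decompose 𝒜 σ
  have key : (hermForm h σ σ).re = ∑ i ∈ s, (hermForm h (c i) (c i)).re := by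
    rw [← Complex.re_sum]
    conv_lhs => rw [← hsum]
    rw [hermForm_sum_left]
    congr 1
    refine Finset.sum_congr rfl fun i hi => ?_
    rw [hermForm_sum_right, Finset.sum_eq_single i
      (fun j _ hj => hermForm_eq_zero_of_ne h hj.symm (hc i) (hc j)) (fun hn => absurd hi hn)]
  have hnn : ∀ i ∈ s, 0 ≤ (hermForm h (c i) (c i)).re := fun i _ =>
    (hermForm_pos_of_mem h (hc i)).1
  rw [key]
  refine ⟨Finset.sum_nonneg hnn, fun h0 => ?_⟩
  rw [Finset.sum_eq_zero_iff_of_nonneg hnn] at h0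
  rw [← hsum]
  exact Finset.sum_eq_zero fun i hi => (hermForm_pos_of_mem h (hc i)).2 (h0 i hi)

/-- The Hermitian product on left-invariant forms is an inner product. -/
@[reducible] def invCore : InnerProductSpace.Core ℂ (InvForms L) where
  inner := hermForm h
  conj_inner_symm := hermForm_conj_symm h
  re_inner_nonneg σ := (hermForm_pos h σ).1
  add_left := hermForm_add_left h
  smul_left σ τ c := hermForm_smul_left h c σ τ
  definite σ h0 := (hermForm_pos h σ).2 (by rw [h0, Complex.zero_re])

/-- No form lives above the top degree: ∑ |u^a ∧ σ|² = (dim - m)|σ|² has a nonnegative left side and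
a negative coefficient on the right. -/
theorem eq_zero_of_numberOp {σ : InvForms L} {m : ℕ} (hm : Module.finrank ℝ L < m)
    (hσ : numberOp h σ = (m : ℂ) • σ) : σ = 0 := by
  have h1 : ∑ a, hermForm h (ιₑ (oncoframe h a) * σ) (ιₑ (oncoframe h a) * σ) =
      ((Module.finrank ℝ L : ℂ) - m) * hermForm h σ σ := by
    rw [← hermForm_smul_right, sub_smul, ← hσ, ← sum_contract_ι_mul, hermForm_sum_right]
    refine Finset.sum_congr rfl fun a _ => ?_
    rw [hermForm_ι_mul_left, conjForm_oncoframe, sharp_oncoframe]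
  have h2 := congrArg Complex.re h1
  rw [Complex.re_sum] at h2
  have h3 : 0 ≤ ((Module.finrank ℝ L : ℝ) - m) * (hermForm h σ σ).re := by
    have : (((Module.finrank ℝ L : ℂ) - m) * hermForm h σ σ).re =
        ((Module.finrank ℝ L : ℝ) - m) * (hermForm h σ σ).re := by simp
    rw [← this, ← h2]
    exact Finset.sum_nonneg fun a _ => (hermForm_pos h _).1
  have h4 : (Module.finrank ℝ L : ℝ) < m := by exact_mod_cast hm
  have h5 := (hermForm_pos h σ).1
  exact (hermForm_pos h σ).2 (by nlinarith)

/-- By adjunction, σ minus its scalar part is orthogonal to 1 and to every product φ ∧ x, hence to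
all forms. -/
theorem eq_smul_one_of_contract {σ : InvForms L}
    (hσ : ∀ a, contractLeft (evalAt (onb h a)) σ = 0) : σ = scalarPart σ • 1 := by
  have h2 : ∀ τ, hermForm h τ (σ - scalarPart σ • 1) = 0 := by
    intro τ
    induction τ using exterior_induction with
    | one => rw [hermForm_one_left]; simp
    | smul r x hx => simp [hermForm_smul_left, hx]
    | add x y hx hy => simp [hermForm_add_left, hx, hy]
    | mul k x hx =>
      have hk : ∀ φ : CDual L, contractLeft (sharp h φ) (σ - scalarPart σ • 1) = 0 := by
        intro φ
        rw [← sum_oncoframe h φ, map_sum, map_sum, LinearMap.sum_apply]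
        refine Finset.sum_eq_zero fun a _ => ?_
        rw [map_smul, map_smul, LinearMap.smul_apply, sharp_oncoframe, map_sub, map_smul, hσ a,
          contract_one]
        simp
      rw [hermForm_ι_mul_left, hk, hermForm_zero_right]
  exact sub_eq_zero.1 ((hermForm_pos h _).2 (by rw [h2, Complex.zero_re]))

end

end Nilmanifold

end

noncomputable section

namespace Nilmanifold

/-! ### The fundamental form and the volume form -/

section

open CliffordAlgebra (contractLeft involute)

variable {L : Type*} [LieRing L] [LieAlgebra ℝ L]
  {𝒥 : InvComplexStructure L} [Module.Finite ℝ L] (h : InvHermitianMetric 𝒥)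

local notation "ιₑ" => ExteriorAlgebra.ι ℂ (M := CDual L)

theorem metric_J_left (v w : L) : h.g (𝒥.J v) w = -h.g v (𝒥.J w) := by
  rw [← h.compat (𝒥.J v) w, 𝒥.sq]
  simp

theorem metric_J_antisymm (v w : L) : h.g (𝒥.J v) w = -h.g (𝒥.J w) v := by
  rw [metric_J_left, h.symm]

theorem oncoframe_apply (a : Fin (Module.finrank ℝ L)) (v : L) :
    oncoframe h a v = (h.g (onb h a) v : ℂ) := by
  have key : h.g (onb h a) v = (onb h).repr v a := by
    conv_lhs => rw [← (onb h).sum_repr v]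
    simp only [map_sum, map_smul, onb_orthonormal, smul_eq_mul]
    simp
  simp [oncoframe, key]

/-- The complex `1`-form `g(J v, ·)`. -/
def fundFlat : L →ₗ[ℝ] CDual L :=
  (Complex.ofRealCLM.toLinearMap.compRight ℝ) ∘ₗ h.g ∘ₗ 𝒥.J

theorem fundFlat_apply (v w : L) : fundFlat h v w = (h.g (𝒥.J v) w : ℂ) := rfl

theorem contract_fundForm (d : Module.Dual ℂ (CDual L)) :
    contractLeft d (fundForm h) = ιₑ (∑ a, d (coframe L a) • fundFlat h (frame L a)) := by
  have h1 : ∀ a b, contractLeft d (ιₑ (coframe L a) * ιₑ (coframe L b)) =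
      d (coframe L a) • ιₑ (coframe L b) - d (coframe L b) • ιₑ (coframe L a) := by
    intro a b
    rw [contract_ι_mul, contract_ι, mul_smul_comm, mul_one]
  -- Skew-symmetry of g(J·,·) makes the two halves of the contraction equal, which absorbs the
  -- factor 1/2 in F.
  have h2 : ∑ a, ∑ b, (h.g (𝒥.J (frame L a)) (frame L b) : ℂ) •
      (d (coframe L b) • ιₑ (coframe L a)) = -∑ a, ∑ b,
        (h.g (𝒥.J (frame L a)) (frame L b) : ℂ) • (d (coframe L a) • ιₑ (coframe L b)) := by
    rw [Finset.sum_comm, ← Finset.sum_neg_distrib]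
    refine Finset.sum_congr rfl fun a _ => ?_
    rw [← Finset.sum_neg_distrib]
    refine Finset.sum_congr rfl fun b _ => ?_
    rw [metric_J_antisymm]
    simp
  have h3 : ∀ a, ιₑ (fundFlat h (frame L a)) =
      ∑ b, (h.g (𝒥.J (frame L a)) (frame L b) : ℂ) • ιₑ (coframe L b) := by
    intro a
    conv_lhs => rw [← sum_coframe (fundFlat h (frame L a))]
    simp only [map_sum, map_smul, fundFlat_apply]
  simp only [fundForm, map_smul, map_sum, h1, smul_sub, Finset.sum_sub_distrib]
  rw [← smul_sub, h2, sub_neg_eq_add, ← two_smul ℂ, smul_smul]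
  norm_num
  refine Finset.sum_congr rfl fun a _ => ?_
  rw [h3, Finset.smul_sum]
  exact Finset.sum_congr rfl fun b _ => smul_comm _ _ _

/-- The contraction is g(Jφ^♯, ·), and J is skew for g. As J is invertible, every 1-form is a
contraction of F. -/
theorem contract_sharp_fundForm (φ : CDual L) :
    contractLeft (sharp h φ) (fundForm h) = -ιₑ (precompJ 𝒥 φ) := by
  rw [contract_fundForm, ← map_neg]
  congr 1
  have h1 : ∀ v : L, ∑ a, coframe L a v • fundFlat h (frame L a) = fundFlat h v := by
    intro v
    conv_rhs => rw [← (frame L).sum_repr v, map_sum]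
    refine Finset.sum_congr rfl fun a _ => ?_
    rw [map_smul]
    ext w
    simp [coframe]
  simp only [sharp_apply, Finset.sum_smul]
  rw [Finset.sum_comm]
  have h2 : ∀ c, ∑ a, (φ (onb h c) * coframe L a (onb h c)) • fundFlat h (frame L a) =
      φ (onb h c) • fundFlat h (onb h c) := by
    intro c
    rw [← h1 (onb h c), Finset.smul_sum]
    exact Finset.sum_congr rfl fun a _ => mul_smul _ _ _
  simp only [h2]
  ext w
  have h3 := congrArg (fun χ : CDual L => χ (𝒥.J w)) (sum_oncoframe h φ)
  simp only [LinearMap.sum_apply, LinearMap.smul_apply, oncoframe_apply] at h3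
  simp only [LinearMap.sum_apply, LinearMap.smul_apply, fundFlat_apply, metric_J_left,
    LinearMap.neg_apply, precompJ, LinearMap.coe_mk, AddHom.coe_mk, LinearMap.comp_apply]
  rw [← h3]
  simp

theorem involute_ι_mul_ι (φ ψ : CDual L) : involute (ιₑ φ * ιₑ ψ) = ιₑ φ * ιₑ ψ := by
  have h2 : ∀ φ : CDual L, involute (ιₑ φ) = - ιₑ φ := fun φ => CliffordAlgebra.involute_ι _
  rw [map_mul, h2, h2, neg_mul_neg]

theorem involute_fundForm : involute (fundForm h) = fundForm h := by
  simp only [fundForm, map_smul, map_sum, involute_ι_mul_ι]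

theorem conjInv_fundForm : conjInv (fundForm h) = fundForm h := by
  simp only [fundForm, conjInv_smul, map_sum, map_mul, conjInv_ι, conjForm_coframe,
    Complex.conj_ofReal, map_div₀, map_one, map_ofNat]

theorem fundForm_mul_comm (σ : InvForms L) : fundForm h * σ = σ * fundForm h :=
  commute_of_involute (involute_fundForm h) σ

theorem numberOp_ι (φ : CDual L) : numberOp h (ιₑ φ) = ιₑ φ := by
  have := numberOp_ι_mul h φ 1
  simpa [numberOp_one] using this

theorem numberOp_fundForm : numberOp h (fundForm h) = (2 : ℂ) • fundForm h := by
  have : ∀ φ ψ : CDual L, numberOp h (ιₑ φ * ιₑ ψ) = (2 : ℂ) • (ιₑ φ * ιₑ ψ) := by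
    intro φ ψ
    rw [numberOp_ι_mul, numberOp_ι, two_smul]
  simp only [fundForm, map_smul, map_sum, this]
  rw [smul_comm (2 : ℂ) (1 / 2 : ℂ)]
  congr 1
  rw [Finset.smul_sum]
  refine Finset.sum_congr rfl fun a _ => ?_
  rw [Finset.smul_sum]
  exact Finset.sum_congr rfl fun b _ => smul_comm _ _ _

theorem numberOp_fundForm_pow (k : ℕ) :
    numberOp h (fundForm h ^ k) = ((2 * k : ℕ) : ℂ) • fundForm h ^ k := by
  induction k with
  | zero => simp [numberOp_one]
  | succ k ih =>
    rw [pow_succ, numberOp_mul, ih, numberOp_fundForm, smul_mul_assoc, mul_smul_comm, ← add_smul]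
    congr 1
    push_cast
    ring

theorem contract_fundForm_pow (d : Module.Dual ℂ (CDual L)) (k : ℕ) :
    contractLeft d (fundForm h ^ (k + 1)) =
      ((k : ℂ) + 1) • (contractLeft d (fundForm h) * fundForm h ^ k) := by
  induction k with
  | zero => simp
  | succ k ih =>
    rw [pow_succ', contract_mul, ih, involute_fundForm, mul_smul_comm, ← mul_assoc,
      fundForm_mul_comm, mul_assoc, ← pow_succ']
    push_cast
    module

theorem precompJ_precompJ (φ : CDual L) : precompJ 𝒥 (precompJ 𝒥 φ) = -φ := by
  ext v
  simp [precompJ, 𝒥.sq]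

/-- If F^(k+1) = 0, contracting it with a suitable vector gives φ ∧ F^k = 0 for every 1-form φ. Then
`sum_contract_ι_mul` gives (dim - 2k) F^k = 0 with a nonzero coefficient, contrary to induction. -/
theorem fundForm_pow_ne_zero (k : ℕ) (hk : 2 * k ≤ Module.finrank ℝ L) :
    fundForm h ^ k ≠ 0 := by
  induction k with
  | zero => simp
  | succ k ih =>
    intro h0
    refine ih (by omega) ?_
    have h1 : ∀ φ : CDual L, ιₑ φ * fundForm h ^ k = 0 := by
      intro φ
      have h2 := contract_fundForm_pow h (sharp h (precompJ 𝒥 φ)) k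
      rw [h0, map_zero, contract_sharp_fundForm, precompJ_precompJ, map_neg, neg_neg] at h2
      refine (smul_eq_zero.1 h2.symm).resolve_left ?_
      exact_mod_cast Nat.succ_ne_zero k
    have h2 := sum_contract_ι_mul h (fundForm h ^ k)
    rw [numberOp_fundForm_pow, ← sub_smul] at h2
    simp only [h1, map_zero, Finset.sum_const_zero] at h2
    refine (smul_eq_zero.1 h2.symm).resolve_left (sub_ne_zero.2 ?_)
    have : Module.finrank ℝ L ≠ 2 * k := by omega
    exact_mod_cast this

/-- Otherwise det(J)² = (-1)^dim would be negative. Evenness guarantees that the truncating division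
in `volForm` still produces a form of top degree. -/
theorem even_finrank (𝒥 : InvComplexStructure L) : Even (Module.finrank ℝ L) := by
  have h1 : 𝒥.J ∘ₗ 𝒥.J = (-1 : ℝ) • LinearMap.id := by
    ext v; simp [𝒥.sq]
  have h2 := congrArg LinearMap.det h1
  rw [LinearMap.det_comp, LinearMap.det_smul, LinearMap.det_id, mul_one] at h2
  by_contra hodd
  rw [Nat.not_even_iff_odd] at hodd
  rw [hodd.neg_one_pow] at h2
  nlinarith [mul_self_nonneg (LinearMap.det 𝒥.J)]

theorem volForm_ne_zero : volForm h ≠ 0 := by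
  refine smul_ne_zero (inv_ne_zero ?_) (fundForm_pow_ne_zero h _ (Nat.mul_div_le _ _))
  exact_mod_cast Nat.factorial_ne_zero _

theorem ι_mul_volForm (φ : CDual L) : ιₑ φ * volForm h = 0 := by
  refine eq_zero_of_numberOp h (m := Module.finrank ℝ L + 1) (Nat.lt_succ_self _) ?_
  rw [volForm, mul_smul_comm, map_smul, numberOp_ι_mul, numberOp_fundForm_pow,
    Nat.two_mul_div_two_of_even (even_finrank 𝒥), smul_comm]
  congr 1
  push_cast
  rw [add_smul, one_smul, mul_smul_comm, add_comm]

theorem involute_volForm : involute (volForm h) = volForm h := by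
  rw [volForm, map_smul, map_pow, involute_fundForm]

theorem conjInv_volForm : conjInv (volForm h) = volForm h := by
  rw [volForm, conjInv_smul, map_pow, conjInv_fundForm]
  simp

/-! ### The Hodge operator -/

theorem invStar_one : invStar h 1 = volForm h := by
  rw [invStar_apply, contraction_one]; rfl

theorem invStar_mul (σ τ : InvForms L) :
    invStar h (σ * τ) = contraction h τ (invStar h σ) := by
  rw [invStar_apply, contraction_mul]; rfl

/-- Moving φ to the last place, at the cost of the grade involution, makes φ^♯ the last vector to be
contracted. -/
theorem invStar_ι_mul (φ : CDual L) (σ : InvForms L) :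
    invStar h (ιₑ φ * σ) = contractLeft (sharp h φ) (invStar h (involute σ)) := by
  rw [ι_mul_eq_involute_mul, invStar_mul, contraction_ι]

theorem invStar_involute (σ : InvForms L) :
    invStar h (involute σ) = involute (invStar h σ) := by
  induction σ using exterior_induction with
  | one => rw [map_one, invStar_one, involute_volForm]
  | smul r x hx => simp [hx]
  | add x y hx hy => simp [hx, hy]
  | mul k x hx =>
    rw [involute_ι_mul, map_neg, invStar_ι_mul, invStar_ι_mul, involute_contract, hx,
      CliffordAlgebra.involute_involute, CliffordAlgebra.involute_involute]

/-- Dual to `invStar_ι_mul`: the Hodge operator exchanges interior and exterior multiplication. The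
induction starts from φ ∧ vol = 0. -/
theorem invStar_contract (φ : CDual L) (σ : InvForms L) :
    invStar h (contractLeft (sharp h φ) σ) = involute (ιₑ φ * invStar h σ) := by
  induction σ using exterior_induction with
  | one => rw [contract_one, invStar_one, ι_mul_volForm, map_zero, map_zero]
  | smul r x hx => simp [hx]
  | add x y hx hy => simp [mul_add, hx, hy]
  | mul k x hx =>
    rw [contract_ι_mul, map_sub, map_smul, invStar_ι_mul, invStar_involute, hx,
      CliffordAlgebra.involute_involute, contract_ι_mul, invStar_ι_mul, invStar_involute,
      involute_ι_mul, involute_contract, CliffordAlgebra.involute_involute, sharp_comm h k φ]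
    simp

/-- By the two exchange rules, ** passes through φ ∧ · with the sign of the grade involution, so it
is determined by its value at 1. That value is *vol, which every vector contracts to zero and which
is therefore a scalar, namely c = |vol|². Its exact value only rescales the adjoints. -/
theorem exists_invStar_invStar : ∃ c : ℝ, 0 < c ∧
    ∀ σ, invStar h (invStar h σ) = (c : ℂ) • involute σ := by
  set c := (hermForm h (volForm h) (volForm h)).re with hc
  have hcc : (c : ℂ) = hermForm h (volForm h) (volForm h) :=
    Complex.conj_eq_iff_re.1 (hermForm_conj_symm h _ _)
  have hvol : invStar h (volForm h) = (c : ℂ) • 1 := by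
    have h1 : hermForm h (volForm h) (volForm h) = scalarPart (invStar h (volForm h)) := by
      rw [hermForm, conjInv_volForm]; rfl
    rw [hcc, h1]
    refine eq_smul_one_of_contract h fun a => ?_
    rw [← sharp_oncoframe, ← contraction_ι, ← invStar_mul,
      commute_of_involute (involute_volForm h), ι_mul_volForm, map_zero]
  refine ⟨c, lt_of_le_of_ne (hermForm_pos h _).1 fun h0 => volForm_ne_zero h
    ((hermForm_pos h _).2 h0.symm), fun σ => ?_⟩
  induction σ using exterior_induction with
  | one => rw [invStar_one, hvol, map_one]
  | smul r x hx => rw [map_smul, map_smul, hx, map_smul, smul_comm]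
  | add x y hx hy => simp [hx, hy]
  | mul k x hx =>
    rw [invStar_ι_mul, invStar_contract, invStar_involute, invStar_involute, hx, involute_ι_mul,
      map_smul, CliffordAlgebra.involute_involute, map_smul, mul_smul_comm, involute_ι_mul,
      smul_neg]

end

end Nilmanifold

end

noncomputable section

namespace Nilmanifold

/-! ### The bigrading -/

section

open CliffordAlgebra (contractLeft involute)

variable {L : Type*} [LieRing L] [LieAlgebra ℝ L] {𝒥 : InvComplexStructure L}

local notation "ιₑ" => ExteriorAlgebra.ι ℂ (M := CDual L)

theorem pr10_apply (φ : CDual L) (v : L) :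
    pr10 𝒥 φ v = (1 / 2) * (φ v - Complex.I * φ (𝒥.J v)) := by
  simp [pr10, precompJ, mul_sub]

theorem pr01_apply (φ : CDual L) (v : L) :
    pr01 𝒥 φ v = (1 / 2) * (φ v + Complex.I * φ (𝒥.J v)) := by
  simp [pr01, precompJ, mul_add]

theorem pr10_add_pr01 (φ : CDual L) : pr10 𝒥 φ + pr01 𝒥 φ = φ := by
  ext v
  rw [LinearMap.add_apply, pr10_apply, pr01_apply]
  ring

theorem pr10_mem (φ : CDual L) : pr10 𝒥 φ ∈ forms10 𝒥 := by
  intro v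
  rw [pr10_apply, pr10_apply, 𝒥.sq, map_neg]
  linear_combination ((1 / 2) * φ (𝒥.J v)) * Complex.I_mul_I

theorem pr01_mem (φ : CDual L) : pr01 𝒥 φ ∈ forms01 𝒥 := by
  intro v
  rw [pr01_apply, pr01_apply, 𝒥.sq, map_neg]
  linear_combination ((1 / 2) * φ (𝒥.J v)) * Complex.I_mul_I

theorem pr10_eq {φ : CDual L} (hφ : φ ∈ forms10 𝒥) : pr10 𝒥 φ = φ := by
  ext v
  rw [pr10_apply, hφ v]
  linear_combination (-(1 / 2) * φ v) * Complex.I_mul_I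

theorem pr01_eq_zero {φ : CDual L} (hφ : φ ∈ forms10 𝒥) : pr01 𝒥 φ = 0 := by
  have := pr10_add_pr01 (𝒥 := 𝒥) φ
  rwa [pr10_eq hφ, add_eq_left] at this

theorem pr01_eq {φ : CDual L} (hφ : φ ∈ forms01 𝒥) : pr01 𝒥 φ = φ := by
  ext v
  rw [pr01_apply, hφ v]
  linear_combination (-(1 / 2) * φ v) * Complex.I_mul_I

theorem pr10_eq_zero {φ : CDual L} (hφ : φ ∈ forms01 𝒥) : pr10 𝒥 φ = 0 := by
  have := pr10_add_pr01 (𝒥 := 𝒥) φ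
  rwa [pr01_eq hφ, add_eq_right] at this

theorem conjForm_mem01 {φ : CDual L} (hφ : φ ∈ forms10 𝒥) : conjForm φ ∈ forms01 𝒥 := by
  intro v
  rw [conjForm_apply, hφ v]
  simp

theorem conjForm_mem10 {φ : CDual L} (hφ : φ ∈ forms01 𝒥) : conjForm φ ∈ forms10 𝒥 := by
  intro v
  rw [conjForm_apply, hφ v]
  simp

variable (𝒥) in
theorem typed_induction {P : InvForms L → Prop}
    (one : P 1) (smul : ∀ (r : ℂ) x, P x → P (r • x)) (add : ∀ x y, P x → P y → P (x + y))
    (mul10 : ∀ φ ∈ forms10 𝒥, ∀ x, P x → P (ιₑ φ * x))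
    (mul01 : ∀ φ ∈ forms01 𝒥, ∀ x, P x → P (ιₑ φ * x)) (x : InvForms L) : P x := by
  induction x using exterior_induction with
  | one => exact one
  | smul r x hx => exact smul r x hx
  | add x y hx hy => exact add x y hx hy
  | mul φ x hx =>
    rw [← pr10_add_pr01 (𝒥 := 𝒥) φ, map_add, add_mul]
    exact add _ _ (mul10 _ (pr10_mem φ) x hx) (mul01 _ (pr01_mem φ) x hx)

theorem invProj_apply (p q : ℕ) (σ : InvForms L) :
    invProj 𝒥 p q σ = (bigrade 𝒥 σ).coeff (p, q) := rfl

theorem bigrade_ι_mul10 {φ : CDual L} (hφ : φ ∈ forms10 𝒥) (σ : InvForms L) :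
    bigrade 𝒥 (ιₑ φ * σ) = AddMonoidAlgebra.single (1, 0) (ιₑ φ) * bigrade 𝒥 σ := by
  rw [map_mul]
  congr 1
  simp [bigrade, bigradeGen, pr10_eq hφ, pr01_eq_zero hφ]

theorem bigrade_ι_mul01 {φ : CDual L} (hφ : φ ∈ forms01 𝒥) (σ : InvForms L) :
    bigrade 𝒥 (ιₑ φ * σ) = AddMonoidAlgebra.single (0, 1) (ιₑ φ) * bigrade 𝒥 σ := by
  rw [map_mul]
  congr 1
  simp [bigrade, bigradeGen, pr01_eq hφ, pr10_eq_zero hφ]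

theorem invProj_one (p q : ℕ) :
    invProj 𝒥 p q 1 = if p = 0 ∧ q = 0 then 1 else 0 := by
  rw [invProj_apply, map_one, AddMonoidAlgebra.one_def, AddMonoidAlgebra.coeff_single,
    Finsupp.single_apply]
  refine if_congr ?_ rfl rfl
  simp [Prod.ext_iff, eq_comm]

theorem invProj_succ_ι_mul10 {φ : CDual L} (hφ : φ ∈ forms10 𝒥) (p q : ℕ) (σ : InvForms L) :
    invProj 𝒥 (p + 1) q (ιₑ φ * σ) = ιₑ φ * invProj 𝒥 p q σ := by
  rw [invProj_apply, bigrade_ι_mul10 hφ, invProj_apply,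
    ← AddMonoidAlgebra.coeff_single_mul_add (bigrade 𝒥 σ) (ιₑ φ) (1, 0) (p, q)]
  congr 1
  simp [add_comm]

theorem invProj_zero_ι_mul10 {φ : CDual L} (hφ : φ ∈ forms10 𝒥) (q : ℕ) (σ : InvForms L) :
    invProj 𝒥 0 q (ιₑ φ * σ) = 0 := by
  rw [invProj_apply, bigrade_ι_mul10 hφ]
  exact AddMonoidAlgebra.coeff_single_mul_of_forall_add_ne _ _ (by simp [Prod.ext_iff])

theorem invProj_succ_ι_mul01 {φ : CDual L} (hφ : φ ∈ forms01 𝒥) (p q : ℕ) (σ : InvForms L) :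
    invProj 𝒥 p (q + 1) (ιₑ φ * σ) = ιₑ φ * invProj 𝒥 p q σ := by
  rw [invProj_apply, bigrade_ι_mul01 hφ, invProj_apply,
    ← AddMonoidAlgebra.coeff_single_mul_add (bigrade 𝒥 σ) (ιₑ φ) (0, 1) (p, q)]
  congr 1
  simp [add_comm]

theorem invProj_zero_ι_mul01 {φ : CDual L} (hφ : φ ∈ forms01 𝒥) (p : ℕ) (σ : InvForms L) :
    invProj 𝒥 p 0 (ιₑ φ * σ) = 0 := by
  rw [invProj_apply, bigrade_ι_mul01 hφ]
  exact AddMonoidAlgebra.coeff_single_mul_of_forall_add_ne _ _ (by simp [Prod.ext_iff])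

theorem invProj_invProj (p q p' q' : ℕ) (σ : InvForms L) :
    invProj 𝒥 p q (invProj 𝒥 p' q' σ) =
      if p = p' ∧ q = q' then invProj 𝒥 p q σ else 0 := by
  induction σ using typed_induction 𝒥 generalizing p q p' q' with
  | one =>
    rw [invProj_one p', apply_ite (invProj 𝒥 p q), map_zero, invProj_one]
    split_ifs <;> first | rfl | omega
  | smul r x hx => simp only [map_smul, hx, smul_ite, smul_zero]
  | add x y hx hy =>
    simp only [map_add, hx, hy]
    split_ifs <;> simp
  | mul10 φ hφ x hx =>
    rcases p' with _ | p'
    · rw [invProj_zero_ι_mul10 hφ, map_zero]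
      split_ifs with h1
      · rw [h1.1, invProj_zero_ι_mul10 hφ]
      · rfl
    · rw [invProj_succ_ι_mul10 hφ]
      rcases p with _ | p
      · rw [invProj_zero_ι_mul10 hφ, invProj_zero_ι_mul10 hφ, ite_self]
      · rw [invProj_succ_ι_mul10 hφ, hx, invProj_succ_ι_mul10 hφ, mul_ite, mul_zero]
        simp
  | mul01 φ hφ x hx =>
    rcases q' with _ | q'
    · rw [invProj_zero_ι_mul01 hφ, map_zero]
      split_ifs with h1
      · rw [h1.2, invProj_zero_ι_mul01 hφ]
      · rfl
    · rw [invProj_succ_ι_mul01 hφ]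
      rcases q with _ | q
      · rw [invProj_zero_ι_mul01 hφ, invProj_zero_ι_mul01 hφ, ite_self]
      · rw [invProj_succ_ι_mul01 hφ, hx, invProj_succ_ι_mul01 hφ, mul_ite, mul_zero]
        simp

/-- The bound M depends on the form here; `sum_invProj` replaces it by the dimension. -/
theorem exists_sum_invProj (σ : InvForms L) : ∃ M : ℕ, ∀ A B, M < A → M < B →
    ∑ p ∈ Finset.range A, ∑ q ∈ Finset.range B, invProj 𝒥 p q σ = σ := by
  induction σ using typed_induction 𝒥 with
  | one =>
    refine ⟨0, fun A B hA hB => ?_⟩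
    rw [Finset.sum_eq_single 0, Finset.sum_eq_single 0]
    · simp [invProj_one]
    · intro q _ hq
      simp [invProj_one, hq]
    · intro h0
      simp at h0
      omega
    · intro p _ hp
      simp [invProj_one, hp]
    · intro h0
      simp at h0
      omega
  | smul r x hx =>
    obtain ⟨M, hM⟩ := hx
    exact ⟨M, fun A B hA hB => by simp only [map_smul, ← Finset.smul_sum, hM A B hA hB]⟩
  | add x y hx hy =>
    obtain ⟨M, hM⟩ := hx
    obtain ⟨M', hM'⟩ := hy
    refine ⟨max M M', fun A B hA hB => ?_⟩
    simp only [map_add, Finset.sum_add_distrib]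
    rw [hM A B (by omega) (by omega), hM' A B (by omega) (by omega)]
  | mul10 φ hφ x hx =>
    obtain ⟨M, hM⟩ := hx
    refine ⟨M + 1, fun A B hA hB => ?_⟩
    obtain ⟨A, rfl⟩ : ∃ A', A = A' + 1 := ⟨A - 1, by omega⟩
    rw [Finset.sum_range_succ']
    simp only [invProj_zero_ι_mul10 hφ, invProj_succ_ι_mul10 hφ, ← Finset.mul_sum]
    rw [hM A B (by omega) (by omega)]
    simp
  | mul01 φ hφ x hx =>
    obtain ⟨M, hM⟩ := hx
    refine ⟨M + 1, fun A B hA hB => ?_⟩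
    obtain ⟨B, rfl⟩ : ∃ B', B = B' + 1 := ⟨B - 1, by omega⟩
    simp only [Finset.sum_range_succ', invProj_zero_ι_mul01 hφ, invProj_succ_ι_mul01 hφ,
      ← Finset.mul_sum, add_zero]
    rw [hM A B (by omega) (by omega)]

/-- A functional vanishing on 𝔤^{1,0} is a vector of type (0,1), so contraction with it removes one
(0,1)-factor. The second clause covers the bidegree that would have index -1. -/
theorem invProj_contract01 {d : Module.Dual ℂ (CDual L)} (hd : ∀ φ ∈ forms10 𝒥, d φ = 0)
    (σ : InvForms L) :
    (∀ p q, invProj 𝒥 p q (contractLeft d σ) = contractLeft d (invProj 𝒥 p (q + 1) σ)) ∧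
      ∀ p, contractLeft d (invProj 𝒥 p 0 σ) = 0 := by
  induction σ using typed_induction 𝒥 with
  | one => constructor <;> intros <;> simp [invProj_one, apply_ite (contractLeft d)]
  | smul r x hx =>
    refine ⟨fun p q => ?_, fun p => ?_⟩
    · simp only [map_smul, hx.1]
    · simp only [map_smul, hx.2, smul_zero]
  | add x y hx hy =>
    refine ⟨fun p q => ?_, fun p => ?_⟩
    · simp only [map_add, hx.1, hy.1]
    · simp only [map_add, hx.2, hy.2, add_zero]
  | mul10 φ hφ x hx =>
    refine ⟨fun p q => ?_, fun p => ?_⟩ <;> rcases p with _ | p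
    · rw [contract_ι_mul, hd φ hφ, zero_smul, zero_sub, map_neg, invProj_zero_ι_mul10 hφ,
        invProj_zero_ι_mul10 hφ, map_zero, neg_zero]
    · rw [contract_ι_mul, hd φ hφ, zero_smul, zero_sub, map_neg, invProj_succ_ι_mul10 hφ,
        invProj_succ_ι_mul10 hφ, contract_ι_mul, hd φ hφ, zero_smul, zero_sub, hx.1]
    · rw [invProj_zero_ι_mul10 hφ, map_zero]
    · rw [invProj_succ_ι_mul10 hφ, contract_ι_mul, hd φ hφ, hx.2, mul_zero, zero_smul, sub_zero]
  | mul01 φ hφ x hx =>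
    refine ⟨fun p q => ?_, fun p => by rw [invProj_zero_ι_mul01 hφ, map_zero]⟩
    rw [contract_ι_mul, invProj_succ_ι_mul01 hφ, contract_ι_mul, map_sub, map_smul]
    rcases q with _ | q
    · rw [invProj_zero_ι_mul01 hφ, hx.2, mul_zero]
    · rw [invProj_succ_ι_mul01 hφ, hx.1]

theorem invProj_contract10 {d : Module.Dual ℂ (CDual L)} (hd : ∀ φ ∈ forms01 𝒥, d φ = 0)
    (σ : InvForms L) :
    (∀ p q, invProj 𝒥 p q (contractLeft d σ) = contractLeft d (invProj 𝒥 (p + 1) q σ)) ∧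
      ∀ q, contractLeft d (invProj 𝒥 0 q σ) = 0 := by
  induction σ using typed_induction 𝒥 with
  | one => constructor <;> intros <;> simp [invProj_one, apply_ite (contractLeft d)]
  | smul r x hx =>
    refine ⟨fun p q => ?_, fun p => ?_⟩
    · simp only [map_smul, hx.1]
    · simp only [map_smul, hx.2, smul_zero]
  | add x y hx hy =>
    refine ⟨fun p q => ?_, fun p => ?_⟩
    · simp only [map_add, hx.1, hy.1]
    · simp only [map_add, hx.2, hy.2, add_zero]
  | mul01 φ hφ x hx =>
    refine ⟨fun p q => ?_, fun q => ?_⟩ <;> rcases q with _ | q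
    · rw [contract_ι_mul, hd φ hφ, zero_smul, zero_sub, map_neg, invProj_zero_ι_mul01 hφ,
        invProj_zero_ι_mul01 hφ, map_zero, neg_zero]
    · rw [contract_ι_mul, hd φ hφ, zero_smul, zero_sub, map_neg, invProj_succ_ι_mul01 hφ,
        invProj_succ_ι_mul01 hφ, contract_ι_mul, hd φ hφ, zero_smul, zero_sub, hx.1]
    · rw [invProj_zero_ι_mul01 hφ, map_zero]
    · rw [invProj_succ_ι_mul01 hφ, contract_ι_mul, hd φ hφ, hx.2, mul_zero, zero_smul, sub_zero]
  | mul10 φ hφ x hx =>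
    refine ⟨fun p q => ?_, fun p => by rw [invProj_zero_ι_mul10 hφ, map_zero]⟩
    rw [contract_ι_mul, invProj_succ_ι_mul10 hφ, contract_ι_mul, map_sub, map_smul]
    rcases p with _ | p
    · rw [invProj_zero_ι_mul10 hφ, hx.2, mul_zero]
    · rw [invProj_succ_ι_mul10 hφ, hx.1]

variable [Module.Finite ℝ L] (h : InvHermitianMetric 𝒥)

theorem numberOp_invProj (p q : ℕ) (σ : InvForms L) :
    numberOp h (invProj 𝒥 p q σ) = ((p + q : ℕ) : ℂ) • invProj 𝒥 p q σ := by
  induction σ using typed_induction 𝒥 generalizing p q with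
  | one =>
    rw [invProj_one]
    split_ifs with h0
    · simp [numberOp_one, h0]
    · simp
  | smul r x hx => simp only [map_smul, hx, smul_comm r]
  | add x y hx hy => simp only [map_add, hx, hy, smul_add]
  | mul10 φ hφ x hx =>
    rcases p with _ | p
    · rw [invProj_zero_ι_mul10 hφ, map_zero, smul_zero]
    · rw [invProj_succ_ι_mul10 hφ, numberOp_ι_mul, hx, mul_smul_comm]
      push_cast
      module
  | mul01 φ hφ x hx =>
    rcases q with _ | q
    · rw [invProj_zero_ι_mul01 hφ, map_zero, smul_zero]
    · rw [invProj_succ_ι_mul01 hφ, numberOp_ι_mul, hx, mul_smul_comm]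
      push_cast
      module

theorem sum_invProj (h : InvHermitianMetric 𝒥) :
    ∑ p ∈ Finset.range (Module.finrank ℝ L + 1),
    ∑ q ∈ Finset.range (Module.finrank ℝ L + 1), invProj 𝒥 p q = 1 := by
  refine LinearMap.ext fun σ => ?_
  obtain ⟨M, hM⟩ := exists_sum_invProj (𝒥 := 𝒥) σ
  set N := Module.finrank ℝ L
  -- The (p,q)-component is an eigenvector of the number operator with eigenvalue p + q, and
  -- eigenvalues above the real dimension do not occur.
  have hz : ∀ p q, N < p + q → invProj 𝒥 p q σ = 0 := fun p q hpq =>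
    eq_zero_of_numberOp h hpq (numberOp_invProj h p q σ)
  have h1 := hM (M + N + 1) (M + N + 1) (by omega) (by omega)
  simp only [LinearMap.sum_apply, Module.End.one_apply]
  conv_rhs => rw [← h1]
  refine (Finset.sum_subset (Finset.range_mono (by omega)) ?_).trans
    (Finset.sum_congr rfl fun p _ => Finset.sum_subset (Finset.range_mono (by omega)) ?_)
  · intro p _ hp
    rw [Finset.mem_range] at hp
    exact Finset.sum_eq_zero fun q _ => hz p q (by omega)
  · intro q _ hq
    rw [Finset.mem_range] at hq
    exact hz p q (by omega)

end

/-! ### Splitting an operator of total degree one by type -/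

section

variable {W : Type*} [AddCommGroup W] [Module ℂ W]

/-- `A` raises the bidegree by `(1, 0)`. -/
structure RaisesLeft (π : ℕ → ℕ → Module.End ℂ W) (A : Module.End ℂ W) : Prop where
  zero : ∀ q, π 0 q * A = 0
  succ : ∀ p q, π (p + 1) q * A = A * π p q

/-- `A` raises the bidegree by `(0, 1)`. -/
structure RaisesRight (π : ℕ → ℕ → Module.End ℂ W) (A : Module.End ℂ W) : Prop where
  zero : ∀ p, π p 0 * A = 0
  succ : ∀ p q, π p (q + 1) * A = A * π p q

variable {π : ℕ → ℕ → Module.End ℂ W} {A B : Module.End ℂ W}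

theorem RaisesLeft.add (hA : RaisesLeft π A) (hB : RaisesLeft π B) : RaisesLeft π (A + B) :=
  ⟨fun q => by rw [mul_add, hA.zero, hB.zero, add_zero],
    fun p q => by rw [mul_add, hA.succ, hB.succ, add_mul]⟩

theorem RaisesRight.add (hA : RaisesRight π A) (hB : RaisesRight π B) : RaisesRight π (A + B) :=
  ⟨fun q => by rw [mul_add, hA.zero, hB.zero, add_zero],
    fun p q => by rw [mul_add, hA.succ, hB.succ, add_mul]⟩

theorem RaisesLeft.sum {κ : Type*} (s : Finset κ) {f : κ → Module.End ℂ W}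
    (hf : ∀ i, RaisesLeft π (f i)) : RaisesLeft π (∑ i ∈ s, f i) :=
  ⟨fun q => by rw [Finset.mul_sum]; exact Finset.sum_eq_zero fun i _ => (hf i).zero q,
    fun p q => by
      rw [Finset.mul_sum, Finset.sum_mul]
      exact Finset.sum_congr rfl fun i _ => (hf i).succ p q⟩

theorem RaisesRight.sum {κ : Type*} (s : Finset κ) {f : κ → Module.End ℂ W}
    (hf : ∀ i, RaisesRight π (f i)) : RaisesRight π (∑ i ∈ s, f i) :=
  ⟨fun q => by rw [Finset.mul_sum]; exact Finset.sum_eq_zero fun i _ => (hf i).zero q,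
    fun p q => by
      rw [Finset.mul_sum, Finset.sum_mul]
      exact Finset.sum_congr rfl fun i _ => (hf i).succ p q⟩

/-- Between the projections only the summand of the right bidegree survives, giving A π^{p,q};
summing over all types restores A. -/
theorem delOf_add {N : ℕ}
    (hπ : ∀ p q p' q', π p q * π p' q' = if p = p' ∧ q = q' then π p q else 0)
    (hsum : ∑ p ∈ Finset.range (N + 1), ∑ q ∈ Finset.range (N + 1), π p q = 1)
    (hA : RaisesLeft π A) (hB : RaisesRight π B) : delOf N π (A + B) = A := by
  have h1 : ∀ p q, π (p + 1) q * (A + B) * π p q = A * π p q := by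
    intro p q
    have hB' : π (p + 1) q * B * π p q = 0 := by
      rcases q with _ | q
      · rw [hB.zero, zero_mul]
      · rw [hB.succ, mul_assoc, hπ, if_neg (by omega), mul_zero]
    rw [mul_add, add_mul, hB', hA.succ, mul_assoc, hπ, if_pos ⟨rfl, rfl⟩, add_zero]
  simp only [delOf, h1, ← Finset.mul_sum]
  rw [hsum, mul_one]

theorem delbarOf_add {N : ℕ}
    (hπ : ∀ p q p' q', π p q * π p' q' = if p = p' ∧ q = q' then π p q else 0)
    (hsum : ∑ p ∈ Finset.range (N + 1), ∑ q ∈ Finset.range (N + 1), π p q = 1)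
    (hA : RaisesLeft π A) (hB : RaisesRight π B) :
    delbarOf N π (A + B) = B := by
  have h1 : ∀ p q, π p (q + 1) * (A + B) * π p q = B * π p q := by
    intro p q
    have hA' : π p (q + 1) * A * π p q = 0 := by
      rcases p with _ | p
      · rw [hA.zero, zero_mul]
      · rw [hA.succ, mul_assoc, hπ, if_neg (by omega), mul_zero]
    rw [mul_add, add_mul, hA', hB.succ, mul_assoc, hπ, if_pos ⟨rfl, rfl⟩, zero_add]
  simp only [delbarOf, h1, ← Finset.mul_sum]
  rw [hsum, mul_one]

end

end Nilmanifold

end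

noncomputable section

namespace Nilmanifold

/-! ### The structure equations -/

section

open CliffordAlgebra (contractLeft involute)

variable {L : Type*} [LieRing L] [LieAlgebra ℝ L] [Module.Finite ℝ L]
  {𝒥 : InvComplexStructure L}

local notation "ιₑ" => ExteriorAlgebra.ι ℂ (M := CDual L)

theorem ceD_apply (σ : InvForms L) : ceD L σ = (-(1 / 2) : ℂ) • ∑ a, ∑ b,
    ιₑ (coframe L a) * (ιₑ (coframe L b) *
      contractLeft (evalAt ⁅frame L a, frame L b⁆) σ) := by
  simp [ceD, wedgeLeft, interiorProd, LinearMap.sum_apply]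

theorem ceD_one : ceD L 1 = 0 := by
  simp [ceD_apply]

theorem ceD_ι (φ : CDual L) : ceD L (ιₑ φ) = (-(1 / 2) : ℂ) • ∑ a, ∑ b,
    φ ⁅frame L a, frame L b⁆ • (ιₑ (coframe L a) * ιₑ (coframe L b)) := by
  rw [ceD_apply]
  congr 1
  refine Finset.sum_congr rfl fun a _ => Finset.sum_congr rfl fun b _ => ?_
  rw [contract_ι, mul_smul_comm, mul_smul_comm, mul_one]
  rfl

/-- Each e^a ∧ e^b ∧ ι_v is an antiderivation, since ι_v is one and e^a ∧ e^b is even; the Jacobi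
identity plays no role. -/
theorem ceD_ι_mul (φ : CDual L) (σ : InvForms L) :
    ceD L (ιₑ φ * σ) = ceD L (ιₑ φ) * σ - ιₑ φ * ceD L σ := by
  have key : ∀ a b, ιₑ (coframe L a) * (ιₑ (coframe L b) *
      contractLeft (evalAt ⁅frame L a, frame L b⁆) (ιₑ φ * σ)) =
      φ ⁅frame L a, frame L b⁆ • (ιₑ (coframe L a) * ιₑ (coframe L b)) * σ -
      ιₑ φ * (ιₑ (coframe L a) * (ιₑ (coframe L b) *
        contractLeft (evalAt ⁅frame L a, frame L b⁆) σ)) := by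
    intro a b
    rw [contract_ι_mul, mul_sub, mul_sub, ι_mul_ι_mul_comm (coframe L b) φ, mul_neg,
      ι_mul_ι_mul_comm (coframe L a) φ, neg_neg, mul_smul_comm, mul_smul_comm, smul_mul_assoc,
      mul_assoc]
    rfl
  rw [ceD_apply, ceD_ι, ceD_apply]
  simp only [key, Finset.sum_sub_distrib, smul_sub, smul_mul_assoc, Finset.sum_mul, mul_smul_comm,
    Finset.mul_sum]

theorem ceD_ι_conjForm (φ : CDual L) : ceD L (ιₑ (conjForm φ)) = conjInv (ceD L (ιₑ φ)) := by
  simp only [ceD_ι, conjInv_smul, map_sum, map_mul, conjInv_ι, conjForm_coframe, conjForm_apply,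
    map_neg, map_div₀, map_one, map_ofNat]

/-! ### The metric and types of 1-forms -/

variable (h : InvHermitianMetric 𝒥)

theorem sharp_precompJ (φ ψ : CDual L) :
    sharp h φ (precompJ 𝒥 ψ) = -sharp h (precompJ 𝒥 φ) ψ := by
  have hJ : ∀ (χ : CDual L) a, χ (𝒥.J (onb h a)) =
      ∑ b, χ (onb h b) * (h.g (onb h b) (𝒥.J (onb h a)) : ℂ) := by
    intro χ a
    have := congrArg (fun ξ : CDual L => ξ (𝒥.J (onb h a))) (sum_oncoframe h χ)
    simpa [LinearMap.sum_apply, oncoframe_apply] using this.symm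
  have e : ∀ χ : CDual L, ∀ v, precompJ 𝒥 χ v = χ (𝒥.J v) := fun _ _ => rfl
  simp only [sharp_apply, e, hJ, Finset.mul_sum, Finset.sum_mul]
  rw [Finset.sum_comm, ← Finset.sum_neg_distrib]
  refine Finset.sum_congr rfl fun a _ => ?_
  rw [← Finset.sum_neg_distrib]
  refine Finset.sum_congr rfl fun b _ => ?_
  rw [h.symm (onb h a), metric_J_left]
  push_cast
  ring

theorem sharp_injective {φ : CDual L} (hφ : ∀ ψ, sharp h φ ψ = 0) : φ = 0 := by
  have : ∀ a, φ (onb h a) = 0 := by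
    intro a
    have := hφ (oncoframe h a)
    rw [sharp_comm, sharp_oncoframe] at this
    exact this
  rw [← sum_oncoframe h φ]
  exact Finset.sum_eq_zero fun a _ => by rw [this a, zero_smul]

theorem precompJ_eq10 {φ : CDual L} (hφ : φ ∈ forms10 𝒥) :
    precompJ 𝒥 φ = Complex.I • φ := LinearMap.ext fun v => hφ v

theorem precompJ_eq01 {φ : CDual L} (hφ : φ ∈ forms01 𝒥) :
    precompJ 𝒥 φ = -Complex.I • φ := LinearMap.ext fun v => hφ v

/-- J is skew for the bilinear pairing `sharp` and acts on both forms by the same scalar, so the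
pairing vanishes: it pairs each type only with the opposite type. -/
theorem sharp_eq_zero_of_mem01 {φ ψ : CDual L} (hφ : φ ∈ forms01 𝒥) (hψ : ψ ∈ forms01 𝒥) :
    sharp h φ ψ = 0 := by
  have h1 := sharp_precompJ h φ ψ
  rw [precompJ_eq01 hφ, precompJ_eq01 hψ, map_smul, map_smul, LinearMap.smul_apply,
    smul_eq_mul] at h1
  have h2 : (2 * Complex.I) * sharp h φ ψ = 0 := by linear_combination -h1
  exact (mul_eq_zero.1 h2).resolve_left (by simp)

theorem sharp_eq_zero_of_mem10 {φ ψ : CDual L} (hφ : φ ∈ forms10 𝒥) (hψ : ψ ∈ forms10 𝒥) :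
    sharp h φ ψ = 0 := by
  have h1 := sharp_precompJ h φ ψ
  rw [precompJ_eq10 hφ, precompJ_eq10 hψ, map_smul, map_smul, LinearMap.smul_apply,
    smul_eq_mul] at h1
  have h2 : (2 * Complex.I) * sharp h φ ψ = 0 := by linear_combination h1
  exact (mul_eq_zero.1 h2).resolve_left (by simp)

theorem mem_forms01_of_sharp {ζ : CDual L} (hζ : ∀ ψ ∈ forms01 𝒥, sharp h ζ ψ = 0) :
    ζ ∈ forms01 𝒥 := by
  have key : precompJ 𝒥 ζ + Complex.I • ζ = 0 := by
    refine sharp_injective h fun ψ => ?_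
    -- Since J² = -1, the operator J - i maps every form into the (-i)-eigenspace; skewness then
    -- transfers it to ζ.
    have hm : precompJ 𝒥 ψ - Complex.I • ψ ∈ forms01 𝒥 := by
      intro v
      simp only [precompJ, LinearMap.coe_mk, AddHom.coe_mk, LinearMap.sub_apply,
        LinearMap.comp_apply, LinearMap.smul_apply, 𝒥.sq, map_neg, smul_eq_mul]
      linear_combination (-ψ v) * Complex.I_mul_I
    have h1 := hζ _ hm
    rw [map_sub, map_smul, sharp_precompJ] at h1
    rw [map_add, map_smul, LinearMap.add_apply, LinearMap.smul_apply]
    linear_combination -h1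
  intro v
  have := congrArg (fun χ : CDual L => χ v) key
  simp only [precompJ, LinearMap.coe_mk, AddHom.coe_mk, LinearMap.add_apply,
    LinearMap.comp_apply, LinearMap.smul_apply, LinearMap.zero_apply, smul_eq_mul] at this
  linear_combination this

/-- `Ω` is a `2`-form built from forms of the types given by `S` and `T` that are orthogonal to
`ζ` and to its conjugate. -/
def perpForms (S T : Submodule ℂ (CDual L)) (ζ : CDual L) : Submodule ℂ (InvForms L) :=
  Submodule.span ℂ {σ | ∃ φ ∈ S, ∃ ψ ∈ T, (sharp h ζ φ = 0 ∧ sharp h (conjForm ζ) φ = 0) ∧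
    (sharp h ζ ψ = 0 ∧ sharp h (conjForm ζ) ψ = 0) ∧ σ = ιₑ φ * ιₑ ψ}

/-! ### Forms orthogonal to ζ and the operator Ω ∧ ι_{ζ^♯} -/

variable {h} {S T : Submodule ℂ (CDual L)} {ζ : CDual L} {Ω : InvForms L}

theorem involute_perpForms (hΩ : Ω ∈ perpForms h S T ζ) : involute Ω = Ω := by
  induction hΩ using Submodule.span_induction with
  | mem x hx =>
    obtain ⟨φ, -, ψ, -, -, -, rfl⟩ := hx
    exact involute_ι_mul_ι φ ψ
  | zero => exact map_zero _
  | add x y _ _ hx hy => rw [map_add, hx, hy]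
  | smul c x _ hx => rw [map_smul, hx]

theorem contract_perpForms (hΩ : Ω ∈ perpForms h S T ζ) :
    contractLeft (sharp h ζ) Ω = 0 ∧ contractLeft (sharp h (conjForm ζ)) Ω = 0 := by
  induction hΩ using Submodule.span_induction with
  | mem x hx =>
    obtain ⟨φ, -, ψ, -, hφ, hψ, rfl⟩ := hx
    simp [contract_ι_mul, hφ.1, hφ.2, hψ.1, hψ.2]
  | zero => exact ⟨map_zero _, map_zero _⟩
  | add x y _ _ hx hy => exact ⟨by rw [map_add, hx.1, hy.1, add_zero],
      by rw [map_add, hx.2, hy.2, add_zero]⟩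
  | smul c x _ hx => exact ⟨by rw [map_smul, hx.1, smul_zero], by rw [map_smul, hx.2, smul_zero]⟩

/-- Passing ζ through the contractions by the two factors of Ω produces two signs, which cancel, and
metric terms, which vanish by orthogonality. -/
theorem contraction_perpForms_ι_mul (hΩ : Ω ∈ perpForms h S T ζ) (σ : InvForms L) :
    contraction h Ω (ιₑ ζ * σ) = ιₑ ζ * contraction h Ω σ := by
  induction hΩ using Submodule.span_induction with
  | mem x hx =>
    obtain ⟨φ, -, ψ, -, hφ, hψ, rfl⟩ := hx
    rw [contraction_ι_mul, contraction_ι_mul, contraction_ι, contract_ι_mul, sharp_comm h φ ζ,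
      hφ.1, zero_smul, zero_sub, map_neg, contract_ι_mul, sharp_comm h ψ ζ, hψ.1]
    simp
  | zero => simp
  | add x y _ _ hx hy => simp only [map_add, LinearMap.add_apply, hx, hy, mul_add]
  | smul c x _ hx => simp only [map_smul, LinearMap.smul_apply, hx, mul_smul_comm]

theorem conjInv_perpForms {S' T' : Submodule ℂ (CDual L)}
    (hS : ∀ φ ∈ S, conjForm φ ∈ S') (hT : ∀ φ ∈ T, conjForm φ ∈ T')
    (hΩ : Ω ∈ perpForms h S T ζ) : conjInv Ω ∈ perpForms h S' T' (conjForm ζ) := by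
  have key : ∀ χ φ : CDual L, sharp h χ φ = 0 → sharp h (conjForm χ) (conjForm φ) = 0 := by
    intro χ φ h0
    rw [← conj_sharp, h0, map_zero]
  induction hΩ using Submodule.span_induction with
  | mem x hx =>
    obtain ⟨φ, hφS, ψ, hψT, hφ, hψ, rfl⟩ := hx
    rw [map_mul, conjInv_ι, conjInv_ι]
    exact Submodule.subset_span ⟨_, hS φ hφS, _, hT ψ hψT, ⟨key _ _ hφ.1, key _ _ hφ.2⟩,
      ⟨key _ _ hψ.1, key _ _ hψ.2⟩, rfl⟩
  | zero => rw [map_zero]; exact zero_mem _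
  | add x y _ _ hx hy => rw [map_add]; exact add_mem hx hy
  | smul c x _ hx => rw [conjInv_smul]; exact Submodule.smul_mem _ _ hx

variable (h) in
/-- The operator `σ ↦ Ω ∧ ι_{ζ^♯} σ`. -/
def twistOp (Ω : InvForms L) (ζ : CDual L) : Module.End ℂ (InvForms L) :=
  LinearMap.mulLeft ℂ Ω * contractLeft (sharp h ζ)

theorem twistOp_apply (σ : InvForms L) :
    twistOp h Ω ζ σ = Ω * contractLeft (sharp h ζ) σ := rfl

/-- Ω is even, hence central, so multiplying the antiderivation ι_{ζ^♯} by it leaves an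
antiderivation. This is the Leibniz rule for ∂ and ∂̄ on left-invariant forms. -/
theorem twistOp_mul (hΩ : Ω ∈ perpForms h S T ζ) (σ τ : InvForms L) :
    twistOp h Ω ζ (σ * τ) = twistOp h Ω ζ σ * τ + involute σ * twistOp h Ω ζ τ := by
  simp only [twistOp_apply]
  rw [contract_mul, mul_add, mul_assoc, ← mul_assoc Ω (involute σ),
    commute_of_involute (involute_perpForms hΩ) (involute σ), mul_assoc]

theorem hermForm_twistOp (σ τ : InvForms L) :
    hermForm h (twistOp h (conjInv Ω) (conjForm ζ) σ) τ =
      hermForm h σ (ιₑ ζ * contraction h Ω τ) := by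
  rw [twistOp_apply, hermForm_mul_left, conjInv_conjInv, hermForm_ι_mul_right]

/-- Compared with `hermForm_twistOp`, this shows that conjugating by * turns the operator of (Ω, ζ)
into -c times the adjoint of the operator of (Ω̄, ζ̄). -/
theorem invStar_twistOp_invStar {c : ℂ}
    (hc : ∀ σ, invStar h (invStar h σ) = c • involute σ) (hΩ : Ω ∈ perpForms h S T ζ)
    (σ : InvForms L) :
    invStar h (twistOp h Ω ζ (invStar h σ)) = -(c • (ιₑ ζ * contraction h Ω σ)) := by
  rw [twistOp_apply, commute_of_involute (involute_perpForms hΩ), invStar_mul, invStar_contract, hc,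
    mul_smul_comm, map_smul, involute_ι_mul, CliffordAlgebra.involute_involute, map_smul, map_neg,
    contraction_perpForms_ι_mul hΩ, smul_neg]

theorem invStar_wedgeLeft_invStar {c : ℂ}
    (hc : ∀ σ, invStar h (invStar h σ) = c • involute σ) (φ : CDual L) (σ : InvForms L) :
    invStar h (wedgeLeft φ (invStar h σ)) = c • contractLeft (sharp h φ) σ := by
  have : wedgeLeft φ (invStar h σ) = ιₑ φ * invStar h σ := rfl
  rw [this, invStar_ι_mul, invStar_involute, hc, map_smul, CliffordAlgebra.involute_involute,
    map_smul]

/-- For ζ of type (0,1) the vector ζ^♯ has type (1,0), so contraction lowers the bidegree by (1,0)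
and Ω raises it by (1,1). -/
theorem raisesRight_twistOp (hΩ : Ω ∈ perpForms h (forms10 𝒥) (forms01 𝒥) ζ)
    (hζ : ζ ∈ forms01 𝒥) : RaisesRight (invProj 𝒥) (twistOp h Ω ζ) := by
  have hd := fun σ => invProj_contract10 (𝒥 := 𝒥) (d := sharp h ζ)
    (fun ψ hψ => sharp_eq_zero_of_mem01 h hζ hψ) σ
  have hmul : ∀ x, (∀ p q, invProj 𝒥 (p + 1) (q + 1) (Ω * x) = Ω * invProj 𝒥 p q x) ∧
      (∀ p, invProj 𝒥 p 0 (Ω * x) = 0) ∧ ∀ q, invProj 𝒥 0 q (Ω * x) = 0 := by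
    intro x
    induction hΩ using Submodule.span_induction with
    | mem y hy =>
      obtain ⟨φ, hφ, ψ, hψ, -, -, rfl⟩ := hy
      refine ⟨fun p q => ?_, fun p => ?_, fun q => ?_⟩
      · rw [mul_assoc, invProj_succ_ι_mul10 hφ, invProj_succ_ι_mul01 hψ, mul_assoc]
      · rcases p with _ | p
        · rw [mul_assoc, invProj_zero_ι_mul10 hφ]
        · rw [mul_assoc, invProj_succ_ι_mul10 hφ, invProj_zero_ι_mul01 hψ, mul_zero]
      · rw [mul_assoc, invProj_zero_ι_mul10 hφ]
    | zero => simp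
    | add y z _ _ hy hz =>
      refine ⟨fun p q => ?_, fun p => ?_, fun q => ?_⟩
      · rw [add_mul, map_add, hy.1, hz.1, add_mul]
      · rw [add_mul, map_add, hy.2.1, hz.2.1, add_zero]
      · rw [add_mul, map_add, hy.2.2, hz.2.2, add_zero]
    | smul c y _ hy =>
      refine ⟨fun p q => ?_, fun p => ?_, fun q => ?_⟩
      · rw [smul_mul_assoc, map_smul, hy.1, smul_mul_assoc]
      · rw [smul_mul_assoc, map_smul, hy.2.1, smul_zero]
      · rw [smul_mul_assoc, map_smul, hy.2.2, smul_zero]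
  refine ⟨fun p => LinearMap.ext fun σ => ?_, fun p q => LinearMap.ext fun σ => ?_⟩
  · exact (hmul _).2.1 p
  · change invProj 𝒥 p (q + 1) (Ω * contractLeft (sharp h ζ) σ) =
      Ω * contractLeft (sharp h ζ) (invProj 𝒥 p q σ)
    rcases p with _ | p
    · rw [(hmul _).2.2, (hd σ).2, mul_zero]
    · rw [(hmul _).1, (hd σ).1]

theorem raisesLeft_twistOp (hΩ : Ω ∈ perpForms h (forms01 𝒥) (forms10 𝒥) ζ)
    (hζ : ζ ∈ forms10 𝒥) : RaisesLeft (invProj 𝒥) (twistOp h Ω ζ) := by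
  have hd := fun σ => invProj_contract01 (𝒥 := 𝒥) (d := sharp h ζ)
    (fun ψ hψ => sharp_eq_zero_of_mem10 h hζ hψ) σ
  have hmul : ∀ x, (∀ p q, invProj 𝒥 (p + 1) (q + 1) (Ω * x) = Ω * invProj 𝒥 p q x) ∧
      (∀ p, invProj 𝒥 p 0 (Ω * x) = 0) ∧ ∀ q, invProj 𝒥 0 q (Ω * x) = 0 := by
    intro x
    induction hΩ using Submodule.span_induction with
    | mem y hy =>
      obtain ⟨φ, hφ, ψ, hψ, -, -, rfl⟩ := hy
      refine ⟨fun p q => ?_, fun p => ?_, fun q => ?_⟩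
      · rw [mul_assoc, invProj_succ_ι_mul01 hφ, invProj_succ_ι_mul10 hψ, mul_assoc]
      · rw [mul_assoc, invProj_zero_ι_mul01 hφ]
      · rcases q with _ | q
        · rw [mul_assoc, invProj_zero_ι_mul01 hφ]
        · rw [mul_assoc, invProj_succ_ι_mul01 hφ, invProj_zero_ι_mul10 hψ, mul_zero]
    | zero => simp
    | add y z _ _ hy hz =>
      refine ⟨fun p q => ?_, fun p => ?_, fun q => ?_⟩
      · rw [add_mul, map_add, hy.1, hz.1, add_mul]
      · rw [add_mul, map_add, hy.2.1, hz.2.1, add_zero]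
      · rw [add_mul, map_add, hy.2.2, hz.2.2, add_zero]
    | smul c y _ hy =>
      refine ⟨fun p q => ?_, fun p => ?_, fun q => ?_⟩
      · rw [smul_mul_assoc, map_smul, hy.1, smul_mul_assoc]
      · rw [smul_mul_assoc, map_smul, hy.2.1, smul_zero]
      · rw [smul_mul_assoc, map_smul, hy.2.2, smul_zero]
  refine ⟨fun q => LinearMap.ext fun σ => ?_, fun p q => LinearMap.ext fun σ => ?_⟩
  · exact (hmul _).2.2 q
  · change invProj 𝒥 (p + 1) q (Ω * contractLeft (sharp h ζ) σ) =
      Ω * contractLeft (sharp h ζ) (invProj 𝒥 p q σ)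
    rcases q with _ | q
    · rw [(hmul _).2.1, (hd σ).2, mul_zero]
    · rw [(hmul _).1, (hd σ).1]

variable (h) in
/-- The structure equations: `d = Ω ∧ ι_{ζ^♯} + Ω̄ ∧ ι_{ζ̄^♯}` on left-invariant forms, where `ζ` is
a `(0,1)`-form and `Ω` is a `(1,1)`-form orthogonal to `ζ` and `ζ̄`. -/
structure StructureEq (Ω : InvForms L) (ζ : CDual L) : Prop where
  ceD_eq : ceD L = twistOp h (conjInv Ω) (conjForm ζ) + twistOp h Ω ζ
  mem01 : ζ ∈ forms01 𝒥
  perp : Ω ∈ perpForms h (forms10 𝒥) (forms01 𝒥) ζ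

theorem StructureEq.conj_perp (hs : StructureEq h Ω ζ) :
    conjInv Ω ∈ perpForms h (forms01 𝒥) (forms10 𝒥) (conjForm ζ) :=
  conjInv_perpForms (fun _ => conjForm_mem01) (fun _ => conjForm_mem10) hs.perp

theorem StructureEq.raisesRight (hs : StructureEq h Ω ζ) :
    RaisesRight (invProj 𝒥) (twistOp h Ω ζ) :=
  raisesRight_twistOp hs.perp hs.mem01

theorem StructureEq.raisesLeft (hs : StructureEq h Ω ζ) :
    RaisesLeft (invProj 𝒥) (twistOp h (conjInv Ω) (conjForm ζ)) :=
  raisesLeft_twistOp hs.conj_perp (conjForm_mem10 hs.mem01)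

theorem StructureEq.twistOp_twistOp (hs : StructureEq h Ω ζ) (σ : InvForms L) :
    twistOp h (conjInv Ω) (conjForm ζ) (twistOp h Ω ζ σ) = conjInv Ω * Ω *
      contractLeft (sharp h (conjForm ζ)) (contractLeft (sharp h ζ) σ) := by
  rw [twistOp_apply, twistOp_apply, contract_mul, (contract_perpForms hs.perp).2, zero_mul,
    zero_add, involute_perpForms hs.perp, mul_assoc]

/-- The two contractions turn F into i|ζ|², so the vanishing at F means ζ = 0 or Ω̄ ∧ Ω = 0. Either
alternative kills the operator at every σ. -/
theorem StructureEq.twistOp_twistOp_eq_zero (hs : StructureEq h Ω ζ)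
    (hF : twistOp h (conjInv Ω) (conjForm ζ) (twistOp h Ω ζ (fundForm h)) = 0)
    (σ : InvForms L) : twistOp h (conjInv Ω) (conjForm ζ) (twistOp h Ω ζ σ) = 0 := by
  rw [hs.twistOp_twistOp] at hF ⊢
  rw [contract_sharp_fundForm, precompJ_eq01 hs.mem01, map_smul, neg_smul, neg_neg, map_smul,
    contract_ι, smul_smul, mul_smul_comm, mul_one] at hF
  rcases smul_eq_zero.1 hF with h0 | h0
  · have h1 : sharp h (conjForm ζ) ζ = 0 :=
      (mul_eq_zero.1 h0).resolve_left Complex.I_ne_zero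
    have h2 : ζ = 0 := by
      have h3 : ∑ a, Complex.normSq (ζ (onb h a)) = 0 := by
        rw [sharp_apply] at h1
        simp only [conjForm_apply, ← Complex.normSq_eq_conj_mul_self] at h1
        exact_mod_cast h1
      rw [Finset.sum_eq_zero_iff_of_nonneg fun a _ => Complex.normSq_nonneg _] at h3
      rw [← sum_oncoframe h ζ]
      exact Finset.sum_eq_zero fun a _ => by
        rw [Complex.normSq_eq_zero.1 (h3 a (Finset.mem_univ a)), zero_smul]
    simp [h2]
  · rw [h0, zero_mul]

-- Both sides are antiderivations annihilating 1, so comparison on 1-forms suffices. The (0,1)-forms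
-- follow from the (1,0)-forms because d commutes with conjugation.
variable (h) in
theorem structureEq_of_basis {n : ℕ} (η : Module.Basis (Fin n) ℂ (forms10 𝒥))
    (hdη : ∀ i, ceD L (ιₑ (η i : CDual L)) = sharp h ζ (η i : CDual L) • Ω)
    (hζ : ζ ∈ forms01 𝒥) (hΩ : Ω ∈ perpForms h (forms10 𝒥) (forms01 𝒥) ζ) :
    StructureEq h Ω ζ := by
  refine ⟨?_, hζ, hΩ⟩
  have h10 : ∀ φ ∈ forms10 𝒥, ceD L (ιₑ φ) = sharp h ζ φ • Ω := by
    have hlin : (ceD L ∘ₗ ιₑ) ∘ₗ (forms10 𝒥).subtype =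
        ((sharp h ζ).smulRight Ω) ∘ₗ (forms10 𝒥).subtype :=
      η.ext fun i => hdη i
    intro φ hφ
    exact congrArg (fun f => f ⟨φ, hφ⟩) hlin
  have h01 : ∀ φ ∈ forms01 𝒥, ceD L (ιₑ φ) = sharp h (conjForm ζ) φ • conjInv Ω := by
    intro φ hφ
    rw [← conjForm_conjForm φ, ceD_ι_conjForm, h10 _ (conjForm_mem10 hφ), conjInv_smul, conj_sharp]
  have hι : ∀ φ, ceD L (ιₑ φ) = sharp h (conjForm ζ) φ • conjInv Ω + sharp h ζ φ • Ω := by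
    intro φ
    have e1 := sharp_eq_zero_of_mem01 h hζ (pr01_mem (𝒥 := 𝒥) φ)
    have e2 := sharp_eq_zero_of_mem10 h (conjForm_mem10 hζ) (pr10_mem (𝒥 := 𝒥) φ)
    rw [← pr10_add_pr01 (𝒥 := 𝒥) φ, map_add, map_add, h10 _ (pr10_mem φ), h01 _ (pr01_mem φ),
      map_add, map_add, e1, e2, zero_add, add_zero, add_comm]
  have hinv := involute_perpForms hΩ
  have hinv' : involute (conjInv Ω) = conjInv Ω := by rw [involute_conjInv, hinv]
  refine LinearMap.ext fun σ => ?_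
  simp only [LinearMap.add_apply, twistOp_apply]
  induction σ using exterior_induction with
  | one => simp [ceD_one]
  | smul r x hx => simp only [map_smul, hx, mul_smul_comm, smul_add]
  | add x y hx hy => simp only [map_add, hx, hy, mul_add]; abel
  | mul φ x hx =>
    rw [ceD_ι_mul, hι, hx, contract_ι_mul, contract_ι_mul, mul_sub, mul_sub, ← mul_assoc Ω,
      ← mul_assoc (conjInv Ω) (ιₑ φ), commute_of_involute hinv (ιₑ φ),
      commute_of_involute hinv' (ιₑ φ)]
    simp only [add_mul, mul_add, smul_mul_assoc, mul_smul_comm, mul_assoc]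
    abel

variable (h) in
theorem exists_structureEq {n : ℕ} (η : Module.Basis (Fin n) ℂ (forms10 𝒥))
    (hclosed : ∀ i : Fin n, (i : ℕ) + 1 < n → ceD _ (ιₑ (η i : CDual L)) = 0)
    (hlast : ∀ k : Fin n, (k : ℕ) + 1 = n → ceD _ (ιₑ (η k : CDual L)) ∈
      Submodule.span ℂ {σ | ∃ i j : Fin n, (i : ℕ) + 1 < n ∧ (j : ℕ) + 1 < n ∧
        σ = ιₑ (η i : CDual L) * ιₑ (conjForm (η j : CDual L))}) :
    ∃ Ω ζ, StructureEq h Ω ζ := by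
  rcases n with _ | m
  -- With an empty coframe there is no last form, and zero data suffice.
  · exact ⟨0, 0, structureEq_of_basis h η (fun i => i.elim0) (zero_mem _) (zero_mem _)⟩
  -- The (1,0)-vector dual to η^n, extended by zero to the (0,1)-forms; ζ will be the form with ζ^♯
  -- = z.
  let z : Module.Dual ℂ (CDual L) :=
    η.coord (Fin.last m) ∘ₗ (pr10 𝒥).codRestrict (forms10 𝒥) pr10_mem
  have hz10 : ∀ i, z (η i : CDual L) = if i = Fin.last m then 1 else 0 := by
    intro i
    have : (pr10 𝒥).codRestrict (forms10 𝒥) pr10_mem (η i : CDual L) = η i :=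
      Subtype.ext (pr10_eq (η i).2)
    change η.coord (Fin.last m) ((pr10 𝒥).codRestrict (forms10 𝒥) pr10_mem (η i : CDual L)) = _
    rw [this, Module.Basis.coord_apply, Module.Basis.repr_self, Finsupp.single_apply]
  have hz01 : ∀ φ ∈ forms01 𝒥, z φ = 0 := by
    intro φ hφ
    have : (pr10 𝒥).codRestrict (forms10 𝒥) pr10_mem φ = 0 := Subtype.ext (pr10_eq_zero hφ)
    change η.coord (Fin.last m) ((pr10 𝒥).codRestrict (forms10 𝒥) pr10_mem φ) = _
    rw [this, map_zero]
  obtain ⟨ζ, hζ⟩ := exists_sharp_eq h z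
  have hlt : ∀ i : Fin (m + 1), (i : ℕ) + 1 < m + 1 → i ≠ Fin.last m := by
    rintro i hi rfl
    simp at hi
  have hperp : ∀ i : Fin (m + 1), (i : ℕ) + 1 < m + 1 → sharp h ζ (η i : CDual L) = 0 := by
    intro i hi
    rw [hζ, hz10, if_neg (hlt i hi)]
  refine ⟨ceD L (ιₑ (η (Fin.last m) : CDual L)), ζ, structureEq_of_basis h η (fun i => ?_)
    (mem_forms01_of_sharp h (by rwa [hζ])) ?_⟩
  · rw [hζ, hz10]
    split_ifs with hi
    · rw [hi, one_smul]
    · rw [zero_smul]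
      refine hclosed i ?_
      have := Fin.val_lt_last hi
      omega
  -- The remaining indices i, j < n are what makes both factors orthogonal to ζ and ζ̄; the mixed
  -- conditions hold by type.
  · refine Submodule.span_le.2 ?_ (hlast (Fin.last m) rfl)
    rintro _ ⟨i, j, hi, hj, rfl⟩
    refine Submodule.subset_span ⟨_, (η i).2, _, conjForm_mem01 (η j).2, ⟨hperp i hi, ?_⟩,
      ⟨?_, ?_⟩, rfl⟩
    · rw [← conjForm_conjForm (η i : CDual L), ← conj_sharp, hζ, hz01 _ (conjForm_mem01 (η i).2),
        map_zero]
    · rw [hζ, hz01 _ (conjForm_mem01 (η j).2)]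
    · rw [← conj_sharp, hperp j hj, map_zero]

end

end Nilmanifold

end

noncomputable section

namespace Nilmanifold

/-! ### Integration over `Γ \ G` -/

section FundamentalDomain

open MeasureTheory Topology
open scoped Pointwise

variable {G : Type*} [Group G] [TopologicalSpace G] [IsTopologicalGroup G]

/-- The union of the powers of a compact symmetric neighbourhood of 1 is open and closed. This leads
to second countability of G and countability of Γ. -/
theorem sigmaCompactSpace_of_connected [LocallyCompactSpace G] [PreconnectedSpace G] :
    SigmaCompactSpace G := by
  obtain ⟨K₀, hK₀, hK₀1⟩ := exists_compact_mem_nhds (1 : G)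
  set K := K₀ ∪ K₀⁻¹ with hKdef
  have hK : IsCompact K := hK₀.union hK₀.inv
  have hK1 : K ∈ 𝓝 (1 : G) := Filter.mem_of_superset hK₀1 Set.subset_union_left
  have hsymm : ∀ x ∈ K, x⁻¹ ∈ K := by
    rintro x (hx | hx)
    · exact Or.inr (by simpa using hx)
    · exact Or.inl hx
  have hpow : ∀ n : ℕ, IsCompact (K ^ n) := by
    intro n
    induction n with
    | zero => rw [pow_zero]; exact isCompact_singleton
    | succ n ih => rw [pow_succ]; exact ih.mul hK
  have hnhds : ∀ y : G, {x | y⁻¹ * x ∈ K} ∈ 𝓝 y := fun y => by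
    have hc : ContinuousAt (fun x => y⁻¹ * x) y := by fun_prop
    exact hc (by simpa using hK1)
  have hclopen : IsClopen (⋃ n : ℕ, K ^ n) := by
    refine ⟨⟨isOpen_iff_mem_nhds.2 fun y hy => ?_⟩, isOpen_iff_mem_nhds.2 fun y hy => ?_⟩
    · refine Filter.mem_of_superset (hnhds y) fun x hx hx' => hy ?_
      obtain ⟨n, hn⟩ := Set.mem_iUnion.1 hx'
      refine Set.mem_iUnion.2 ⟨n + 1, ?_⟩
      rw [pow_succ]
      exact ⟨x, hn, (y⁻¹ * x)⁻¹, hsymm _ hx, by simp⟩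
    · obtain ⟨n, hn⟩ := Set.mem_iUnion.1 hy
      refine Filter.mem_of_superset (hnhds y) fun x hx => Set.mem_iUnion.2 ⟨n + 1, ?_⟩
      rw [pow_succ]
      exact ⟨y, hn, y⁻¹ * x, hx, by simp⟩
  have huniv := hclopen.eq_univ ⟨1, Set.mem_iUnion.2 ⟨0, by simp⟩⟩
  exact isSigmaCompact_univ_iff.1 ⟨fun n => K ^ n, hpow, huniv⟩

/-- A discrete cocompact subgroup has a relatively compact Borel fundamental domain. -/
theorem exists_fundamentalDomain [LocallyCompactSpace G] [MeasurableSpace G] [BorelSpace G]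
    (Γ : Subgroup G) [DiscreteTopology Γ] [CompactSpace (Quotient (QuotientGroup.rightRel Γ))] :
    ∃ D : Set G, MeasurableSet D ∧ (∀ x : G, ∃! γ : Γ, γ • x ∈ D) ∧
      ∃ K : Set G, IsCompact K ∧ D ⊆ K := by
  obtain ⟨V, hVo, hV⟩ : ∃ V : Set G, IsOpen V ∧ ((↑) : Γ → G) ⁻¹' V = {1} :=
    isOpen_induced_iff.1 (isOpen_discrete ({1} : Set Γ))
  have hV1 : (1 : G) ∈ V := by
    have : (1 : Γ) ∈ ((↑) : Γ → G) ⁻¹' V := by rw [hV]; rfl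
    exact this
  -- W W⁻¹ will lie in V, which meets Γ only in 1, so distinct points of a right translate of W lie
  -- in distinct Γ-orbits. Intersecting with K₀ keeps these translates inside compact sets.
  obtain ⟨W₀, hW₀, hW₀V⟩ := exists_nhds_split_inv (hVo.mem_nhds hV1)
  obtain ⟨K₀, hK₀, hK₀1⟩ := exists_compact_mem_nhds (1 : G)
  set W := interior (W₀ ∩ K₀) with hW
  have hWo : IsOpen W := isOpen_interior
  have hW1 : (1 : G) ∈ W := mem_interior_iff_mem_nhds.2 (Filter.inter_mem hW₀ hK₀1)
  let U : G → Set G := fun x => {y | y * x⁻¹ ∈ W}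
  have hUo : ∀ x, IsOpen (U x) := fun x => hWo.preimage (by fun_prop)
  have hUx : ∀ x, x ∈ U x := fun x => by simpa [U] using hW1
  -- The Γ-saturation of U x, which is the full preimage of an open subset of the quotient.
  let S : G → Set G := fun x => ⋃ γ : Γ, {y | (γ : G) * y ∈ U x}
  have hSo : ∀ x, IsOpen (S x) := fun x =>
    isOpen_iUnion fun γ => (hUo x).preimage (by fun_prop)
  have hSinv : ∀ x y (γ : Γ), (γ : G) * y ∈ S x → y ∈ S x := by
    intro x y γ hy
    obtain ⟨δ, hδ⟩ := Set.mem_iUnion.1 hy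
    refine Set.mem_iUnion.2 ⟨δ * γ, ?_⟩
    simpa [mul_assoc] using hδ
  have hUS : ∀ x, U x ⊆ S x := fun x y hy => Set.mem_iUnion.2 ⟨1, by simpa using hy⟩
  have hmk : ∀ x, IsOpen ((Quotient.mk (QuotientGroup.rightRel Γ)) '' S x) := by
    intro x
    refine isOpen_coinduced.2 ?_
    have : Quotient.mk (QuotientGroup.rightRel Γ) ⁻¹'
        (Quotient.mk (QuotientGroup.rightRel Γ) '' S x) = S x := by
      refine Set.Subset.antisymm ?_ (Set.subset_preimage_image _ _)
      rintro y ⟨z, hz, hzy⟩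
      have h1 : y * z⁻¹ ∈ Γ := QuotientGroup.rightRel_apply.1 (Quotient.exact hzy)
      refine hSinv x y ⟨y * z⁻¹, h1⟩⁻¹ ?_
      simpa using hz
    exact this.symm ▸ hSo x
  obtain ⟨t, ht⟩ := isCompact_univ.elim_finite_subcover
    (fun x => Quotient.mk (QuotientGroup.rightRel Γ) '' S x) hmk (fun q _ => by
      induction q using Quotient.inductionOn with
      | h x => exact Set.mem_iUnion.2 ⟨x, x, hUS x (hUx x), rfl⟩)
  have hcover : ∀ y : G, ∃ i : Fin t.card, y ∈ S (t.equivFin.symm i) := by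
    intro y
    have h1 := ht (Set.mem_univ (Quotient.mk (QuotientGroup.rightRel Γ) y))
    simp only [Set.mem_iUnion] at h1
    obtain ⟨x, hx, z, hz, hzy⟩ := h1
    refine ⟨t.equivFin ⟨x, hx⟩, ?_⟩
    have h1 : y * z⁻¹ ∈ Γ := QuotientGroup.rightRel_apply.1 (Quotient.exact hzy)
    rw [Equiv.symm_apply_apply]
    refine hSinv x y ⟨y * z⁻¹, h1⟩⁻¹ ?_
    simpa using hz
  let c : Fin t.card → G := fun i => t.equivFin.symm i
  -- From each U (c i) keep the points whose orbit meets no U (c j) with j < i.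
  refine ⟨⋃ i, U (c i) \ ⋃ j : {j // j < i}, S (c j), ?_, ?_, ⋃ i, (fun y => y * c i) '' K₀, ?_, ?_⟩
  · exact MeasurableSet.iUnion fun i => (hUo _).measurableSet.diff
      (isOpen_iUnion fun j => hSo _).measurableSet
  · intro x
    classical
    obtain ⟨i, hi, hmin⟩ : ∃ i, x ∈ S (c i) ∧ ∀ j < i, x ∉ S (c j) := by
      have hne : {i | x ∈ S (c i)}.Nonempty := hcover x
      refine ⟨wellFounded_lt.min _ hne, wellFounded_lt.min_mem _ hne, fun j hj hx => ?_⟩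
      exact wellFounded_lt.not_lt_min {i | x ∈ S (c i)} hx hj
    obtain ⟨γ, hγ⟩ := Set.mem_iUnion.1 hi
    have hmem : ∀ δ : Γ, δ • x ∈ ⋃ i, U (c i) \ ⋃ j : {j // j < i}, S (c j) →
        (δ : G) * x ∈ U (c i) := by
      intro δ hδ
      obtain ⟨k, hk, hk'⟩ := Set.mem_iUnion.1 hδ
      rcases lt_trichotomy k i with hki | rfl | hki
      · exact absurd (hSinv _ _ δ (hUS _ hk)) (hmin k hki)
      · exact hk
      · refine absurd (Set.mem_iUnion.2 ⟨⟨i, hki⟩, ?_⟩) hk'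
        refine hSinv _ _ δ⁻¹ ?_
        have : ((δ⁻¹ : Γ) : G) * (δ • x) = x := by simp [Subgroup.smul_def]
        rw [this]
        exact hi
    refine ⟨γ, Set.mem_iUnion.2 ⟨i, hγ, fun hx => ?_⟩, fun δ hδ => ?_⟩
    · obtain ⟨⟨j, hj⟩, hx⟩ := Set.mem_iUnion.1 hx
      exact hmin j hj (hSinv _ _ γ hx)
    · have h1 : (δ : G) * x * (c i)⁻¹ ∈ W₀ := (interior_subset (hmem δ hδ)).1
      have h2 : (γ : G) * x * (c i)⁻¹ ∈ W₀ := (interior_subset (show _ ∈ W from hγ)).1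
      have h3 := hW₀V _ h1 _ h2
      have h4 : (δ : G) * x * (c i)⁻¹ / ((γ : G) * x * (c i)⁻¹) = ((δ * γ⁻¹ : Γ) : G) := by
        simp [div_eq_mul_inv, mul_assoc]
      rw [h4] at h3
      have h5 : δ * γ⁻¹ ∈ ((↑) : Γ → G) ⁻¹' V := h3
      rw [hV] at h5
      exact mul_inv_eq_one.1 h5
  · exact isCompact_iUnion fun i => hK₀.image (by fun_prop)
  · refine Set.iUnion_mono fun i y hy => ⟨y * (c i)⁻¹, ?_, by simp⟩
    exact (interior_subset (show _ ∈ W from hy.1)).2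

/-! ### Unimodularity and right translation -/

variable [LocallyCompactSpace G] [SecondCountableTopology G] [MeasurableSpace G] [BorelSpace G]
  {Γ : Subgroup G} [Countable Γ] {μ : Measure G} [μ.IsHaarMeasure]

theorem existsUnique_preimage_mul_right {D : Set G} (hD : ∀ x : G, ∃! γ : Γ, γ • x ∈ D) (g : G)
    (x : G) : ∃! γ : Γ, γ • x ∈ (fun y => y * g) ⁻¹' D := by
  have := hD (x * g)
  simpa only [Set.mem_preimage, smul_mul_assoc] using this

/-- The right translate of Haar measure is left-invariant, hence a multiple of it. A fundamental
domain and its right translate have the same finite nonzero measure, so the multiple is 1. -/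
theorem map_mul_right_eq {D : Set G} (hDm : MeasurableSet D) (hD : ∀ x : G, ∃! γ : Γ, γ • x ∈ D)
    (hfin : μ D ≠ ⊤) (g : G) : μ.map (fun x => x * g) = μ := by
  have h1 := Measure.isMulLeftInvariant_eq_smul (μ.map (fun x => x * g)) μ
  have hf := IsFundamentalDomain.mk' (μ := μ) hDm.nullMeasurableSet hD
  have hf' := IsFundamentalDomain.mk' (μ := μ)
    (hDm.preimage (measurable_mul_const g)).nullMeasurableSet (existsUnique_preimage_mul_right hD g)
  have h2 : μ.map (fun x => x * g) D = μ D := by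
    rw [Measure.map_apply (measurable_mul_const g) hDm]
    exact hf'.measure_eq hf
  have hne : μ D ≠ 0 := hf.measure_ne_zero (NeZero.ne μ)
  set c := (μ.map (fun x => x * g)).haarScalarFactor μ
  rw [h1] at h2 ⊢
  have hc : (c : ENNReal) = 1 := by
    have h3 : (c : ENNReal) * μ D = 1 * μ D := by
      rw [one_mul]
      exact h2
    exact (ENNReal.mul_left_inj hne hfin).1 h3
  have hc' : c = 1 := by exact_mod_cast hc
  rw [hc', one_smul]

/-- Right translation preserves the measure and carries D to another fundamental domain, over which
a Γ-invariant function has the same integral. -/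
theorem setIntegral_mul_right {D : Set G} (hDm : MeasurableSet D)
    (hD : ∀ x : G, ∃! γ : Γ, γ • x ∈ D) (hfin : μ D ≠ ⊤) (g : G) {f : G → ℂ}
    (hf : ∀ (γ : Γ) (x : G), f (γ • x) = f x) :
    ∫ x in D, f (x * g) ∂μ = ∫ x in D, f x ∂μ := by
  have hmp : MeasurePreserving (fun x => x * g) μ μ :=
    ⟨measurable_mul_const g, map_mul_right_eq hDm hD hfin g⟩
  have h1 := hmp.setIntegral_preimage_emb (measurableEmbedding_mulRight g) f
    ((fun y => y * g⁻¹) ⁻¹' D)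
  have h2 : (fun x => x * g) ⁻¹' ((fun y => y * g⁻¹) ⁻¹' D) = D := by
    ext x; simp
  rw [h2] at h1
  rw [h1]
  exact (IsFundamentalDomain.mk' (μ := μ)
    (hDm.preimage (measurable_mul_const g⁻¹)).nullMeasurableSet
    (existsUnique_preimage_mul_right hD g⁻¹)).setIntegral_eq
    (IsFundamentalDomain.mk' hDm.nullMeasurableSet hD) hf

end FundamentalDomain

end Nilmanifold

end

noncomputable section

namespace Nilmanifold

/-! ### Smooth functions on the quotient and their integral -/

section L2

open MeasureTheory Topology

variable {E : Type*} [NormedAddCommGroup E] [NormedSpace ℝ E] [FiniteDimensional ℝ E]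
  {G : Type*} [TopologicalSpace G] [ChartedSpace E G] [Group G] [LieGroup 𝓘(ℝ, E) ∞ G]
  {Γ : Subgroup G}

/-- Evaluation of a smooth function at a point. -/
def evalFun (Γ : Subgroup G) (x : G) : SmoothFun E Γ →ₗ[ℂ] ℂ where
  toFun f := f.1 x
  map_add' _ _ := rfl
  map_smul' _ _ := rfl

theorem SmoothFun.ext {f g : SmoothFun E Γ} (hfg : ∀ x, evalFun Γ x f = evalFun Γ x g) : f = g :=
  Subtype.ext (funext hfg)

theorem evalFun_mul (x : G) (f g : SmoothFun E Γ) :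
    evalFun Γ x (f * g) = evalFun Γ x f * evalFun Γ x g := rfl

theorem evalFun_one (x : G) : evalFun Γ x (1 : SmoothFun E Γ) = 1 := rfl

theorem evalFun_contMDiff (f : SmoothFun E Γ) :
    ContMDiff 𝓘(ℝ, E) 𝓘(ℝ, ℂ) ∞ (fun x => evalFun Γ x f) := f.2.1

theorem evalFun_continuous (f : SmoothFun E Γ) : Continuous (fun x => evalFun Γ x f) :=
  f.2.1.continuous

theorem evalFun_smul (f : SmoothFun E Γ) (γ : Γ) (x : G) :
    evalFun Γ (γ • x) f = evalFun Γ x f := f.2.2 γ γ.2 x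

/-- The complex conjugate of a smooth function. -/
def conjFun (f : SmoothFun E Γ) : SmoothFun E Γ :=
  ⟨fun x => starRingEnd ℂ (f.1 x),
    (Complex.conjCLE.contDiff (𝕜 := ℝ)).contMDiff.comp f.2.1,
    fun γ hγ x => congrArg (starRingEnd ℂ) (f.2.2 γ hγ x)⟩

theorem evalFun_conjFun (x : G) (f : SmoothFun E Γ) :
    evalFun Γ x (conjFun f) = starRingEnd ℂ (evalFun Γ x f) := rfl

theorem invDeriv_conjFun (v : GroupLieAlgebra 𝓘(ℝ, E) G) (f : SmoothFun E Γ) :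
    invDeriv Γ v (conjFun f) = conjFun (invDeriv Γ v f) := by
  refine SmoothFun.ext fun x => ?_
  have hf : MDifferentiableAt 𝓘(ℝ, E) 𝓘(ℝ, ℂ) (fun y => evalFun Γ y f) x :=
    (evalFun_contMDiff f).mdifferentiableAt (by simp)
  have h1 := (((Complex.conjCLE : ℂ →L[ℝ] ℂ).hasMFDerivAt).comp x hf.hasMFDerivAt).mfderiv
  exact DFunLike.congr_fun h1 _

theorem invDeriv_mul (v : GroupLieAlgebra 𝓘(ℝ, E) G) (f g : SmoothFun E Γ) :
    invDeriv Γ v (f * g) = invDeriv Γ v f * g + f * invDeriv Γ v g := by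
  refine SmoothFun.ext fun x => ?_
  have hf : MDifferentiableAt 𝓘(ℝ, E) 𝓘(ℝ, ℂ) (fun y => evalFun Γ y f) x :=
    (evalFun_contMDiff f).mdifferentiableAt (by simp)
  have hg : MDifferentiableAt 𝓘(ℝ, E) 𝓘(ℝ, ℂ) (fun y => evalFun Γ y g) x :=
    (evalFun_contMDiff g).mdifferentiableAt (by simp)
  have h1 := DFunLike.congr_fun (hf.hasMFDerivAt.mul hg.hasMFDerivAt).mfderiv
    (mulInvariantVectorField v x)
  refine h1.trans ?_
  rw [map_add, evalFun_mul, evalFun_mul, add_comm, mul_comm (evalFun Γ x (invDeriv Γ v f))]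
  rfl

theorem mfderiv_mulInvariantVectorField (v : GroupLieAlgebra 𝓘(ℝ, E) G) {f : G → ℂ}
    (hf : ContMDiff 𝓘(ℝ, E) 𝓘(ℝ, ℂ) ∞ f) (y : G) :
    (mfderiv 𝓘(ℝ, E) 𝓘(ℝ, ℂ) f y (mulInvariantVectorField v y) : ℂ) =
      mfderiv 𝓘(ℝ, E) 𝓘(ℝ, ℂ) (fun z => f (y * z)) 1 v := by
  have h1 := mfderiv_comp (I := 𝓘(ℝ, E)) (I' := 𝓘(ℝ, E)) (I'' := 𝓘(ℝ, ℂ)) (1 : G)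
    (g := f) (f := fun z : G => y * z) (hf.mdifferentiableAt (by simp))
    ((contMDiff_mul_left (n := ∞)).mdifferentiableAt (by simp))
  have h2 := DFunLike.congr_fun h1 v
  have h3 : ∀ (a b : G) (_ : a = b) (w : E), (mfderiv 𝓘(ℝ, E) 𝓘(ℝ, ℂ) f a : E →L[ℝ] ℂ) w =
      (mfderiv 𝓘(ℝ, E) 𝓘(ℝ, ℂ) f b : E →L[ℝ] ℂ) w := by
    rintro a _ rfl w
    rfl
  exact (h3 y (y * 1) (mul_one y).symm _).trans h2.symm

/-- Left-invariant vector fields are invariant under left translations. -/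
theorem mfderiv_comp_mul_left (v : GroupLieAlgebra 𝓘(ℝ, E) G) {f : G → ℂ}
    (hf : ContMDiff 𝓘(ℝ, E) 𝓘(ℝ, ℂ) ∞ f) (x y : G) :
    (mfderiv 𝓘(ℝ, E) 𝓘(ℝ, ℂ) (fun z => f (x * z)) y (mulInvariantVectorField v y) : ℂ) =
      mfderiv 𝓘(ℝ, E) 𝓘(ℝ, ℂ) f (x * y) (mulInvariantVectorField v (x * y)) := by
  have hg : ContMDiff 𝓘(ℝ, E) 𝓘(ℝ, ℂ) ∞ (fun z => f (x * z)) := hf.comp contMDiff_mul_left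
  refine (mfderiv_mulInvariantVectorField v hg y).trans
    (Eq.trans ?_ (mfderiv_mulInvariantVectorField v hf (x * y)).symm)
  have e : (fun z => f (x * (y * z))) = fun z => f (x * y * z) := by
    funext z
    rw [mul_assoc]
  exact congrArg (fun F : G → ℂ => (mfderiv 𝓘(ℝ, E) 𝓘(ℝ, ℂ) F 1 : E →L[ℝ] ℂ) v) e

/-- The left translate by x of a local integral curve of X_v through 1 is an integral curve through
x. One time interval thus serves all x and f, as differentiation under the integral requires. -/
theorem exists_curve (v : GroupLieAlgebra 𝓘(ℝ, E) G) : ∃ c : ℝ → G, c 0 = 1 ∧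
    ∃ s ∈ 𝓝 (0 : ℝ), ∀ (f : SmoothFun E Γ) (x : G), ∀ t ∈ s,
      HasDerivAt (fun t => evalFun Γ (x * c t) f) (evalFun Γ (x * c t) (invDeriv Γ v f)) t := by
  have : IsManifold 𝓘(ℝ, E) 1 G := IsManifold.of_le (n := ∞) (by
    exact_mod_cast (le_top : (1 : ℕ∞) ≤ ⊤))
  obtain ⟨c, hc0, hc⟩ := exists_isMIntegralCurveAt_of_contMDiffAt_boundaryless (I := 𝓘(ℝ, E))
    (v := fun x : G => mulInvariantVectorField v x) (x₀ := (1 : G)) 0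
    ((contMDiff_invField v).contMDiffAt.of_le (by exact_mod_cast (le_top : (1 : ℕ∞) ≤ ⊤)))
  obtain ⟨s, hs, hcs⟩ := Filter.eventually_iff_exists_mem.1 hc
  refine ⟨c, hc0, s, hs, fun f x t ht => ?_⟩
  have hg : ContMDiff 𝓘(ℝ, E) 𝓘(ℝ, ℂ) ∞ (fun z => evalFun Γ (x * z) f) :=
    (evalFun_contMDiff f).comp contMDiff_mul_left
  have h1 : MDifferentiableAt 𝓘(ℝ, E) 𝓘(ℝ, ℂ) (fun z => evalFun Γ (x * z) f) (c t) :=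
    hg.mdifferentiableAt (by simp)
  let A : E →L[ℝ] ℂ := mfderiv 𝓘(ℝ, E) 𝓘(ℝ, ℂ) (fun z => evalFun Γ (x * z) f) (c t)
  let w : E := mulInvariantVectorField v (c t)
  have h2 : HasFDerivAt (fun t => evalFun Γ (x * c t) f)
      (A.comp (ContinuousLinearMap.smulRight (1 : ℝ →L[ℝ] ℝ) w)) t :=
    (h1.hasMFDerivAt.comp t (hcs t ht)).hasFDerivAt
  have h3 : A w = evalFun Γ (x * c t) (invDeriv Γ v f) :=
    mfderiv_comp_mul_left v (evalFun_contMDiff f) x (c t)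
  refine h2.hasDerivAt.congr_deriv ?_
  simpa using h3

-- Along an integral curve c of X_v, the integral of f(x c(t)) is independent of t by right
-- invariance; its derivative at t = 0 is the integral of X_v f. This takes the place of Stokes'
-- theorem.
variable (Γ) in
theorem exists_integral [T2Space G] [PreconnectedSpace G] [DiscreteTopology Γ]
    [CompactSpace (Quotient (QuotientGroup.rightRel Γ))] :
    ∃ I : SmoothFun E Γ →ₗ[ℂ] ℂ, (∀ v f, I (invDeriv Γ v f) = 0) ∧
      (∀ f, I (conjFun f) = starRingEnd ℂ (I f)) ∧
      ∀ f, 0 ≤ (I (conjFun f * f)).re ∧ ((I (conjFun f * f)).re = 0 → f = 0) := by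
  have : IsTopologicalGroup G := topologicalGroup_of_lieGroup 𝓘(ℝ, E) ∞
  have : LocallyCompactSpace G := Manifold.locallyCompact_of_finiteDimensional 𝓘(ℝ, E)
  have : SigmaCompactSpace G := sigmaCompactSpace_of_connected
  have : SecondCountableTopology G := ChartedSpace.secondCountable_of_sigmaCompact E G
  have : Countable Γ := countable_of_Lindelof_of_discrete
  let _ : MeasurableSpace G := borel G
  have : BorelSpace G := ⟨rfl⟩
  obtain ⟨D, hDm, hD, K, hK, hDK⟩ := exists_fundamentalDomain Γ
  let μ : Measure G := Measure.haar
  have hfin : μ D ≠ ⊤ := ((measure_mono hDK).trans_lt hK.measure_lt_top).ne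
  have hdom : IsFundamentalDomain Γ D μ := IsFundamentalDomain.mk' hDm.nullMeasurableSet hD
  have hintg : ∀ f : G → ℂ, Continuous f → IntegrableOn f D μ := fun f hf =>
    (hf.continuousOn.integrableOn_compact hK).mono_set hDK
  -- Every Γ-orbit meets the compact set K, so invariant continuous functions are bounded on all of
  -- G, including at the translated points x c(t).
  have hbound : ∀ f : SmoothFun E Γ, ∃ C, ∀ x, ‖evalFun Γ x f‖ ≤ C := by
    intro f
    obtain ⟨C, hC⟩ := hK.exists_bound_of_continuousOn (evalFun_continuous f).continuousOn
    refine ⟨C, fun x => ?_⟩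
    obtain ⟨γ, hγ, -⟩ := hD x
    rw [← evalFun_smul f γ x]
    exact hC _ (hDK hγ)
  let I : SmoothFun E Γ →ₗ[ℂ] ℂ :=
    { toFun := fun f => ∫ x in D, evalFun Γ x f ∂μ
      map_add' := fun f g => by
        simp only [map_add]
        exact integral_add (hintg _ (evalFun_continuous f)) (hintg _ (evalFun_continuous g))
      map_smul' := fun c f => by
        simp only [map_smul]
        exact integral_smul c _ }
  have hI : ∀ f, I f = ∫ x in D, evalFun Γ x f ∂μ := fun f => rfl
  refine ⟨I, fun v f => ?_, fun f => ?_, fun f => ?_⟩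
  · obtain ⟨c, hc0, s, hs, hcs⟩ := exists_curve (Γ := Γ) v
    obtain ⟨C, hC⟩ := hbound (invDeriv Γ v f)
    have hcont : ∀ (g : SmoothFun E Γ) (y : G), Continuous fun x => evalFun Γ (x * y) g :=
      fun g y => (evalFun_continuous g).comp (continuous_mul_const y)
    have h1 := (hasDerivAt_integral_of_dominated_loc_of_deriv_le (μ := μ.restrict D) (𝕜 := ℝ)
      (F := fun t x => evalFun Γ (x * c t) f)
      (F' := fun t x => evalFun Γ (x * c t) (invDeriv Γ v f)) (bound := fun _ => C) hs
      (Filter.Eventually.of_forall fun t => (hcont f (c t)).aestronglyMeasurable)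
      (hintg _ (hcont f (c 0))) (hcont _ (c 0)).aestronglyMeasurable
      (Filter.Eventually.of_forall fun x t _ => hC _)
      (integrableOn_const hfin)
      (Filter.Eventually.of_forall fun x t ht => hcs f x t ht)).2
    have h2 : (fun t => ∫ x in D, evalFun Γ (x * c t) f ∂μ) = fun _ => ∫ x in D, evalFun Γ x f ∂μ :=
      funext fun t => setIntegral_mul_right (f := fun x => evalFun Γ x f) hDm hD hfin (c t)
        (fun γ x => evalFun_smul f γ x)
    rw [h2] at h1
    have h3 := h1.unique (hasDerivAt_const (0 : ℝ) _)
    simp only [hc0, mul_one] at h3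
    exact h3
  · rw [hI, hI, ← integral_conj]
    rfl
  · have h1 : (I (conjFun f * f)) = ((∫ x in D, Complex.normSq (evalFun Γ x f) ∂μ : ℝ) : ℂ) := by
      rw [hI, ← integral_complex_ofReal]
      refine integral_congr_ae (Filter.Eventually.of_forall fun x => ?_)
      simp only [evalFun_mul, evalFun_conjFun, Complex.normSq_eq_conj_mul_self]
    rw [h1, Complex.ofReal_re]
    refine ⟨integral_nonneg fun x => Complex.normSq_nonneg _, fun h0 => ?_⟩
    have hcont : Continuous fun x => Complex.normSq (evalFun Γ x f) :=
      Complex.continuous_normSq.comp (evalFun_continuous f)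
    rw [integral_eq_zero_iff_of_nonneg (fun x => Complex.normSq_nonneg _)
      ((hcont.continuousOn.integrableOn_compact hK).mono_set hDK)] at h0
    -- The nonvanishing set is open and Γ-invariant. Being null on a fundamental domain it is null
    -- in G, and Haar measure charges nonempty open sets.
    set U : Set G := {x | evalFun Γ x f ≠ 0} with hU
    have hUo : IsOpen U := isOpen_ne_fun (evalFun_continuous f) continuous_const
    have h2 : μ (U ∩ D) = 0 := by
      have h3 := (ae_restrict_iff' hDm).1 h0
      refine measure_mono_null ?_ h3
      rintro x ⟨hx, hxD⟩ hx'
      exact hx (Complex.normSq_eq_zero.1 (hx' hxD))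
    have h4 : μ U = 0 := by
      refine hdom.measure_zero_of_invariant U (fun γ => ?_) h2
      ext x
      rw [Set.mem_smul_set_iff_inv_smul_mem]
      simp only [hU, Set.mem_ofPred_eq, evalFun_smul]
    have h5 : U = ∅ := (hUo.measure_eq_zero_iff μ).1 h4
    refine SmoothFun.ext fun x => ?_
    rw [map_zero]
    by_contra hx
    have : x ∈ U := hx
    rw [h5] at this
    exact this

end L2

end Nilmanifold

end

noncomputable section

namespace Nilmanifold

/-! ### Positive definite Hermitian forms -/

section Hermitian

theorem exists_tensor_form {V W : Type*} [AddCommGroup V] [Module ℂ V] [AddCommGroup W]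
    [Module ℂ W] (cV : InnerProductSpace.Core ℂ V) (cW : InnerProductSpace.Core ℂ W) :
    ∃ B : V ⊗[ℂ] W →ₗ⋆[ℂ] V ⊗[ℂ] W →ₗ[ℂ] ℂ,
      (∀ v w v' w', B (v ⊗ₜ w) (v' ⊗ₜ w') = cV.inner v v' * cW.inner w w') ∧
      (∀ x y, starRingEnd ℂ (B x y) = B y x) ∧
      ∀ x, 0 ≤ (B x x).re ∧ ((B x x).re = 0 → x = 0) := by
  let _ : NormedAddCommGroup V := cV.toNormedAddCommGroup
  let _ : InnerProductSpace ℂ V := InnerProductSpace.ofCore cV.toCore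
  let _ : NormedAddCommGroup W := cW.toNormedAddCommGroup
  let _ : InnerProductSpace ℂ W := InnerProductSpace.ofCore cW.toCore
  refine ⟨innerₛₗ ℂ, fun v w v' w' => TensorProduct.inner_tmul ℂ v v' w w',
    fun x y => inner_conj_symm y x, fun x => ⟨inner_self_nonneg (𝕜 := ℂ) (E := V ⊗[ℂ] W) (x := x), fun h0 => ?_⟩⟩
  refine inner_self_eq_zero (𝕜 := ℂ).1 ?_
  rw [← inner_self_ofReal_re (𝕜 := ℂ) x]
  exact congrArg _ h0

variable {W : Type*} [AddCommGroup W] [Module ℂ W] {B : W →ₗ⋆[ℂ] W →ₗ[ℂ] ℂ}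
  {c : ℝ}

theorem adjoint_left (hsymm : ∀ x y, starRingEnd ℂ (B x y) = B y x) {d a : Module.End ℂ W}
    (h : ∀ x y, B x (a y) = c * B (d x) y) (x y : W) : c * B x (d y) = B (a x) y := by
  rw [← hsymm y, h, map_mul, hsymm, Complex.conj_ofReal]

/-- The kernel of the Bott-Chern Laplacian. -/
theorem ker_laplace (hsymm : ∀ x y, starRingEnd ℂ (B x y) = B y x)
    (hpos : ∀ x, 0 ≤ (B x x).re ∧ ((B x x).re = 0 → x = 0)) (hc : 0 < c)
    {d₁ d₂ a₁ a₂ : Module.End ℂ W}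
    (h₁ : ∀ x y, B x (a₁ y) = c * B (d₁ x) y) (h₂ : ∀ x y, B x (a₂ y) = c * B (d₂ x) y) {x : W}
    (hx : (d₁ * d₂ * a₂ * a₁ + a₂ * a₁ * d₁ * d₂ + a₂ * d₁ * a₁ * d₂ + a₁ * d₂ * a₂ * d₁ +
      a₂ * d₂ + a₁ * d₁) x = 0) : d₁ x = 0 ∧ d₂ x = 0 ∧ a₂ (a₁ x) = 0 := by
  have h₁' := adjoint_left hsymm h₁
  have h₂' := adjoint_left hsymm h₂
  -- Paired with x and multiplied by c², each of the six terms becomes a nonnegative multiple of a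
  -- squared norm, so a vanishing sum makes every term vanish.
  have e1 : c * c * B x (d₁ (d₂ (a₂ (a₁ x)))) = B (a₂ (a₁ x)) (a₂ (a₁ x)) := by
    rw [mul_assoc, h₁', h₂']
  have e2 : B x (a₂ (a₁ (d₁ (d₂ x)))) = c * c * B (d₁ (d₂ x)) (d₁ (d₂ x)) := by
    rw [h₂, h₁, mul_assoc]
  have e3 : B x (a₂ (d₁ (a₁ (d₂ x)))) = B (a₁ (d₂ x)) (a₁ (d₂ x)) := by
    rw [h₂, h₁']
  have e4 : B x (a₁ (d₂ (a₂ (d₁ x)))) = B (a₂ (d₁ x)) (a₂ (d₁ x)) := by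
    rw [h₁, h₂']
  have e5 := h₂ x (d₂ x)
  have e6 := h₁ x (d₁ x)
  have e := congrArg (fun y => (c : ℂ) * c * B x y) hx
  simp only [LinearMap.add_apply, Module.End.mul_apply, map_add, map_zero, mul_zero, mul_add, e1,
    e2, e3, e4, e5, e6] at e
  have er := congrArg Complex.re e
  simp only [Complex.add_re, Complex.zero_re, ← Complex.ofReal_mul, Complex.re_ofReal_mul] at er
  have p1 := (hpos (a₂ (a₁ x))).1
  have p2 := (hpos (d₁ (d₂ x))).1
  have p3 := (hpos (a₁ (d₂ x))).1
  have p4 := (hpos (a₂ (d₁ x))).1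
  have p5 := (hpos (d₂ x)).1
  have p6 := (hpos (d₁ x)).1
  have q2 : 0 ≤ c * c * (c * c * (B (d₁ (d₂ x)) (d₁ (d₂ x))).re) := by positivity
  have q3 : 0 ≤ c * c * (B (a₁ (d₂ x)) (a₁ (d₂ x))).re := by positivity
  have q4 : 0 ≤ c * c * (B (a₂ (d₁ x)) (a₂ (d₁ x))).re := by positivity
  have q5 : 0 ≤ c * c * (c * (B (d₂ x) (d₂ x)).re) := by positivity
  have q6 : 0 ≤ c * c * (c * (B (d₁ x) (d₁ x)).re) := by positivity
  have hc3 : c * c * c ≠ 0 := by positivity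
  refine ⟨(hpos _).2 ?_, (hpos _).2 ?_, (hpos _).2 (by linarith)⟩
  · have : c * c * c * (B (d₁ x) (d₁ x)).re = 0 := by
      rw [mul_assoc]
      linarith
    exact (mul_eq_zero.1 this).resolve_left hc3
  · have : c * c * c * (B (d₂ x) (d₂ x)).re = 0 := by
      rw [mul_assoc]
      linarith
    exact (mul_eq_zero.1 this).resolve_left hc3

end Hermitian

/-! ### Products of forms and bidegrees -/

section Products

variable {L : Type*} [LieRing L] [LieAlgebra ℝ L] (𝒥 : InvComplexStructure L)

theorem invBidegree_mul_mem {p q r s : ℕ} {σ τ : InvForms L} (hσ : σ ∈ invBidegree 𝒥 p q)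
    (hτ : τ ∈ invBidegree 𝒥 r s) : σ * τ ∈ invBidegree 𝒥 (p + r) (q + s) := by
  -- 1-forms anticommute, and the sign is invisible at the level of subspaces, so the (1,0)- and
  -- (0,1)-factors can be reordered.
  have hle : ∀ S T : Submodule ℂ (CDual L), S.map (ExteriorAlgebra.ι ℂ) *
      T.map (ExteriorAlgebra.ι ℂ) ≤ T.map (ExteriorAlgebra.ι ℂ) * S.map (ExteriorAlgebra.ι ℂ) := by
    intro S T
    rw [Submodule.mul_le]
    rintro _ ⟨φ, hφ, rfl⟩ _ ⟨ψ, hψ, rfl⟩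
    rw [eq_neg_of_add_eq_zero_left (ExteriorAlgebra.ι_add_mul_swap (R := ℂ) φ ψ)]
    exact neg_mem (Submodule.mul_mem_mul ⟨ψ, hψ, rfl⟩ ⟨φ, hφ, rfl⟩)
  have hcomm : Commute ((forms01 𝒥).map (ExteriorAlgebra.ι ℂ))
      ((forms10 𝒥).map (ExteriorAlgebra.ι ℂ)) := le_antisymm (hle _ _) (hle _ _)
  have h1 := Submodule.mul_mem_mul hσ hτ
  have h2 : invBidegree 𝒥 p q * invBidegree 𝒥 r s = invBidegree 𝒥 (p + r) (q + s) := by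
    simp only [invBidegree]
    rw [mul_assoc, ← mul_assoc _ _ (_ ^ s), (hcomm.pow_pow q r).eq, mul_assoc, ← pow_add,
      ← mul_assoc, ← pow_add]
  rwa [h2] at h1

end Products

/-! ### The `L²` product on forms and the adjoints of `∂` and `∂̄` -/

section Adjoints

open CliffordAlgebra (contractLeft involute)

variable {E : Type*} [NormedAddCommGroup E] [NormedSpace ℝ E] [FiniteDimensional ℝ E]
  {G : Type*} [TopologicalSpace G] [ChartedSpace E G] [Group G] [LieGroup 𝓘(ℝ, E) ∞ G]
  {Γ : Subgroup G}

/-- The `L²` product of smooth functions. -/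
@[reducible] def smoothCore (I : SmoothFun E Γ →ₗ[ℂ] ℂ)
    (hconj : ∀ f, I (conjFun f) = starRingEnd ℂ (I f))
    (hpos : ∀ f, 0 ≤ (I (conjFun f * f)).re ∧ ((I (conjFun f * f)).re = 0 → f = 0)) :
    InnerProductSpace.Core ℂ (SmoothFun E Γ) where
  inner f g := I (conjFun f * g)
  conj_inner_symm f g := by
    rw [← hconj]
    congr 1
    refine SmoothFun.ext fun x => ?_
    simp [evalFun_mul, evalFun_conjFun, mul_comm]
  re_inner_nonneg f := (hpos f).1
  add_left f g k := by
    rw [← map_add]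
    congr 1
    refine SmoothFun.ext fun x => ?_
    simp [evalFun_mul, evalFun_conjFun, add_mul]
  smul_left f g r := by
    refine Eq.trans (congrArg I ?_) ((map_smul I (starRingEnd ℂ r) (conjFun f * g)).trans
      (smul_eq_mul _ _))
    refine SmoothFun.ext fun x => ?_
    simp [evalFun_mul, evalFun_conjFun, mul_assoc]
  definite f h0 := (hpos f).2 (by rw [h0, Complex.zero_re])

/-- Integration by parts; no conjugate appears on the field because it is real. -/
theorem integral_invDeriv_mul {I : SmoothFun E Γ →ₗ[ℂ] ℂ}
    (hI : ∀ v f, I (invDeriv Γ v f) = 0) (v : GroupLieAlgebra 𝓘(ℝ, E) G) (f g : SmoothFun E Γ) :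
    I (conjFun f * invDeriv Γ v g) = -I (conjFun (invDeriv Γ v f) * g) := by
  have h1 := hI v (conjFun f * g)
  rw [invDeriv_mul, map_add, invDeriv_conjFun] at h1
  exact eq_neg_of_add_eq_zero_right h1

theorem conjForm_pr10_coframe {L : Type*} [LieRing L] [LieAlgebra ℝ L] [Module.Finite ℝ L]
    (𝒥 : InvComplexStructure L) (a : Fin (Module.finrank ℝ L)) :
    conjForm (pr10 𝒥 (coframe L a)) = pr01 𝒥 (coframe L a) := by
  ext v
  simp [pr10_apply, pr01_apply, coframe, map_ofNat]

theorem conjForm_pr01_coframe {L : Type*} [LieRing L] [LieAlgebra ℝ L] [Module.Finite ℝ L]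
    (𝒥 : InvComplexStructure L) (a : Fin (Module.finrank ℝ L)) :
    conjForm (pr01 𝒥 (coframe L a)) = pr10 𝒥 (coframe L a) := by
  rw [← conjForm_pr10_coframe, conjForm_conjForm]

variable {𝒥 : InvComplexStructure (GroupLieAlgebra 𝓘(ℝ, E) G)}

theorem raisesLeft_wedgeLeft {φ : CDual (GroupLieAlgebra 𝓘(ℝ, E) G)} (hφ : φ ∈ forms10 𝒥) :
    RaisesLeft (invProj 𝒥) (wedgeLeft φ) :=
  ⟨fun q => LinearMap.ext fun σ => invProj_zero_ι_mul10 hφ q σ,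
    fun p q => LinearMap.ext fun σ => invProj_succ_ι_mul10 hφ p q σ⟩

theorem raisesRight_wedgeLeft {φ : CDual (GroupLieAlgebra 𝓘(ℝ, E) G)} (hφ : φ ∈ forms01 𝒥) :
    RaisesRight (invProj 𝒥) (wedgeLeft φ) :=
  ⟨fun p => LinearMap.ext fun σ => invProj_zero_ι_mul01 hφ p σ,
    fun p q => LinearMap.ext fun σ => invProj_succ_ι_mul01 hφ p q σ⟩

theorem RaisesLeft.map {A : Module.End ℂ (InvForms (GroupLieAlgebra 𝓘(ℝ, E) G))}
    (hA : RaisesLeft (invProj 𝒥) A) (X : Module.End ℂ (SmoothFun E Γ)) :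
    RaisesLeft (proj Γ 𝒥) (TensorProduct.map X A) :=
  ⟨fun q => TensorProduct.ext' fun f σ =>
      (congrArg (fun τ => X f ⊗ₜ[ℂ] τ) (DFunLike.congr_fun (hA.zero q) σ)).trans
        (TensorProduct.tmul_zero _ _),
    fun p q => TensorProduct.ext' fun f σ =>
      congrArg (fun τ => X f ⊗ₜ[ℂ] τ) (DFunLike.congr_fun (hA.succ p q) σ)⟩

theorem RaisesRight.map {A : Module.End ℂ (InvForms (GroupLieAlgebra 𝓘(ℝ, E) G))}
    (hA : RaisesRight (invProj 𝒥) A) (X : Module.End ℂ (SmoothFun E Γ)) :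
    RaisesRight (proj Γ 𝒥) (TensorProduct.map X A) :=
  ⟨fun q => TensorProduct.ext' fun f σ =>
      (congrArg (fun τ => X f ⊗ₜ[ℂ] τ) (DFunLike.congr_fun (hA.zero q) σ)).trans
        (TensorProduct.tmul_zero _ _),
    fun p q => TensorProduct.ext' fun f σ =>
      congrArg (fun τ => X f ⊗ₜ[ℂ] τ) (DFunLike.congr_fun (hA.succ p q) σ)⟩

theorem invProj_mul (p q p' q' : ℕ) : invProj 𝒥 p q * invProj 𝒥 p' q' =
    if p = p' ∧ q = q' then invProj 𝒥 p q else 0 := by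
  refine LinearMap.ext fun σ => (invProj_invProj p q p' q' σ).trans ?_
  split_ifs <;> rfl

theorem proj_mul (p q p' q' : ℕ) : proj Γ 𝒥 p q * proj Γ 𝒥 p' q' =
    if p = p' ∧ q = q' then proj Γ 𝒥 p q else 0 := by
  rw [proj, proj, ← LinearMap.lTensor_mul, invProj_mul]
  split_ifs
  · rfl
  · exact LinearMap.lTensor_zero _

variable (h : InvHermitianMetric 𝒥)

theorem sum_invProj_model (h : InvHermitianMetric 𝒥) :
    ∑ p ∈ Finset.range (Module.finrank ℝ E + 1),
      ∑ q ∈ Finset.range (Module.finrank ℝ E + 1), invProj 𝒥 p q = 1 := sum_invProj h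

variable (Γ) in
theorem sum_proj (h : InvHermitianMetric 𝒥) :
    ∑ p ∈ Finset.range (Module.finrank ℝ E + 1),
      ∑ q ∈ Finset.range (Module.finrank ℝ E + 1), proj Γ 𝒥 p q = 1 := by
  have h1 := congrArg (LinearMap.lTensorHom (SmoothFun E Γ)) (sum_invProj_model h)
  simp only [map_sum] at h1
  exact h1.trans (LinearMap.lTensor_id _ _)

variable {h} {Ω : InvForms (GroupLieAlgebra 𝓘(ℝ, E) G)}
  {ζ : CDual (GroupLieAlgebra 𝓘(ℝ, E) G)}

theorem StructureEq.invDel_eq (hs : StructureEq h Ω ζ) :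
    invDel 𝒥 = twistOp h (conjInv Ω) (conjForm ζ) := by
  rw [invDel, hs.ceD_eq]
  exact delOf_add invProj_mul (sum_invProj_model h) hs.raisesLeft hs.raisesRight

theorem StructureEq.invDelbar_eq (hs : StructureEq h Ω ζ) : invDelbar 𝒥 = twistOp h Ω ζ := by
  rw [invDelbar, hs.ceD_eq]
  exact delbarOf_add invProj_mul (sum_invProj_model h) hs.raisesLeft hs.raisesRight

end Adjoints

end Nilmanifold

end

noncomputable section

namespace Nilmanifold

open CliffordAlgebra (contractLeft involute)

variable {E : Type*} [NormedAddCommGroup E] [NormedSpace ℝ E] [FiniteDimensional ℝ E]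
  {G : Type*} [TopologicalSpace G] [ChartedSpace E G] [Group G] [LieGroup 𝓘(ℝ, E) ∞ G]
  {Γ : Subgroup G} {𝒥 : InvComplexStructure (GroupLieAlgebra 𝓘(ℝ, E) G)}

local notation "𝔤" => GroupLieAlgebra 𝓘(ℝ, E) G

/-! ### `∂` and `∂̄` in terms of the structure equation -/

section Operators

variable (Γ) (h : InvHermitianMetric 𝒥)

/-- The operator `∑ X_a ⊗ (φ_a ∧ ·) + 1 ⊗ (Ω ∧ ι_{ζ^♯})`. -/
def twistedDeriv (φ : Fin (Module.finrank ℝ 𝔤) → CDual 𝔤) (Ω : InvForms 𝔤)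
    (ζ : CDual 𝔤) :
    Module.End ℂ (Forms E Γ) :=
  ∑ a, TensorProduct.map (invDeriv Γ (frame 𝔤 a)) (wedgeLeft (φ a)) +
    TensorProduct.map LinearMap.id (twistOp h Ω ζ)

variable {h} {Ω : InvForms (GroupLieAlgebra 𝓘(ℝ, E) G)}
  {ζ : CDual (GroupLieAlgebra 𝓘(ℝ, E) G)}

theorem twistedDeriv_tmul (φ : Fin (Module.finrank ℝ 𝔤) → CDual 𝔤) (f : SmoothFun E Γ)
    (σ : InvForms 𝔤) : twistedDeriv Γ h φ Ω ζ (f ⊗ₜ σ) =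
      ∑ a, invDeriv Γ (frame 𝔤 a) f ⊗ₜ[ℂ] (wedgeLeft (φ a) σ) + f ⊗ₜ[ℂ] twistOp h Ω ζ σ := by
  rw [twistedDeriv, LinearMap.add_apply, LinearMap.sum_apply]
  rfl

theorem StructureEq.extD_eq (hs : StructureEq h Ω ζ) :
    extD Γ = twistedDeriv Γ h (fun a => pr10 𝒥 (coframe 𝔤 a)) (conjInv Ω) (conjForm ζ) +
      twistedDeriv Γ h (fun a => pr01 𝒥 (coframe 𝔤 a)) Ω ζ := by
  have hw : ∀ a, wedgeLeft (coframe 𝔤 a) =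
      wedgeLeft (pr10 𝒥 (coframe 𝔤 a)) + wedgeLeft (pr01 𝒥 (coframe 𝔤 a)) := by
    intro a
    refine LinearMap.ext fun σ => ?_
    change ExteriorAlgebra.ι ℂ _ * σ = ExteriorAlgebra.ι ℂ _ * σ + ExteriorAlgebra.ι ℂ _ * σ
    rw [← add_mul, ← map_add, pr10_add_pr01]
  refine TensorProduct.ext' fun f σ => ?_
  rw [LinearMap.add_apply, twistedDeriv_tmul, twistedDeriv_tmul, extD, LinearMap.add_apply,
    LinearMap.sum_apply, LinearMap.lTensor_tmul, hs.ceD_eq, LinearMap.add_apply,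
    TensorProduct.tmul_add, add_add_add_comm, ← Finset.sum_add_distrib]
  congr 1
  refine Finset.sum_congr rfl fun a _ => ?_
  rw [TensorProduct.map_tmul, hw, LinearMap.add_apply, TensorProduct.tmul_add]

theorem StructureEq.raisesLeft_twistedDeriv (hs : StructureEq h Ω ζ) :
    RaisesLeft (proj Γ 𝒥)
      (twistedDeriv Γ h (fun a => pr10 𝒥 (coframe 𝔤 a)) (conjInv Ω) (conjForm ζ)) :=
  (RaisesLeft.sum _ fun _ => (raisesLeft_wedgeLeft (pr10_mem _)).map _).add (hs.raisesLeft.map _)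

theorem StructureEq.raisesRight_twistedDeriv (hs : StructureEq h Ω ζ) :
    RaisesRight (proj Γ 𝒥) (twistedDeriv Γ h (fun a => pr01 𝒥 (coframe 𝔤 a)) Ω ζ) :=
  (RaisesRight.sum _ fun _ => (raisesRight_wedgeLeft (pr01_mem _)).map _).add
    (hs.raisesRight.map _)

theorem StructureEq.del_eq (hs : StructureEq h Ω ζ) : del Γ 𝒥 =
    twistedDeriv Γ h (fun a => pr10 𝒥 (coframe 𝔤 a)) (conjInv Ω) (conjForm ζ) := by
  rw [del, hs.extD_eq]
  exact delOf_add proj_mul (sum_proj Γ h) (hs.raisesLeft_twistedDeriv Γ)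
    (hs.raisesRight_twistedDeriv Γ)

theorem StructureEq.delbar_eq (hs : StructureEq h Ω ζ) : delbar Γ 𝒥 =
    twistedDeriv Γ h (fun a => pr01 𝒥 (coframe 𝔤 a)) Ω ζ := by
  rw [delbar, hs.extD_eq]
  exact delbarOf_add proj_mul (sum_proj Γ h) (hs.raisesLeft_twistedDeriv Γ)
    (hs.raisesRight_twistedDeriv Γ)

end Operators

/-! ### Adjoints -/

section Adjoint

variable {h : InvHermitianMetric 𝒥} {Ω : InvForms (GroupLieAlgebra 𝓘(ℝ, E) G)}
  {ζ : CDual (GroupLieAlgebra 𝓘(ℝ, E) G)} {c : ℝ}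
  {I : SmoothFun E Γ →ₗ[ℂ] ℂ} {B : Forms E Γ →ₗ⋆[ℂ] Forms E Γ →ₗ[ℂ] ℂ}

/-- In the first-order part the sign of integration by parts cancels the one in -* · *; in the
zeroth-order part the sign from `invStar_twistOp_invStar` does. Both parts carry the same factor c.
-/
theorem adjoint_twistedDeriv (hc : ∀ σ, invStar h (invStar h σ) = (c : ℂ) • involute σ)
    (hI : ∀ v f, I (invDeriv Γ v f) = 0)
    (hB : ∀ f σ g τ, B (f ⊗ₜ σ) (g ⊗ₜ τ) = I (conjFun f * g) * hermForm h σ τ)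
    {S T : Submodule ℂ (CDual 𝔤)} (hΩ : Ω ∈ perpForms h S T ζ)
    (φ : Fin (Module.finrank ℝ 𝔤) → CDual 𝔤) (x y : Forms E Γ) :
    B x ((-(hodgeStar Γ h * twistedDeriv Γ h (fun a => conjForm (φ a)) Ω ζ * hodgeStar Γ h)) y) =
      c * B (twistedDeriv Γ h φ (conjInv Ω) (conjForm ζ) x) y := by
  induction y using TensorProduct.induction_on with
  | zero => simp only [map_zero, mul_zero]
  | add y y' hy hy' => simp only [map_add, mul_add, hy, hy']
  | tmul g τ =>
    induction x using TensorProduct.induction_on with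
    | zero => simp only [map_zero, LinearMap.zero_apply, mul_zero]
    | add x x' hx hx' => simp only [map_add, LinearMap.add_apply, mul_add, hx, hx']
    | tmul f σ =>
      have hstar : ∀ (k : SmoothFun E Γ) (ρ : InvForms 𝔤),
          hodgeStar Γ h (k ⊗ₜ ρ) = k ⊗ₜ[ℂ] invStar h ρ := fun _ _ => rfl
      rw [LinearMap.neg_apply, Module.End.mul_apply, Module.End.mul_apply, hstar,
        twistedDeriv_tmul, map_add, map_sum, hstar, invStar_twistOp_invStar hc hΩ]
      simp only [hstar, invStar_wedgeLeft_invStar hc]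
      rw [twistedDeriv_tmul, map_neg, map_add, map_sum, map_add, map_sum, LinearMap.add_apply,
        LinearMap.sum_apply]
      simp only [hB, hermForm_neg_right, hermForm_smul_right, hermForm_twistOp,
        integral_invDeriv_mul hI]
      have hw : ∀ a, hermForm h (wedgeLeft (φ a) σ) τ =
          hermForm h σ (contractLeft (sharp h (conjForm (φ a))) τ) :=
        fun a => hermForm_ι_mul_left h (φ a) σ τ
      simp only [hw, mul_add, neg_add, ← Finset.sum_neg_distrib, Finset.mul_sum]
      congr 1
      · exact Finset.sum_congr rfl fun a _ => by ring
      · ring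

/-- Conjugating the coefficients of ∂ gives those of ∂̄, because the coframe is real. This is why ∂̄
stands between the two Hodge operators in ∂^*. -/
theorem StructureEq.adjoint_del (hs : StructureEq h Ω ζ)
    (hc : ∀ σ, invStar h (invStar h σ) = (c : ℂ) • involute σ)
    (hI : ∀ v f, I (invDeriv Γ v f) = 0)
    (hB : ∀ f σ g τ, B (f ⊗ₜ σ) (g ⊗ₜ τ) = I (conjFun f * g) * hermForm h σ τ)
    (x y : Forms E Γ) : B x (delAdj Γ h y) = c * B (del Γ 𝒥 x) y := by
  have h1 := adjoint_twistedDeriv hc hI hB hs.perp (fun a => pr10 𝒥 (coframe 𝔤 a)) x y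
  simp only [conjForm_pr10_coframe] at h1
  rwa [← hs.del_eq, ← hs.delbar_eq] at h1

theorem StructureEq.adjoint_delbar (hs : StructureEq h Ω ζ)
    (hc : ∀ σ, invStar h (invStar h σ) = (c : ℂ) • involute σ)
    (hI : ∀ v f, I (invDeriv Γ v f) = 0)
    (hB : ∀ f σ g τ, B (f ⊗ₜ σ) (g ⊗ₜ τ) = I (conjFun f * g) * hermForm h σ τ)
    (x y : Forms E Γ) : B x (delbarAdj Γ h y) = c * B (delbar Γ 𝒥 x) y := by
  have h1 := adjoint_twistedDeriv hc hI hB hs.conj_perp (fun a => pr01 𝒥 (coframe 𝔤 a)) x y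
  simp only [conjForm_pr01_coframe, conjInv_conjInv, conjForm_conjForm] at h1
  rwa [← hs.del_eq, ← hs.delbar_eq] at h1

end Adjoint

/-! ### Bott-Chern harmonic forms -/

section Harmonic

variable {h : InvHermitianMetric 𝒥} {Ω : InvForms (GroupLieAlgebra 𝓘(ℝ, E) G)}
  {ζ : CDual (GroupLieAlgebra 𝓘(ℝ, E) G)}

theorem ofInv_injective : Function.Injective (ofInv (E := E) Γ) := by
  have hleft : ∀ σ, TensorProduct.lid ℂ (InvForms 𝔤)
      (LinearMap.rTensor (InvForms 𝔤) (evalFun Γ 1) (ofInv Γ σ)) = σ := fun σ =>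
    (TensorProduct.lid_tmul σ _).trans (by rw [evalFun_one, one_smul])
  exact Function.LeftInverse.injective
    (g := fun x => TensorProduct.lid ℂ (InvForms 𝔤)
      (LinearMap.rTensor (InvForms 𝔤) (evalFun Γ 1) x)) hleft

theorem ofInv_mul (σ τ : InvForms 𝔤) : ofInv (E := E) Γ σ * ofInv Γ τ = ofInv Γ (σ * τ) :=
  (Algebra.TensorProduct.tmul_mul_tmul _ _ _ _).trans (by rw [mul_one]; rfl)

theorem delAdj_ofInv (σ : InvForms 𝔤) :
    delAdj Γ h (ofInv Γ σ) = ofInv Γ (-invStar h (invDelbar 𝒥 (invStar h σ))) := by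
  have hstar : ∀ ρ, hodgeStar Γ h (ofInv Γ ρ) = ofInv Γ (invStar h ρ) := fun _ => rfl
  rw [delAdj, LinearMap.neg_apply, Module.End.mul_apply, Module.End.mul_apply, hstar, delbar_ofInv,
    hstar, map_neg]

theorem delbarAdj_ofInv (σ : InvForms 𝔤) :
    delbarAdj Γ h (ofInv Γ σ) = ofInv Γ (-invStar h (invDel 𝒥 (invStar h σ))) := by
  have hstar : ∀ ρ, hodgeStar Γ h (ofInv Γ ρ) = ofInv Γ (invStar h ρ) := fun _ => rfl
  rw [delbarAdj, LinearMap.neg_apply, Module.End.mul_apply, Module.End.mul_apply, hstar, del_ofInv,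
    hstar, map_neg]

theorem StructureEq.invDel_invDelbar (hs : StructureEq h Ω ζ) (hSKT : IsSKT Γ h)
    (σ : InvForms 𝔤) : invDel 𝒥 (invDelbar 𝒥 σ) = 0 := by
  rw [IsSKT, delbar_ofInv, del_ofInv] at hSKT
  have h1 := ofInv_injective (hSKT.trans (map_zero (ofInv (E := E) Γ)).symm)
  rw [hs.invDel_eq, hs.invDelbar_eq] at h1 ⊢
  exact hs.twistOp_twistOp_eq_zero h1 σ

theorem StructureEq.invDel_mul_eq_zero (hs : StructureEq h Ω ζ) {σ τ : InvForms 𝔤}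
    (hσ : invDel 𝒥 σ = 0) (hτ : invDel 𝒥 τ = 0) : invDel 𝒥 (σ * τ) = 0 := by
  rw [hs.invDel_eq] at *
  rw [twistOp_mul hs.conj_perp, hσ, hτ, zero_mul, mul_zero, add_zero]

theorem StructureEq.invDelbar_mul_eq_zero (hs : StructureEq h Ω ζ) {σ τ : InvForms 𝔤}
    (hσ : invDelbar 𝒥 σ = 0) (hτ : invDelbar 𝒥 τ = 0) : invDelbar 𝒥 (σ * τ) = 0 := by
  rw [hs.invDelbar_eq] at *
  rw [twistOp_mul hs.perp, hσ, hτ, zero_mul, mul_zero, add_zero]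

/-- Every Bott-Chern class is represented by an invariant form. -/
theorem exists_invariant_representative (hBC : BCComputedByInvForms Γ 𝒥) {p q : ℕ}
    {α : Forms E Γ} (hα : α ∈ bidegree Γ 𝒥 p q) (h₁ : del Γ 𝒥 α = 0) (h₂ : delbar Γ 𝒥 α = 0) :
    ∃ σ ∈ invBidegree 𝒥 p q, invDel 𝒥 σ = 0 ∧ invDelbar 𝒥 σ = 0 ∧
      ∃ γ, del Γ 𝒥 (delbar Γ 𝒥 γ) = ofInv Γ σ - α := by
  let α' : bcClosed (bidegree Γ 𝒥 p q) (del Γ 𝒥) (delbar Γ 𝒥) := ⟨α, ⟨hα, h₁⟩, h₂⟩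
  obtain ⟨t, ht⟩ := (hBC p q).2 (Submodule.Quotient.mk α')
  obtain ⟨⟨σ, ⟨hσ, hσ₁⟩, hσ₂⟩, rfl⟩ := Submodule.Quotient.mk_surjective _ t
  obtain ⟨-, γ, hγ⟩ := (Submodule.Quotient.eq _).1 ht
  exact ⟨σ, hσ, hσ₁, hσ₂, γ, hγ⟩

theorem laplaceBC_eq_zero {α : Forms E Γ} (h₁ : del Γ 𝒥 α = 0) (h₂ : delbar Γ 𝒥 α = 0)
    (h₃ : delbarAdj Γ h (delAdj Γ h α) = 0) : laplaceBC Γ h α = 0 := by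
  simp only [laplaceBC, LinearMap.add_apply, Module.End.mul_apply, h₁, h₂, h₃, map_zero, add_zero]

variable [T2Space G] [PreconnectedSpace G] [DiscreteTopology Γ]
  [CompactSpace (Quotient (QuotientGroup.rightRel Γ))]

variable (Γ) in
/-- An `L²` product for which `∂^*` and `∂̄^*` are, up to a factor, the adjoints of `∂` and `∂̄`. -/
theorem StructureEq.exists_hermitian (hs : StructureEq h Ω ζ) :
    ∃ (c : ℝ) (B : Forms E Γ →ₗ⋆[ℂ] Forms E Γ →ₗ[ℂ] ℂ), 0 < c ∧
      (∀ x y, starRingEnd ℂ (B x y) = B y x) ∧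
      (∀ x, 0 ≤ (B x x).re ∧ ((B x x).re = 0 → x = 0)) ∧
      (∀ x y, B x (delAdj Γ h y) = c * B (del Γ 𝒥 x) y) ∧
      ∀ x y, B x (delbarAdj Γ h y) = c * B (delbar Γ 𝒥 x) y := by
  obtain ⟨c, hc0, hc⟩ := exists_invStar_invStar h
  obtain ⟨I, hI, hconj, hpos⟩ := exists_integral (E := E) Γ
  obtain ⟨B, hB, hsymm, hBpos⟩ := exists_tensor_form (smoothCore I hconj hpos) (invCore h)
  exact ⟨c, B, hc0, hsymm, hBpos, hs.adjoint_del hc hI hB, hs.adjoint_delbar hc hI hB⟩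

/-- With τ = ∂̄^*∂^*σ, adjunction gives |τ|² = c²⟨∂∂̄τ, σ⟩. The form τ is again left-invariant, so
∂∂̄τ = 0. -/
theorem StructureEq.delbarAdj_delAdj_ofInv (hs : StructureEq h Ω ζ) (hSKT : IsSKT Γ h)
    (σ : InvForms 𝔤) : delbarAdj Γ h (delAdj Γ h (ofInv Γ σ)) = 0 := by
  obtain ⟨c, B, -, -, hpos, hdel, hdelbar⟩ := hs.exists_hermitian Γ
  refine (hpos _).2 ?_
  rw [hdelbar, hdel, delAdj_ofInv, delbarAdj_ofInv, delbar_ofInv, del_ofInv,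
    hs.invDel_invDelbar hSKT, map_zero, map_zero, LinearMap.zero_apply, mul_zero, mul_zero,
    Complex.zero_re]

/-- For the invariant representative, σ - α = ∂∂̄γ is annihilated by ∂̄^*∂^*, since both σ and α
are. Hence c²|σ - α|² = ⟨γ, ∂̄^*∂^*(σ - α)⟩ = 0. -/
theorem StructureEq.exists_eq_ofInv (hs : StructureEq h Ω ζ) (hSKT : IsSKT Γ h)
    (hBC : BCComputedByInvForms Γ 𝒥) {p q : ℕ} {α : Forms E Γ} (hα : α ∈ harmonicBC Γ h p q) :
    ∃ σ ∈ invBidegree 𝒥 p q, invDel 𝒥 σ = 0 ∧ invDelbar 𝒥 σ = 0 ∧ ofInv Γ σ = α := by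
  obtain ⟨c, B, hc, hsymm, hpos, hdel, hdelbar⟩ := hs.exists_hermitian Γ
  obtain ⟨h₁, h₂, h₃⟩ := ker_laplace hsymm hpos hc hdel hdelbar hα.2
  obtain ⟨σ, hσ, hσ₁, hσ₂, γ, hγ⟩ := exists_invariant_representative hBC hα.1 h₁ h₂
  refine ⟨σ, hσ, hσ₁, hσ₂, sub_eq_zero.1 ?_⟩
  have h0 : delbarAdj Γ h (delAdj Γ h (ofInv Γ σ - α)) = 0 := by
    rw [map_sub, map_sub, hs.delbarAdj_delAdj_ofInv hSKT, h₃, sub_zero]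
  have h4 : (c : ℂ) * (c * B (ofInv Γ σ - α) (ofInv Γ σ - α)) = 0 := by
    conv_lhs => rw [← hγ]
    rw [← hdel, ← hdelbar, hγ, h0, map_zero]
  have hc' : (c : ℂ) ≠ 0 := Complex.ofReal_ne_zero.2 hc.ne'
  refine (hpos _).2 ?_
  rw [(mul_eq_zero.1 ((mul_eq_zero.1 h4).resolve_left hc')).resolve_left hc', Complex.zero_re]

/-- The condition ∂̄^*∂^* = 0, usually the obstruction for a product, is automatic for a
left-invariant form; the other two conditions follow from the Leibniz rule. -/
theorem StructureEq.isGeometricallyBCFormal (hs : StructureEq h Ω ζ) (hSKT : IsSKT Γ h)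
    (hBC : BCComputedByInvForms Γ 𝒥) : IsGeometricallyBCFormal Γ h := by
  intro p q r s α hα β hβ
  obtain ⟨σ, hσ, hσ₁, hσ₂, rfl⟩ := hs.exists_eq_ofInv hSKT hBC hα
  obtain ⟨τ, hτ, hτ₁, hτ₂, rfl⟩ := hs.exists_eq_ofInv hSKT hBC hβ
  rw [ofInv_mul]
  refine ⟨ofInv_mem Γ 𝒥 _ _ _ (invBidegree_mul_mem 𝒥 hσ hτ), laplaceBC_eq_zero ?_ ?_
    (hs.delbarAdj_delAdj_ofInv hSKT _)⟩
  · rw [del_ofInv, hs.invDel_mul_eq_zero hσ₁ hτ₁, map_zero]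
  · rw [delbar_ofInv, hs.invDelbar_mul_eq_zero hσ₂ hτ₂, map_zero]

end Harmonic

end Nilmanifold

end

open Nilmanifold in
theorem mainTheorem4
    {E : Type*} [NormedAddCommGroup E] [NormedSpace ℝ E] [FiniteDimensional ℝ E]
    {G : Type*} [TopologicalSpace G] [T2Space G] [ChartedSpace E G] [Group G]
    [LieGroup 𝓘(ℝ, E) ∞ G] [SimplyConnectedSpace G] [Group.IsNilpotent G]
    (Γ : Subgroup G) [DiscreteTopology Γ]
    [CompactSpace (Quotient (QuotientGroup.rightRel Γ))]
    (𝒥 : InvComplexStructure (GroupLieAlgebra 𝓘(ℝ, E) G))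
    (hBC : BCComputedByInvForms Γ 𝒥)
    (n : ℕ) (η : Module.Basis (Fin n) ℂ (forms10 𝒥))
    (hclosed : ∀ i : Fin n, (i : ℕ) + 1 < n →
      ceD _ (ExteriorAlgebra.ι ℂ (η i : CDual (GroupLieAlgebra 𝓘(ℝ, E) G))) = 0)
    (hlast : ∀ k : Fin n, (k : ℕ) + 1 = n →
      ceD _ (ExteriorAlgebra.ι ℂ (η k : CDual (GroupLieAlgebra 𝓘(ℝ, E) G))) ∈
        Submodule.span ℂ {σ | ∃ i j : Fin n, (i : ℕ) + 1 < n ∧ (j : ℕ) + 1 < n ∧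
          σ = ExteriorAlgebra.ι ℂ (η i : CDual (GroupLieAlgebra 𝓘(ℝ, E) G)) *
            ExteriorAlgebra.ι ℂ (conjForm (η j : CDual (GroupLieAlgebra 𝓘(ℝ, E) G)))})
    (h : InvHermitianMetric 𝒥) (hSKT : IsSKT Γ h) :
    IsGeometricallyBCFormal Γ h := by
  obtain ⟨Ω, ζ, hs⟩ := exists_structureEq h η hclosed hlast
  exact hs.isGeometricallyBCFormal hSKT hBC
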